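/- **Setting.** Let $V$ be a separable real Hilbert space, and let $A,B$ be linear operators on $V$ such that $-A$ and $-B$ are closed, symmetric and positive with compact inverse. Let $S_B$ be the semigroup generated by $B$ and $(-A)^{-\nu}$ the negative fractional powers of $-A$, both given by expansion in a complete orthonormal system of eigenvectors. Let $f,g:V\times V\to V$, let $f$ be bounded, and let $C_1>0$ satisfy $$\|f(x_1,y_1)-f(x_2,y_2)\|+\|g(x_1,y_1)-g(x_2,y_2)\|\le C_1(\|x_1-x_2\|+\|y_1-y_2\|)\quad\text{for all }x_1,x_2,y_1,y_2\in V.$$ Assume $\|S_B(t)\|\le e^{-\lambda_B t}$ for all $t\ge 0$, with a constant $\lambda_B>C_1$. Let $0<\gamma'<H_2<1$. Let $\Omega_2$ be the set of continuous paths $\omega_2:\mathbb R\to V$ with $\omega_2(0)=0$ that are $\gamma'$-Hölder continuous on every compact interval, with the trace of the Borel $\sigma$-algebra of the compact-open topology, and put $\theta_t\omega_2(\cdot)=\omega_2(\cdot+t)-\omega_2(t)$, $t\in\mathbb R$. Let $\mathbb P$ be the law on $\Omega_2$ of a two-sided $V$-valued fractional Brownian motion, i.e. the canonical process $B^{H_2}(t)=\omega_2(t)$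 is Gaussian and centred with $\mathbb E[B^{H_2}(t)\otimes B^{H_2}(s)]=Q_2(|t|^{2H_2}+|s|^{2H_2}-|t-s|^{2H_2})$ for a symmetric positive (semidefinite) operator $Q_2$ of finite trace. For $x\in V$ consider the random dynamical system generated by the mild solutions of $dY=BY\,dt+g(x,Y)\,dt+d\omega_2$, i.e. by $$Y(t)=S_B(t)Y_0+\int_0^tS_B(t-r)g(x,Y(r))\,dr+\omega_2(t)+B\int_0^tS_B(t-r)\omega_2(r)\,dr,\qquad t\ge0.$$ A *tempered random fixed point* is a map $Y_F^1:\Omega_2\times V\to V$, measurable in $\omega_2$ for each $x$, for which there is a measurable $\theta$-invariant set of full measure, independent of $x$, such that for all $\omega_2$ in it and all $x\in V$ the map $t\mapsto Y_F^1(\theta_t\omega_2,x)$ is on $[0,\infty)$ the mild solution with initial value $Y_F^1(\omega_2,x)$, and $|t|^{-1}\log^+\|Y^1_F(\theta_t\omega_2,x)\|\to0$ as $t\to\pm\infty$. Put $\bar f(x)=\mathbb E[f(x,Y^1_F(\omega_2,x))]$. **Lemma.** A tempered random fixed point $Y_F^1$ exists. For every such $Y_F^1$ the function $\bar f$ is Lipschitz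 continuous, and for every $\nu>0$ there is a measurable $\theta$-invariant set $\tilde\Omega_2\subset\Omega_2$ of full measure, which does not depend on $x$, such that for all $\omega_2\in\tilde\Omega_2$ and all $x\in V$ $$\lim_{T\to\pm\infty}\frac1{|T|}\Big\|\int_0^T(-A)^{-\nu}\big(f(x,Y^1_F(\theta_r\omega_2,x))-\bar f(x)\big)\,dr\Big\|=0.$$ -/

import Mathlib

open MeasureTheory ProbabilityTheory Filter Set
open scoped NNReal Topology

universe u

/-! ### Positive symmetric operators with compact inverse -/

/-- The (unbounded) operator `T` on the real Hilbert space `V` is closed, symmetric and positive, and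
it has a compact inverse `K`. -/
structure IsPositiveCompactInverse {V : Type*} [NormedAddCommGroup V] [InnerProductSpace ℝ V]
    (T : V →ₗ.[ℝ] V) : Prop where
  closed : T.IsClosed
  symmetric : ∀ x y : T.domain, inner ℝ (T x) (y : V) = inner ℝ (x : V) (T y)
  positive : ∀ x : T.domain, (x : V) ≠ 0 → 0 < inner ℝ (T x) (x : V)
  compact_inverse : ∃ K : V →L[ℝ] V, IsCompactOperator K ∧
    (∀ v : V, (K v, v) ∈ T.graph) ∧ ∀ x : T.domain, K (T x) = x

/-- A choice of a complete orthonormal system of eigenvectors of `T`, with its eigenvalues. -/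
structure Eigensystem {V : Type*} [NormedAddCommGroup V] [InnerProductSpace ℝ V]
    (T : V →ₗ.[ℝ] V) (ι : Type*) where
  basis : HilbertBasis ι ℝ V
  eigenvalue : ι → ℝ
  eigen : ∀ i, (basis i, eigenvalue i • basis i) ∈ T.graph

/-- Every closed positive symmetric operator with compact inverse has a complete orthonormal
system of eigenvectors, so that `Eigensystem` is never an additional assumption. -/
theorem IsPositiveCompactInverse.exists_eigensystem {V : Type u} [NormedAddCommGroup V]
    [InnerProductSpace ℝ V] [CompleteSpace V] {T : V →ₗ.[ℝ] V}
    (hT : IsPositiveCompactInverse T) :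
    ∃ ι : Type u, Nonempty (Eigensystem T ι) := by
  obtain ⟨K, hK, hKT, -⟩ := hT.compact_inverse
  have hsymm : (K : V →ₗ[ℝ] V).IsSymmetric := by
    intro x y
    obtain ⟨a, ha, ha'⟩ := (LinearPMap.mem_graph_iff _).1 (hKT x)
    obtain ⟨b, hb, hb'⟩ := (LinearPMap.mem_graph_iff _).1 (hKT y)
    have h := hT.symmetric a b
    simp only [] at ha ha' hb hb'
    rw [ha', hb', ha, hb] at h
    exact h.symm
  have hbot := ContinuousLinearMap.orthogonalComplement_iSup_eigenspaces_eq_bot hK hsymm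
  have hcl : ∀ μ : ℝ, CompleteSpace (Module.End.eigenspace (K : Module.End ℝ V) μ) := by
    intro μ
    have : IsClosed ((Module.End.eigenspace (K : Module.End ℝ V) μ : Submodule ℝ V) : Set V) := by
      have he : ((Module.End.eigenspace (K : Module.End ℝ V) μ : Submodule ℝ V) : Set V)
          = {v | K v = μ • v} := by
        ext v
        simp
      rw [he]
      exact isClosed_eq K.continuous (continuous_const_smul μ)
    exact this.completeSpace_coe
  choose w b hb using fun μ : ℝ =>
    exists_hilbertBasis ℝ (Module.End.eigenspace (K : Module.End ℝ V) μ)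
  have hon := hsymm.orthogonalFamily_eigenspaces.orthonormal_sigma_orthonormal
    (fun μ => (b μ).orthonormal)
  have hperp : (Submodule.span ℝ (Set.range fun a : Σ μ : ℝ, w μ =>
      ((b a.1 a.2 : Module.End.eigenspace (K : Module.End ℝ V) a.1) : V)))ᗮ = ⊥ := by
    rw [eq_bot_iff, ← hbot]
    intro x hx
    have hle : (⨆ μ, Module.End.eigenspace (K : Module.End ℝ V) μ) ≤ (ℝ ∙ x)ᗮ := by
      refine iSup_le fun μ y hy => ?_
      rw [Submodule.mem_orthogonal_singleton_iff_inner_right]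
      have h1 := ((b μ).hasSum_repr ⟨y, hy⟩).mapL
        ((innerSL ℝ x).comp (Submodule.subtypeL _))
      have h3 : ∀ i : w μ, inner ℝ x
          ((b μ i : Module.End.eigenspace (K : Module.End ℝ V) μ) : V) = 0 := fun i =>
        (Submodule.mem_orthogonal' _ _).1 hx _ (Submodule.subset_span ⟨⟨μ, i⟩, rfl⟩)
      have h4 : inner ℝ x y = ∑' _ : w μ, (0 : ℝ) := by
        rw [← show _ = inner ℝ x y from h1.tsum_eq]
        refine tsum_congr fun i => ?_
        simp [h3]
      simpa using h4
    rw [Submodule.mem_orthogonal']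
    intro y hy
    exact Submodule.mem_orthogonal_singleton_iff_inner_right.1 (hle hy)
  let B : HilbertBasis (Σ μ : ℝ, w μ) ℝ V := HilbertBasis.mkOfOrthogonalEqBot hon hperp
  have hB : ∀ a : Σ μ : ℝ, w μ,
      B a = ((b a.1 a.2 : Module.End.eigenspace (K : Module.End ℝ V) a.1) : V) := by
    intro a
    exact congrFun (HilbertBasis.coe_mkOfOrthogonalEqBot hon hperp) a
  refine ⟨Σ μ : ℝ, w μ, ⟨⟨B, fun a => a.1⁻¹, fun a => ?_⟩⟩⟩
  have hKa : K (B a) = a.1 • B a := by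
    rw [hB a]
    exact Module.End.mem_eigenspace_iff.1 (b a.1 a.2).2
  have hg := hKT (B a)
  have hne : B a ≠ 0 := B.orthonormal.ne_zero a
  have hμ : a.1 ≠ 0 := by
    intro h0
    rw [hKa, h0, zero_smul] at hg
    exact hne (LinearPMap.graph_fst_eq_zero_snd T hg rfl)
  have h3 := T.graph.smul_mem a.1⁻¹ hg
  rwa [hKa, Prod.smul_mk, smul_smul, inv_mul_cancel₀ hμ, one_smul] at h3

namespace Eigensystem

variable {V : Type*} [NormedAddCommGroup V] [InnerProductSpace ℝ V] {T : V →ₗ.[ℝ] V} {ι : Type*}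

/-- The function `φ(T)` of the operator `T`:
`φ(T) v = ∑ φ(λ i) ⟨e i, v⟩ e i` for the eigenvectors `e i` and the eigenvalues `λ i`. -/
noncomputable def apply (E : Eigensystem T ι) (φ : ℝ → ℝ) (v : V) : V :=
  ∑' i, (φ (E.eigenvalue i) * inner ℝ (E.basis i) v) • E.basis i

/-- The semigroup `exp (-t T)` generated by `-T`. -/
noncomputable def semigroup (E : Eigensystem T ι) (t : ℝ) (v : V) : V :=
  E.apply (fun l => Real.exp (-(t * l))) v

/-- The negative fractional power `T ^ (-ν)`. -/
noncomputable def negPow (E : Eigensystem T ι) (ν : ℝ) (v : V) : V :=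
  E.apply (fun l => l ^ (-ν)) v

end Eigensystem

/-! ### The path space of the noise -/

/-- The space of the continuous paths `ω : ℝ → V` that vanish at zero and are Hölder continuous with
exponent `γ` on every compact interval. -/
def PathSpace (V : Type*) [NormedAddCommGroup V] (γ : ℝ≥0) : Type _ :=
  {ω : C(ℝ, V) // ω 0 = 0 ∧ ∀ a b : ℝ, ∃ C : ℝ≥0, HolderOnWith C γ ω (Icc a b)}

namespace PathSpace

variable {V : Type*} [NormedAddCommGroup V] {γ : ℝ≥0}

instance : CoeFun (PathSpace V γ) (fun _ => ℝ → V) := ⟨fun ω => ω.1⟩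

/-- The trace of the Borel σ-algebra of the compact-open topology. -/
instance : MeasurableSpace (PathSpace V γ) := (borel C(ℝ, V)).comap Subtype.val

/-- The shift `(θ_t ω)(s) = ω (s + t) - ω t`. -/
def shift (t : ℝ) (ω : PathSpace V γ) : PathSpace V γ :=
  ⟨⟨fun s => ω (s + t) - ω t, by have := ω.1.continuous; fun_prop⟩, by
    refine ⟨by simp, fun a b => ?_⟩
    obtain ⟨C, hC⟩ := ω.2.2 (a + t) (b + t)
    refine ⟨C, fun x hx y hy => ?_⟩
    have h := hC (x + t) ⟨by linarith [hx.1], by linarith [hx.2]⟩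
      (y + t) ⟨by linarith [hy.1], by linarith [hy.2]⟩
    simpa [edist_sub_right, edist_add_right] using h⟩

/-- `S` is a measurable set that is invariant under all shifts and has full measure. -/
structure IsInvariantFull (P : Measure (PathSpace V γ)) (S : Set (PathSpace V γ)) : Prop where
  measurableSet : MeasurableSet S
  invariant : ∀ t : ℝ, shift t ⁻¹' S = S
  full : P Sᶜ = 0

end PathSpace

/-- `Q` is a symmetric positive operator of finite trace. -/
structure IsTraceClassCovariance {V : Type*} [NormedAddCommGroup V] [InnerProductSpace ℝ V]
    (Q : V →L[ℝ] V) : Prop where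
  symmetric : ∀ u v : V, inner ℝ (Q u) v = inner ℝ u (Q v)
  nonneg : ∀ v : V, 0 ≤ inner ℝ (Q v) v
  trace : ∃ (w : Set V) (b : HilbertBasis w ℝ V), Summable fun i => inner ℝ (Q (b i)) (b i)

/-- `P` is the law of the two-sided `V`-valued fractional Brownian motion with Hurst parameter `H` and
covariance operator `Q`: under `P` the canonical process `t ↦ ω t` is Gaussian and centred with
`𝔼[B(t) ⊗ B(s)] = (|t|^{2H} + |s|^{2H} - |t-s|^{2H}) Q`. -/
structure IsFBMLaw {V : Type*} [NormedAddCommGroup V] [InnerProductSpace ℝ V] [MeasurableSpace V]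
    {γ : ℝ≥0} (H : ℝ) (Q : V →L[ℝ] V) (P : Measure (PathSpace V γ)) : Prop where
  isProbabilityMeasure : IsProbabilityMeasure P
  gaussian : IsGaussianProcess (fun (t : ℝ) (ω : PathSpace V γ) => ω t) P
  centred : ∀ t : ℝ, ∫ ω : PathSpace V γ, ω t ∂P = 0
  covariance : ∀ (t s : ℝ) (u v : V),
    ∫ ω : PathSpace V γ, inner ℝ (ω t) u * inner ℝ (ω s) v ∂P
      = (|t| ^ (2 * H) + |s| ^ (2 * H) - |t - s| ^ (2 * H)) * inner ℝ (Q u) v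

/-! ### The fast equation and its random fixed point -/

section FastEquation

variable {V : Type*} [NormedAddCommGroup V] [InnerProductSpace ℝ V] {B : V →ₗ.[ℝ] V} {ι : Type*}
  {γ : ℝ≥0}

/-- `y` is, on `[0, ∞)`, the mild solution of `dy = B y dt + G(y) dt + dω` with `y(0) = y₀`:
`y(t) = S_B(t) y₀ + ∫₀ᵗ S_B(t-r) G(y(r)) dr + ω(t) + B ∫₀ᵗ S_B(t-r) ω(r) dr`,
where the last two terms are the stochastic convolution `∫₀ᵗ S_B(t-r) dω(r)`. The vector `w` is the
value of `B` at `∫₀ᵗ S_B(t-r) ω(r) dr`, which has to lie in the domain of `B`. -/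
def IsMildSolution (E : Eigensystem (-B) ι) (G : V → V) (ω : PathSpace V γ) (y₀ : V)
    (y : ℝ → V) : Prop :=
  ContinuousOn y (Ici 0) ∧ ∀ t : ℝ, 0 ≤ t → ∃ w : V,
    (∫ r in (0 : ℝ)..t, E.semigroup (t - r) (ω r), w) ∈ B.graph ∧
    y t = E.semigroup t y₀ + (∫ r in (0 : ℝ)..t, E.semigroup (t - r) (G (y r))) + (ω t + w)

/-- The random variable `X ≥ 0` is tempered along the orbit of `ω`:
`log⁺ X(θ_t ω) / |t| → 0` as `t → ±∞`. -/
def IsTemperedAt (X : PathSpace V γ → ℝ) (ω : PathSpace V γ) : Prop :=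
  Tendsto (fun t : ℝ => Real.posLog (X (PathSpace.shift t ω)) / |t|) atTop (𝓝 0) ∧
  Tendsto (fun t : ℝ => Real.posLog (X (PathSpace.shift t ω)) / |t|) atBot (𝓝 0)

/-- `Y(ω, x)` is, for every `x`, the tempered random fixed point of the random dynamical system
`φ^x` generated by `dy = B y dt + g(x, y) dt + dω`. Since `t ↦ φ^x(t, ω, y₀)` is the mild solution
with initial value `y₀`, the fixed point property `φ^x(t, ω, Y(ω, x)) = Y(θ_t ω, x)`, `t ≥ 0`, says
that `t ↦ Y(θ_t ω, x)` is the mild solution with initial value `Y(ω, x)`. It holds on an invariant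
set of full measure which is the same for all `x`. -/
structure IsRandomFixedPoint [MeasurableSpace V] (E : Eigensystem (-B) ι) (g : V → V → V)
    (P : Measure (PathSpace V γ)) (Y : PathSpace V γ → V → V) : Prop where
  measurable : ∀ x : V, Measurable fun ω => Y ω x
  fixedPoint : ∃ S : Set (PathSpace V γ), PathSpace.IsInvariantFull P S ∧ ∀ ω ∈ S, ∀ x : V,
    IsMildSolution E (g x) ω (Y ω x) (fun t => Y (PathSpace.shift t ω) x) ∧
    IsTemperedAt (fun ω' => ‖Y ω' x‖) ω

/-- The averaged coefficient `f̄(x) = 𝔼[f(x, Y(ω, x))]`. -/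
noncomputable def averagedDrift (f : V → V → V) (P : Measure (PathSpace V γ))
    (Y : PathSpace V γ → V → V) (x : V) : V :=
  ∫ ω : PathSpace V γ, f x (Y ω x) ∂P

end FastEquation

/-! Three facts carry the theorem: the noise is ergodic, its paths grow subexponentially, and the
gap between the decay rate of the semigroup and the Lipschitz constant of `g` makes the fast
dynamics contract.

Noise. Finite-dimensional characteristic functions determine a measure on the path space, so the
covariance formula alone shows that the law is invariant under shifts and under self-similar
rescaling. Covariances of distant increments are second differences of `|d| ^ (2H)`; they vanish at
infinity because `2H < 2`, and for Gaussian processes this forces ergodicity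
(`IsFBMLaw.ergodic_shift`). Fernique's estimate on `[-1, 1]` together with self-similarity gives
Hölder constants of subexponential growth, almost surely (`IsFBMLaw.measure_compl_temperedPaths`).

Fixed point. On these tempered paths the stationary Ornstein–Uhlenbeck process `Z` is defined
pathwise, after an integration by parts that leaves the integrable singularity `s ^ (γ - 1)`.
Writing `Y = U + Z` turns the equation into `U = ∫_{-∞}^0 S(-r) g(x, U + Z) dr`, which contracts in
an exponentially weighted norm. The set of good paths comes from the noise alone and so serves all
`x` at once. For an arbitrary tempered fixed point, a Gronwall estimate started at time `-t`, with
`t → ∞`, shows that `x ↦ Y(ω, x)` is Lipschitz with a deterministic constant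
(`norm_sub_le_of_tempered`). Hence so are `x ↦ f(x, Y(ω, x))` and its mean.

Averages. The pointwise ergodic theorem for bounded real functions is applied to each coordinate of
`f(x, Y(·, x))` for `x` in a countable dense set, in both time directions. The countable
intersection of the resulting invariant sets has full measure, and the Lipschitz bound carries the
limits over to all `x`. This is only weak convergence of bounded averages in `V`. Since the inverse
of `-A` is compact, the eigenvalues of its negative powers tend to zero, and weak convergence
becomes norm convergence (`Eigensystem.tendsto_apply_zero`). The exceptional set does not even
depend on `ν`. -/

set_option linter.unusedSectionVars false

/-! ### Measurability of evaluations and shifts on the path space -/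

namespace PathSpace

variable {V : Type*} [NormedAddCommGroup V] {γ : ℝ≥0}

theorem continuous_coe (ω : PathSpace V γ) : Continuous (ω : ℝ → V) := ω.1.continuous

@[simp] theorem coe_zero (ω : PathSpace V γ) : ω 0 = 0 := ω.2.1

theorem shift_apply (t s : ℝ) (ω : PathSpace V γ) : shift t ω s = ω (s + t) - ω t := rfl

theorem ext_apply {ω ω' : PathSpace V γ} (h : ∀ t, ω t = ω' t) : ω = ω' :=
  Subtype.ext (ContinuousMap.ext h)

theorem shift_shift (s t : ℝ) (ω : PathSpace V γ) : shift s (shift t ω) = shift (s + t) ω := by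
  refine ext_apply fun r => ?_
  simp only [shift_apply]
  rw [add_assoc]
  abel

@[simp] theorem shift_zero (ω : PathSpace V γ) : shift 0 ω = ω := by
  refine ext_apply fun r => ?_
  simp [shift_apply]

/-- A family of continuous functions is measurable for the Borel σ-algebra of the compact-open
topology as soon as all its evaluations are. -/
theorem measurable_continuousMap_of_eval [SecondCountableTopology V] [MeasurableSpace V]
    [BorelSpace V] {α : Type*} [MeasurableSpace α] {F : α → C(ℝ, V)}
    (hF : ∀ t, Measurable fun a => F a t) : Measurable[_, borel C(ℝ, V)] F := by
  rw [borel_eq_generateFrom_of_subbasis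
    (ContinuousMap.compactOpen_eq (X := ℝ) (Y := V))]
  refine measurable_generateFrom ?_
  rintro _ ⟨K, hK, U, hU, rfl⟩
  obtain ⟨D, hDK, hD, hKD⟩ :=
    (TopologicalSpace.IsSeparable.of_separableSpace K).exists_countable_dense_subset
  -- A compact set mapped into `U` keeps a positive distance from the complement of `U`. By
  -- continuity this distance can be tested on a countable dense subset `D` of `K`, which leaves
  -- only countably many evaluations.
  have key : F ⁻¹' {f | MapsTo f K U} =
      ⋃ n : ℕ, ⋂ d ∈ D, {a | ((n : ENNReal) + 1)⁻¹ ≤ Metric.infEDist (F a d) Uᶜ} := by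
    ext a
    simp only [mem_preimage, mem_ofPred_eq, mem_iUnion, mem_iInter]
    constructor
    · intro h
      rcases K.eq_empty_or_nonempty with rfl | hne
      · exact ⟨0, fun d hd => absurd (hDK hd) (by simp)⟩
      obtain ⟨x, hxK, hx⟩ := hK.exists_isMinOn hne (f := fun x => Metric.infEDist (F a x) Uᶜ)
        (Metric.continuous_infEDist.comp (F a).continuous).continuousOn
      have hpos : Metric.infEDist (F a x) Uᶜ ≠ 0 := by
        intro h0
        exact (Metric.mem_iff_infEDist_zero_of_closed hU.isClosed_compl).2 h0 (h hxK)
      obtain ⟨n, hn⟩ := ENNReal.exists_inv_nat_lt hpos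
      refine ⟨n, fun d hd => le_trans ?_ (hx (hDK hd))⟩
      refine le_trans ?_ hn.le
      exact ENNReal.inv_le_inv.2 le_self_add
    · rintro ⟨n, hn⟩ x hx
      have hcl : IsClosed {y | ((n : ENNReal) + 1)⁻¹ ≤ Metric.infEDist (F a y) Uᶜ} :=
        isClosed_le continuous_const (Metric.continuous_infEDist.comp (F a).continuous)
      have hx' := hcl.closure_subset_iff.2 (show D ⊆ _ from hn) (hKD hx)
      by_contra hxU
      have h0 : Metric.infEDist (F a x) Uᶜ = 0 := Metric.infEDist_zero_of_mem hxU
      rw [mem_ofPred_eq, h0] at hx'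
      simp at hx'
  rw [key]
  refine MeasurableSet.iUnion fun n => MeasurableSet.biInter hD fun d _ => ?_
  exact measurableSet_le measurable_const
    (Metric.continuous_infEDist.measurable.comp (hF d))

variable [MeasurableSpace V] [BorelSpace V]

theorem measurable_coe :
    Measurable[_, borel C(ℝ, V)] (fun ω : PathSpace V γ => (ω.1 : C(ℝ, V))) :=
  @comap_measurable _ _ (borel _) _

theorem measurable_eval (t : ℝ) : Measurable fun ω : PathSpace V γ => ω t := by
  let _ : MeasurableSpace C(ℝ, V) := borel _
  have : BorelSpace C(ℝ, V) := ⟨rfl⟩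
  exact (continuous_eval_const (F := C(ℝ, V)) t).measurable.comp measurable_coe

theorem measurableSet_preimage_of_isClosed {F : Set C(ℝ, V)} (hF : IsClosed F) :
    MeasurableSet {ω : PathSpace V γ | ω.1 ∈ F} := by
  let _ : MeasurableSpace C(ℝ, V) := borel _
  have : BorelSpace C(ℝ, V) := ⟨rfl⟩
  exact measurable_coe hF.measurableSet

variable [SecondCountableTopology V]

theorem measurable_of_eval {α : Type*} [MeasurableSpace α] {F : α → PathSpace V γ}
    (hF : ∀ t, Measurable fun a => F a t) : Measurable F :=
  (@measurable_comap_iff _ _ _ _ (borel _) _ _).2 (measurable_continuousMap_of_eval hF)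

theorem measurable_uncurry_eval : Measurable fun p : ℝ × PathSpace V γ => p.2 p.1 :=
  measurable_uncurry_of_continuous_of_measurable
    (u := fun (t : ℝ) (ω : PathSpace V γ) => ω t) (fun ω => ω.continuous_coe) measurable_eval

theorem measurable_shift_uncurry :
    Measurable fun p : ℝ × PathSpace V γ => shift p.1 p.2 := by
  refine measurable_of_eval fun s => ?_
  simp only [shift_apply]
  refine Measurable.sub ?_ measurable_uncurry_eval
  exact measurable_uncurry_eval.comp (f := fun p : ℝ × PathSpace V γ => (s + p.1, p.2))
    (by fun_prop)

theorem measurable_shift (t : ℝ) : Measurable (shift t : PathSpace V γ → PathSpace V γ) :=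
  measurable_shift_uncurry.comp (measurable_const.prodMk measurable_id)

theorem measurable_shift_left (ω : PathSpace V γ) : Measurable fun t => shift t ω :=
  measurable_shift_uncurry.comp (measurable_id.prodMk measurable_const)

end PathSpace

/-! ### Finite-dimensional distributions determine a law on the path space -/

namespace PathSpace

variable {V : Type*} [NormedAddCommGroup V] [InnerProductSpace ℝ V] [CompleteSpace V]
  [MeasurableSpace V] [BorelSpace V] [SecondCountableTopology V] {γ : ℝ≥0}

theorem measurable_pi : Measurable fun (ω : PathSpace V γ) (t : ℝ) => ω t :=
  measurable_pi_lambda _ measurable_eval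

/-- The nontrivial inclusion is `measurable_of_eval` for the identity map, with its source carrying
the σ-algebra generated by the evaluations. -/
theorem measurableSpace_eq_comap_pi :
    (instMeasurableSpace : MeasurableSpace (PathSpace V γ)) =
      MeasurableSpace.comap (fun (ω : PathSpace V γ) (t : ℝ) => ω t) MeasurableSpace.pi := by
  refine le_antisymm ?_ measurable_pi.comap_le
  have h := @measurable_of_eval V _ γ _ _ _ (PathSpace V γ)
    (MeasurableSpace.comap (fun (ω : PathSpace V γ) (t : ℝ) => ω t) MeasurableSpace.pi) id
    (fun t => (measurable_pi_apply t).comp (comap_measurable _))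
  intro s hs
  exact h hs

/-- A finite measure on the path space is determined by the characteristic functions of its
finite-dimensional distributions. -/
theorem measure_ext_of_charFun {μ ν : Measure (PathSpace V γ)} [IsFiniteMeasure μ]
    [IsFiniteMeasure ν]
    (h : ∀ (I : Finset ℝ) (u : I → V),
      ∫ ω : PathSpace V γ, Complex.exp ((∑ t : I, inner ℝ (u t) (ω t) : ℝ) * Complex.I) ∂μ =
      ∫ ω : PathSpace V γ, Complex.exp ((∑ t : I, inner ℝ (u t) (ω t) : ℝ) * Complex.I) ∂ν) :
    μ = ν := by
  have hpi : μ.map (fun (ω : PathSpace V γ) (t : ℝ) => ω t) =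
      ν.map (fun (ω : PathSpace V γ) (t : ℝ) => ω t) := by
    have hμ := isProjectiveLimit_map (X := fun (t : ℝ) (ω : PathSpace V γ) => ω t) (P := μ)
      measurable_pi.aemeasurable
    have hν := isProjectiveLimit_map (X := fun (t : ℝ) (ω : PathSpace V γ) => ω t) (P := ν)
      measurable_pi.aemeasurable
    -- A finite measure on a product is the unique projective limit of its finite marginals, so only
    -- finite sets `I` of times remain. There, functionals on `I → V` are represented by Riesz
    -- vectors `u t`.
    refine hμ.unique ?_
    convert hν using 2 with I
    have hm : Measurable fun ω : PathSpace V γ => I.restrict fun t => ω t :=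
      (Finset.measurable_restrict I).comp measurable_pi
    refine Measure.ext_of_charFunDual ?_
    ext L
    classical
    set u : I → V := fun t => (InnerProductSpace.toDual ℝ V).symm
      (L.comp (ContinuousLinearMap.single ℝ (fun _ : I => V) t)) with hu
    have hL : ∀ x : I → V, L x = ∑ t : I, inner ℝ (u t) (x t) := by
      intro x
      conv_lhs => rw [← Finset.univ_sum_single x]
      rw [map_sum]
      refine Finset.sum_congr rfl fun t _ => ?_
      simp [hu, InnerProductSpace.toDual_symm_apply]
    rw [charFunDual_apply, charFunDual_apply, integral_map hm.aemeasurable (by fun_prop),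
      integral_map hm.aemeasurable (by fun_prop)]
    simp only [hL]
    exact h I u
  ext s hs
  rw [measurableSpace_eq_comap_pi] at hs
  obtain ⟨t, ht, rfl⟩ := hs
  rw [← Measure.map_apply measurable_pi ht, ← Measure.map_apply measurable_pi ht, hpi]

end PathSpace

/-! ### Second differences of powers -/

/-- Mean value theorem twice: the second derivative `α (α - 1) z ^ (α - 2)` is largest at the left
end because `α < 2`, and `hd` keeps every argument above `R`. -/
theorem abs_secondDiff_rpow_le {α : ℝ} (hα : α < 2) {R a b d : ℝ} (hR : 0 < R)
    (hd : R + |a| + |b| ≤ d) :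
    |((d + a) ^ α - d ^ α) - ((d - b + a) ^ α - (d - b) ^ α)| ≤
      |α * (α - 1)| * R ^ (α - 2) * |a| * |b| := by
  have hφ : ∀ (p x : ℝ), 0 < x → HasDerivAt (fun y : ℝ => y ^ p) (p * x ^ (p - 1)) x :=
    fun p x hx => Real.hasDerivAt_rpow_const (Or.inl hx.ne')
  have h1 : ∀ x y, R ≤ x → R ≤ y → |α * y ^ (α - 1) - α * x ^ (α - 1)| ≤
      |α * (α - 1)| * R ^ (α - 2) * |y - x| := by
    intro x y hx hy
    have := (convex_Ici R).norm_image_sub_le_of_norm_hasDerivWithin_le (𝕜 := ℝ)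
      (f := fun z : ℝ => α * z ^ (α - 1)) (f' := fun z => α * ((α - 1) * z ^ (α - 1 - 1)))
      (C := |α * (α - 1)| * R ^ (α - 2))
      (fun z hz => ((hφ (α - 1) z (hR.trans_le hz)).const_mul α).hasDerivWithinAt)
      (fun z hz => by
        have hz0 : 0 < z := hR.trans_le hz
        rw [← mul_assoc, Real.norm_eq_abs, abs_mul, abs_of_nonneg (Real.rpow_nonneg hz0.le _),
          show α - 1 - 1 = α - 2 by ring]
        exact mul_le_mul_of_nonneg_left
          (Real.rpow_le_rpow_of_nonpos hR hz (by linarith)) (abs_nonneg _))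
      (show x ∈ Ici R from hx) (show y ∈ Ici R from hy)
    simpa using this
  have h2 := (convex_Ici (R + |a|)).norm_image_sub_le_of_norm_hasDerivWithin_le (𝕜 := ℝ)
    (f := fun z : ℝ => (z + a) ^ α - z ^ α)
    (f' := fun z => α * (z + a) ^ (α - 1) - α * z ^ (α - 1))
    (C := |α * (α - 1)| * R ^ (α - 2) * |a|)
    (fun z hz => by
      have hz' : R + |a| ≤ z := hz
      have := neg_abs_le a
      have := abs_nonneg a
      refine HasDerivAt.hasDerivWithinAt (HasDerivAt.sub ?_ (hφ α z (by linarith)))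
      exact (hφ α (z + a) (by linarith)).comp_add_const z a)
    (fun z hz => by
      have hz' : R + |a| ≤ z := hz
      have := neg_abs_le a
      have := abs_nonneg a
      have := h1 z (z + a) (by linarith) (by linarith)
      simpa using this)
    (x := d - b) (y := d)
    (by have := le_abs_self b; show R + |a| ≤ d - b; linarith)
    (by have := abs_nonneg b; show R + |a| ≤ d; linarith)
  simpa using h2

/-- For `α = 2H` this is the decorrelation of two increments of fractional Brownian motion at
distance `d`. It follows from the preceding bound with `R = d - |a| - |b|`. -/
theorem tendsto_secondDiff_rpow {α : ℝ} (hα : α < 2) (a b : ℝ) :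
    Tendsto (fun d : ℝ => |d + a| ^ α + |d - b| ^ α - |d + a - b| ^ α - |d| ^ α)
      atTop (𝓝 0) := by
  have hlim : Tendsto (fun d : ℝ => |α * (α - 1)| * (d - |a| - |b|) ^ (α - 2) * |a| * |b|)
      atTop (𝓝 0) := by
    have h1 : Tendsto (fun d : ℝ => (d - |a| - |b|)) atTop atTop := by
      simp_rw [sub_sub]
      exact tendsto_atTop_add_const_right _ _ tendsto_id
    have h2 := (tendsto_rpow_neg_atTop (y := 2 - α) (by linarith)).comp h1
    have h3 := ((h2.const_mul |α * (α - 1)|).mul_const |a|).mul_const |b|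
    simpa using h3
  refine squeeze_zero_norm' ?_ hlim
  filter_upwards [eventually_gt_atTop (|a| + |b|)] with d hd
  have ha := abs_nonneg a
  have hb := abs_nonneg b
  have ha' := neg_abs_le a
  have hb' := le_abs_self b
  have := abs_secondDiff_rpow_le hα (R := d - |a| - |b|) (a := a) (b := b) (d := d)
    (by linarith) (by linarith)
  rw [abs_of_pos (show 0 < d + a by linarith), abs_of_pos (show 0 < d - b by linarith),
    abs_of_pos (show 0 < d + a - b by linarith), abs_of_pos (show 0 < d by linarith)]
  rw [Real.norm_eq_abs]
  convert this using 2
  rw [show d - b + a = d + a - b by ring]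
  ring

theorem tendsto_secondDiff_rpow_cocompact {α : ℝ} (hα : α < 2) (a b : ℝ) :
    Tendsto (fun d : ℝ => |d + a| ^ α + |d - b| ^ α - |d + a - b| ^ α - |d| ^ α)
      (cocompact ℝ) (𝓝 0) := by
  rw [cocompact_eq_atBot_atTop, tendsto_sup]
  refine ⟨?_, tendsto_secondDiff_rpow hα a b⟩
  have := (tendsto_secondDiff_rpow hα (-a) (-b)).comp tendsto_neg_atBot_atTop
  refine this.congr fun d => ?_
  simp only [Function.comp_apply]
  rw [show -d + -a = -(d + a) by ring, show -d - -b = -(d - b) by ring,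
    show -(d + a) - -b = -(d + a - b) by ring]
  simp only [abs_neg]

/-! ### Characteristic functions of fractional Brownian motion -/

/-- The covariance of the increments of fractional Brownian motion over `[s, t]` and `[s', t']`. -/
noncomputable def incrementCov (H s t s' t' : ℝ) : ℝ :=
  |t - s'| ^ (2 * H) + |s - t'| ^ (2 * H) - |t - t'| ^ (2 * H) - |s - s'| ^ (2 * H)

namespace IsFBMLaw

variable {V : Type*} [NormedAddCommGroup V] [InnerProductSpace ℝ V] [CompleteSpace V]
  [MeasurableSpace V] [BorelSpace V] [SecondCountableTopology V] {γ : ℝ≥0}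
  {H : ℝ} {Q : V →L[ℝ] V} {P : Measure (PathSpace V γ)}

theorem memLp_eval (hP : IsFBMLaw H Q P) (t : ℝ) :
    MemLp (fun ω : PathSpace V γ => ω t) 2 P :=
  (hP.gaussian.hasGaussianLaw_eval t).memLp_two

theorem memLp_inner (hP : IsFBMLaw H Q P) (t : ℝ) (u : V) :
    MemLp (fun ω : PathSpace V γ => inner ℝ u (ω t)) 2 P :=
  (hP.memLp_eval t).const_inner u

theorem integral_inner_mul_inner (hP : IsFBMLaw H Q P) (s t s' t' : ℝ) (u v : V) :
    ∫ ω : PathSpace V γ, inner ℝ u (ω t - ω s) * inner ℝ v (ω t' - ω s') ∂P =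
      incrementCov H s t s' t' * inner ℝ (Q u) v := by
  have hi : ∀ a b : ℝ, Integrable
      (fun ω : PathSpace V γ => inner ℝ u (ω a) * inner ℝ v (ω b)) P := fun a b =>
    (hP.memLp_inner a u).integrable_mul (hP.memLp_inner b v)
  have hc : ∀ a b : ℝ, ∫ ω : PathSpace V γ, inner ℝ u (ω a) * inner ℝ v (ω b) ∂P =
      (|a| ^ (2 * H) + |b| ^ (2 * H) - |a - b| ^ (2 * H)) * inner ℝ (Q u) v := by
    intro a b
    rw [← hP.covariance a b u v]
    simp only [real_inner_comm]
  have hexp : ∀ ω : PathSpace V γ, inner ℝ u (ω t - ω s) * inner ℝ v (ω t' - ω s') =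
      inner ℝ u (ω t) * inner ℝ v (ω t') - inner ℝ u (ω t) * inner ℝ v (ω s')
        - (inner ℝ u (ω s) * inner ℝ v (ω t') - inner ℝ u (ω s) * inner ℝ v (ω s')) := by
    intro ω
    rw [inner_sub_right, inner_sub_right]
    ring
  simp only [hexp]
  have hi' : ∀ a b c d : ℝ, Integrable (fun ω : PathSpace V γ =>
      inner ℝ u (ω a) * inner ℝ v (ω b) - inner ℝ u (ω c) * inner ℝ v (ω d)) P :=
    fun a b c d => (hi a b).sub (hi c d)
  rw [integral_sub (hi' _ _ _ _) (hi' _ _ _ _),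
    integral_sub (hi _ _) (hi _ _), integral_sub (hi _ _) (hi _ _)]
  simp only [hc, incrementCov]
  ring

variable {ι : Type*} [Fintype ι]

/-- The sum is a continuous linear image of the Gaussian vector of the values at all endpoints. -/
theorem hasGaussianLaw_sum_increments (hP : IsFBMLaw H Q P) (s t : ι → ℝ) (u : ι → V) :
    HasGaussianLaw (fun ω : PathSpace V γ => ∑ k, inner ℝ (u k) (ω (t k) - ω (s k))) P := by
  classical
  let I : Finset ℝ := Finset.univ.image t ∪ Finset.univ.image s
  have ht : ∀ k, t k ∈ I := fun k => by simp [I]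
  have hs : ∀ k, s k ∈ I := fun k => by simp [I]
  let L : (I → V) →L[ℝ] ℝ := ∑ k, (innerSL ℝ (u k)).comp
    (ContinuousLinearMap.proj (R := ℝ) (φ := fun _ : I => V) ⟨t k, ht k⟩ -
      ContinuousLinearMap.proj (R := ℝ) (φ := fun _ : I => V) ⟨s k, hs k⟩)
  have := (hP.gaussian.hasGaussianLaw I).map L
  refine this.congr (ae_of_all _ fun ω => ?_)
  simp [L, Finset.restrict, sum_apply, inner_sub_right]

theorem integral_sum_increments (hP : IsFBMLaw H Q P) (s t : ι → ℝ) (u : ι → V) :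
    ∫ ω : PathSpace V γ, ∑ k, inner ℝ (u k) (ω (t k) - ω (s k)) ∂P = 0 := by
  have := hP.isProbabilityMeasure
  have hi : ∀ t, Integrable (fun ω : PathSpace V γ => ω t) P := fun t =>
    (hP.memLp_eval t).integrable (by norm_num)
  rw [integral_finsetSum]
  · refine Finset.sum_eq_zero fun k _ => ?_
    have hs : Integrable (fun ω : PathSpace V γ => ω (t k) - ω (s k)) P := (hi _).sub (hi _)
    rw [integral_inner hs, integral_sub (hi _) (hi _), hP.centred, hP.centred]
    simp
  · exact fun k _ => ((hi _).sub (hi _)).const_inner (u k)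

theorem variance_sum_increments (hP : IsFBMLaw H Q P) (s t : ι → ℝ) (u : ι → V) :
    Var[fun ω : PathSpace V γ => ∑ k, inner ℝ (u k) (ω (t k) - ω (s k)); P] =
      ∑ k, ∑ l, incrementCov H (s k) (t k) (s l) (t l) * inner ℝ (Q (u k)) (u l) := by
  have := hP.isProbabilityMeasure
  have hmem : ∀ k, MemLp (fun ω : PathSpace V γ => inner ℝ (u k) (ω (t k) - ω (s k))) 2 P :=
    fun k => ((hP.memLp_eval (t k)).sub (hP.memLp_eval (s k))).const_inner (u k)
  rw [variance_of_integral_eq_zero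
    (hP.hasGaussianLaw_sum_increments s t u).aemeasurable (hP.integral_sum_increments s t u)]
  simp only [sq, Finset.sum_mul_sum]
  rw [integral_finsetSum]
  · refine Finset.sum_congr rfl fun k _ => ?_
    rw [integral_finsetSum]
    · exact Finset.sum_congr rfl fun l _ => hP.integral_inner_mul_inner _ _ _ _ _ _
    · exact fun l _ => (hmem k).integrable_mul (hmem l)
  · exact fun k _ => integrable_finsetSum _ fun l _ => (hmem k).integrable_mul (hmem l)

theorem integral_exp_sum_increments (hP : IsFBMLaw H Q P) (s t : ι → ℝ) (u : ι → V) :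
    ∫ ω : PathSpace V γ,
        Complex.exp ((∑ k, inner ℝ (u k) (ω (t k) - ω (s k)) : ℝ) * Complex.I) ∂P =
      Real.exp (-(∑ k, ∑ l, incrementCov H (s k) (t k) (s l) (t l) *
        inner ℝ (Q (u k)) (u l)) / 2) := by
  have hX := hP.hasGaussianLaw_sum_increments s t u
  have h := hX.charFun_map_eq 1
  rw [charFun_apply, integral_map hX.aemeasurable (by fun_prop)] at h
  have hone : ∀ x : ℝ, inner ℝ (1 : ℝ) x = x := fun x => by simp
  have hone' : ∀ x : ℝ, inner ℝ x (1 : ℝ) = x := fun x => by simp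
  simp only [hone, hone'] at h
  rw [h, hP.variance_sum_increments, hP.integral_sum_increments]
  push_cast
  congr 1
  ring

/-- A fractional Brownian motion stays one under affine changes of time. -/
theorem measurePreserving_of_affine (hP : IsFBMLaw H Q P) {τ : PathSpace V γ → PathSpace V γ}
    {a b c : ℝ} (hac : |a| ^ (2 * H) * c ^ 2 = 1)
    (hτ : ∀ ω t, τ ω t = c • (ω (a * t + b) - ω b)) : MeasurePreserving τ P P := by
  have := hP.isProbabilityMeasure
  have hm : Measurable τ := by
    refine PathSpace.measurable_of_eval fun t => ?_
    simp only [hτ]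
    exact ((PathSpace.measurable_eval _).sub (PathSpace.measurable_eval _)).const_smul c
  refine ⟨hm, ?_⟩
  have := Measure.isProbabilityMeasure_map (μ := P) hm.aemeasurable
  refine PathSpace.measure_ext_of_charFun fun I u => ?_
  have hmeas : Measurable fun ω : PathSpace V γ => ∑ t : I, inner ℝ (u t) (ω t) :=
    Finset.measurable_sum _ fun t _ => measurable_const.inner (PathSpace.measurable_eval _)
  have hmeas' : Measurable fun ω : PathSpace V γ =>
      Complex.exp ((∑ t : I, inner ℝ (u t) (ω t) : ℝ) * Complex.I) :=
    Complex.measurable_exp.comp ((Complex.measurable_ofReal.comp hmeas).mul_const _)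
  rw [integral_map hm.aemeasurable hmeas'.aestronglyMeasurable]
  -- Under `τ`, the value at `t` becomes the increment over `[b, a t + b]` tested against `c • u t`,
  -- so both characteristic functions are instances of the same formula.
  have h1 := hP.integral_exp_sum_increments (fun _ : I => b) (fun t : I => a * t + b)
    (fun t => c • u t)
  have h2 := hP.integral_exp_sum_increments (fun _ : I => 0) (fun t : I => (t : ℝ)) u
  simp only [PathSpace.coe_zero, sub_zero] at h2
  have h3 : ∀ (ω : PathSpace V γ) (t : I), inner ℝ (u t) (τ ω t) =
      inner ℝ (c • u t) (ω (a * t + b) - ω b) := by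
    intro ω t
    rw [hτ, inner_smul_left, inner_smul_right]
    rfl
  simp only [h3]
  rw [h1, h2]
  congr 3
  refine congrArg Neg.neg (Finset.sum_congr rfl fun k _ => Finset.sum_congr rfl fun l _ => ?_)
  -- The increment covariance is translation invariant and homogeneous of degree `2H`; `hac` says
  -- exactly that the factor `c ^ 2` compensates for this.
  have h4 : incrementCov H b (a * k + b) b (a * l + b) =
      |a| ^ (2 * H) * incrementCov H 0 k 0 l := by
    unfold incrementCov
    rw [show a * k + b - b = a * (k - 0) by ring, show b - (a * l + b) = a * (0 - l) by ring,
      show a * k + b - (a * l + b) = a * (k - l) by ring, show b - b = a * (0 - 0) by ring]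
    simp only [abs_mul, Real.mul_rpow (abs_nonneg _) (abs_nonneg _)]
    ring
  rw [h4, map_smul, inner_smul_left, inner_smul_right]
  simp only [conj_trivial]
  linear_combination (incrementCov H 0 k 0 l * inner ℝ (Q (u k)) (u l)) * hac

theorem measurePreserving_shift (hP : IsFBMLaw H Q P) (t : ℝ) :
    MeasurePreserving (PathSpace.shift t) P P :=
  hP.measurePreserving_of_affine (a := 1) (b := t) (c := 1) (by simp)
    fun ω s => by simp [PathSpace.shift_apply]

end IsFBMLaw

/-! ### Ergodicity of the shifts -/

/-- If the correlations of a bounded complex sequence of random variables tend to zero, then its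
integrals over a fixed set cannot all be equal to the same non-zero constant. -/
theorem eq_zero_of_setIntegral_eq_const {Ω : Type*} [MeasurableSpace Ω] {P : Measure Ω}
    [IsProbabilityMeasure P] {ψ : ℕ → Ω → ℂ} {M : ℝ} (hψm : ∀ n, Measurable (ψ n))
    (hψ : ∀ n ω, ‖ψ n ω‖ ≤ M) {r : ℤ → ℝ}
    (hr : ∀ n m : ℕ, ∫ ω, ψ n ω * (starRingEnd ℂ) (ψ m ω) ∂P = r ((n : ℤ) - m))
    (hr0 : Tendsto r cofinite (𝓝 0)) {A : Set Ω} {a : ℂ}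
    (ha : ∀ n, ∫ ω in A, ψ n ω ∂P = a) : a = 0 := by
  have hi : ∀ n m, Integrable (fun ω => ψ n ω * (starRingEnd ℂ) (ψ m ω)) P := by
    intro n m
    refine Integrable.of_bound (C := M * M)
      ((hψm n).mul (RCLike.continuous_conj.measurable.comp (hψm m))).aestronglyMeasurable
      (ae_of_all _ fun ω => ?_)
    rw [norm_mul, RCLike.norm_conj]
    exact mul_le_mul (hψ n ω) (hψ m ω) (norm_nonneg _) ((norm_nonneg _).trans (hψ n ω))
  have hi1 : ∀ n, Integrable (ψ n) P := fun n =>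
    Integrable.of_bound (C := M) (hψm n).aestronglyMeasurable (ae_of_all _ (hψ n))
  -- Sum `K` widely spaced terms into `Ψ`. The integral of `Ψ` over `A` is `K a`, while the second
  -- moment of `Ψ` is at most `K |r 0| + K² ε / 2`, since the off-diagonal correlations are below `ε
  -- / 2`.
  have key : ∀ ε : ℝ, 0 < ε → ‖a‖ ^ 2 ≤ ε := by
    intro ε hε
    have hfin : {d : ℤ | ¬ |r d| < ε / 2}.Finite := by
      have h1 : ∀ᶠ d in cofinite, r d ∈ Metric.ball (0 : ℝ) (ε / 2) :=
        hr0.eventually (Metric.ball_mem_nhds (0 : ℝ) (half_pos hε))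
      have h2 : ∀ᶠ d in cofinite, |r d| < ε / 2 := h1.mono fun d hd => by
        simpa [Real.norm_eq_abs] using hd
      exact Filter.eventually_cofinite.1 h2
    obtain ⟨L, hL⟩ : ∃ L : ℕ, ∀ d : ℤ, (L : ℤ) < |d| → |r d| < ε / 2 := by
      obtain ⟨L, hL⟩ := (hfin.image fun d => d.natAbs).bddAbove
      refine ⟨L, fun d hd => ?_⟩
      by_contra hcon
      have : d.natAbs ≤ L := hL ⟨d, hcon, rfl⟩
      rw [Int.abs_eq_natAbs] at hd
      omega
    -- With this many terms the diagonal contribution `K |r 0|` is also at most `K² ε / 2`.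
    obtain ⟨K, hK⟩ := exists_nat_gt (2 * |r 0| / ε)
    have hK0 : (0 : ℝ) < K := lt_of_le_of_lt (by positivity) hK
    -- Spacing `L + 1` puts the differences of distinct indices beyond the finitely many lags where
    -- `r` may be large.
    set s : ℕ → ℕ := fun k => k * (L + 1) with hs
    have hrs : ∀ k l : ℕ, r ((s k : ℤ) - s l) ≤ (if k = l then |r 0| else 0) + ε / 2 := by
      intro k l
      split_ifs with hkl
      · subst hkl
        simp only [sub_self]
        linarith [le_abs_self (r 0)]
      · have : (L : ℤ) < |(s k : ℤ) - s l| := by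
          have h1 : (s k : ℤ) - s l = ((k : ℤ) - l) * (L + 1) := by simp [hs]; ring
          rw [h1, abs_mul]
          have h2 : 1 ≤ |(k : ℤ) - l| := Int.one_le_abs (by omega)
          have h3 : |(L : ℤ) + 1| = L + 1 := abs_of_nonneg (by positivity)
          rw [h3]
          nlinarith
        linarith [hL _ this, le_abs_self (r ((s k : ℤ) - s l))]
    set Ψ : Ω → ℂ := fun ω => ∑ k ∈ Finset.range K, ψ (s k) ω with hΨ
    have hΨm : Measurable Ψ := Finset.measurable_sum _ fun k _ => hψm (s k)
    have hΨb : ∀ ω, ‖Ψ ω‖ ≤ K * M := fun ω => by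
      refine (norm_sum_le _ _).trans ((Finset.sum_le_card_nsmul _ _ M fun k _ => hψ _ _).trans ?_)
      simp
    have hΨi : Integrable (fun ω => ‖Ψ ω‖) P :=
      (Integrable.of_bound (C := K * M) hΨm.aestronglyMeasurable (ae_of_all _ hΨb)).norm
    have hΨi2 : Integrable (fun ω => ‖Ψ ω‖ ^ 2) P :=
      Integrable.of_bound (C := (K * M) ^ 2) (hΨm.norm.pow_const 2).aestronglyMeasurable
        (ae_of_all _ fun ω => by
          rw [norm_pow, norm_norm]
          exact pow_le_pow_left₀ (norm_nonneg _) (hΨb ω) 2)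
    have h1 : ∫ ω, ‖Ψ ω‖ ^ 2 ∂P =
        ∑ k ∈ Finset.range K, ∑ l ∈ Finset.range K, r ((s k : ℤ) - s l) := by
      have h2 : ∀ ω, ((‖Ψ ω‖ ^ 2 : ℝ) : ℂ) = ∑ k ∈ Finset.range K, ∑ l ∈ Finset.range K,
          ψ (s k) ω * (starRingEnd ℂ) (ψ (s l) ω) := by
        intro ω
        rw [← Finset.sum_mul_sum, ← map_sum, Complex.mul_conj, Complex.normSq_eq_norm_sq]
      have h3 : ((∫ ω, ‖Ψ ω‖ ^ 2 ∂P : ℝ) : ℂ) =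
          ∑ k ∈ Finset.range K, ∑ l ∈ Finset.range K, (r ((s k : ℤ) - s l) : ℂ) := by
        rw [← integral_complex_ofReal]
        simp only [h2]
        rw [integral_finsetSum _ fun k _ => integrable_finsetSum _ fun l _ => hi _ _]
        refine Finset.sum_congr rfl fun k _ => ?_
        rw [integral_finsetSum _ fun l _ => hi _ _]
        exact Finset.sum_congr rfl fun l _ => hr _ _
      exact_mod_cast h3
    have h4 : ∫ ω, ‖Ψ ω‖ ^ 2 ∂P ≤ K * |r 0| + K * K * (ε / 2) := by
      rw [h1]
      refine (Finset.sum_le_sum fun k _ => Finset.sum_le_sum fun l _ => hrs k l).trans ?_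
      simp only [Finset.sum_add_distrib, Finset.sum_const, Finset.card_range, nsmul_eq_mul,
        Finset.sum_ite_eq, Finset.mem_range]
      have hle : ∑ k ∈ Finset.range K, (if k < K then |r 0| else 0) ≤ K * |r 0| := by
        refine (Finset.sum_le_sum fun k _ => ?_).trans_eq
          (by rw [Finset.sum_const, Finset.card_range, nsmul_eq_mul])
        split_ifs <;> simp
      linarith
    have h5 : (K : ℂ) * a = ∫ ω in A, Ψ ω ∂P := by
      rw [integral_finsetSum _ fun k _ => (hi1 _).integrableOn]
      simp [ha]
    have h6 : K * ‖a‖ ≤ ∫ ω, ‖Ψ ω‖ ∂P := by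
      have : ‖(K : ℂ) * a‖ ≤ ∫ ω in A, ‖Ψ ω‖ ∂P := by
        rw [h5]; exact norm_integral_le_integral_norm _
      rw [norm_mul, Complex.norm_natCast] at this
      exact this.trans (setIntegral_le_integral hΨi (ae_of_all _ fun ω => norm_nonneg _))
    -- This replaces the Cauchy–Schwarz inequality: with `x = K ‖a‖ ≤ E‖Ψ‖` from `h6`, one gets `2x²
    -- ≤ x² + E‖Ψ‖²`.
    have h7 : 2 * (K * ‖a‖) * ∫ ω, ‖Ψ ω‖ ∂P ≤ (K * ‖a‖) ^ 2 + ∫ ω, ‖Ψ ω‖ ^ 2 ∂P := by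
      have : ∫ ω, 2 * (K * ‖a‖) * ‖Ψ ω‖ ∂P ≤ ∫ ω, ((K * ‖a‖) ^ 2 + ‖Ψ ω‖ ^ 2) ∂P :=
        integral_mono (hΨi.const_mul _) ((integrable_const _).add hΨi2) fun ω => by
          dsimp only
          nlinarith [sq_nonneg (K * ‖a‖ - ‖Ψ ω‖)]
      rw [integral_const_mul, integral_add (integrable_const _) hΨi2, integral_const] at this
      simpa using this
    have h8 : (K * ‖a‖) ^ 2 ≤ K * |r 0| + K * K * (ε / 2) := by
      have : 0 ≤ K * ‖a‖ := by positivity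
      nlinarith
    rw [div_lt_iff₀ hε] at hK
    have h9 : K * K * ‖a‖ ^ 2 ≤ K * K * ε := by nlinarith
    exact le_of_mul_le_mul_left h9 (by positivity)
  have h0 : ‖a‖ ^ 2 ≤ 0 := le_of_forall_pos_le_add fun ε hε => by simpa using key ε hε
  have : ‖a‖ = 0 := by nlinarith [norm_nonneg a]
  exact norm_eq_zero.1 this

namespace IsFBMLaw

variable {V : Type*} [NormedAddCommGroup V] [InnerProductSpace ℝ V] [CompleteSpace V]
  [MeasurableSpace V] [BorelSpace V] [SecondCountableTopology V] {γ : ℝ≥0}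
  {H : ℝ} {Q : V →L[ℝ] V} {P : Measure (PathSpace V γ)}

theorem tendsto_incrementCov {H : ℝ} (hH : H < 1) {c : ℝ} (hc : c ≠ 0) (s t : ℝ) :
    Tendsto (fun d : ℤ => incrementCov H (d * c) (s + d * c) 0 t) cofinite (𝓝 0) := by
  have h1 : Tendsto (fun d : ℤ => (d : ℝ) * c) cofinite (cocompact ℝ) := by
    have h2 := Int.tendsto_coe_cofinite
    exact (Homeomorph.mulRight₀ c hc).isClosedEmbedding.tendsto_cocompact.comp h2
  refine ((tendsto_secondDiff_rpow_cocompact (α := 2 * H) (by linarith) s t).comp h1).congr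
    fun d => ?_
  simp only [Function.comp_apply, incrementCov]
  rw [show s + d * c - 0 = d * c + s by ring, show s + d * c - t = d * c + s - t by ring,
    sub_zero]

theorem incrementCov_add (H s t s' t' a : ℝ) :
    incrementCov H (s + a) (t + a) (s' + a) (t' + a) = incrementCov H s t s' t' := by
  simp only [incrementCov, add_sub_add_right_eq_sub]

/-- For an invariant set `A`, the restriction of `P` to `A` is shown to be `P A • P`; evaluation at
`A` then gives `P A = (P A)²`. To compare characteristic functions, let `e` be the exponential of a
finite linear functional with mean `m`. The centred shifts of `e` have correlations tending to zero
with the time lag, yet by invariance of `A` their integrals over `A` are all the same.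
`eq_zero_of_setIntegral_eq_const` makes this common value zero. -/
theorem ergodic_shift (hP : IsFBMLaw H Q P) (hH : H < 1) {c : ℝ} (hc : c ≠ 0) :
    Ergodic (PathSpace.shift c) P := by
  have hprob := hP.isProbabilityMeasure
  refine ⟨hP.measurePreserving_shift c, ⟨fun A hA hinv => ?_⟩⟩
  have hiter : ∀ n : ℕ, PathSpace.shift (n * c) ⁻¹' A = A := by
    intro n
    induction n with
    | zero => ext ω; simp
    | succ n ih =>
      have : (PathSpace.shift ((n + 1 : ℕ) * c) : PathSpace V γ → PathSpace V γ) =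
          PathSpace.shift (n * c) ∘ PathSpace.shift c := by
        ext1 ω
        simp only [Function.comp_apply, PathSpace.shift_shift]
        congr 1
        push_cast
        ring
      rw [this, preimage_comp, ih, hinv]
  have hfin : IsFiniteMeasure (P A • P) := Measure.smul_finite _ (measure_ne_top _ _)
  have key : P.restrict A = P A • P := by
    refine PathSpace.measure_ext_of_charFun fun I u => ?_
    set S : PathSpace V γ → ℝ := fun ω => ∑ t : I, inner ℝ (u t) (ω t) with hS
    have hSm : Measurable S :=
      Finset.measurable_sum _ fun t _ => measurable_const.inner (PathSpace.measurable_eval _)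
    set e : PathSpace V γ → ℂ := fun ω => Complex.exp ((S ω : ℝ) * Complex.I) with he
    have hem : Measurable e :=
      Complex.measurable_exp.comp ((Complex.measurable_ofReal.comp hSm).mul_const _)
    have heb : ∀ ω, ‖e ω‖ = 1 := fun ω => Complex.norm_exp_ofReal_mul_I _
    set σ : ℝ := ∑ k : I, ∑ l : I, incrementCov H 0 k 0 l * inner ℝ (Q (u k)) (u l) with hσ
    set κ : ℤ → ℝ := fun d => ∑ k : I, ∑ l : I,
      incrementCov H (d * c) (k + d * c) 0 l * inner ℝ (Q (u k)) (u l) with hκ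
    have hκ0 : Tendsto κ cofinite (𝓝 0) := by
      have : Tendsto κ cofinite (𝓝 (∑ k : I, ∑ l : I, 0 * inner ℝ (Q (u k)) (u l))) :=
        tendsto_finsetSum _ fun k _ => tendsto_finsetSum _ fun l _ =>
          (tendsto_incrementCov hH hc _ _).mul_const _
      simpa using this
    set m : ℝ := Real.exp (-σ / 2) with hm
    have hmean : ∫ ω, e ω ∂P = m := by
      have := hP.integral_exp_sum_increments (fun _ : I => 0) (fun t : I => (t : ℝ)) u
      simpa only [PathSpace.coe_zero, sub_zero] using this
    set E : ℕ → PathSpace V γ → ℂ := fun n ω => e (PathSpace.shift (n * c) ω) with hE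
    have hEm : ∀ n, Measurable (E n) := fun n => hem.comp (PathSpace.measurable_shift _)
    have hEi : ∀ n, Integrable (E n) P := fun n =>
      Integrable.of_bound (C := 1) (hEm n).aestronglyMeasurable (ae_of_all _ fun ω => (heb _).le)
    have hEmean : ∀ n, ∫ ω, E n ω ∂P = m := fun n => by
      rw [← hmean]
      have hmp := hP.measurePreserving_shift (n * c)
      conv_rhs => rw [← hmp.map_eq,
        integral_map hmp.measurable.aemeasurable hem.aestronglyMeasurable]
    have hEset : ∀ n, ∫ ω in A, E n ω ∂P = ∫ ω in A, e ω ∂P := fun n => by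
      have hmp := hP.measurePreserving_shift (n * c)
      conv_rhs => rw [← hmp.map_eq, setIntegral_map hA hem.aestronglyMeasurable
        hmp.measurable.aemeasurable, hiter n]
    -- The product of one exponential with the conjugate of another is the exponential of a
    -- difference, encoded on `I ⊕ I` with vectors `u` and `-u`. Its variance is `2σ` minus the two
    -- cross covariances, which depend only on `n - n'`.
    have hEE : ∀ n n' : ℕ, ∫ ω, E n ω * (starRingEnd ℂ) (E n' ω) ∂P =
        Real.exp (-σ + (κ ((n : ℤ) - n') + κ (-((n : ℤ) - n'))) / 2) := by
      intro n n'
      have h1 := hP.integral_exp_sum_increments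
        (Sum.elim (fun _ : I => n * c) (fun _ : I => n' * c))
        (Sum.elim (fun t : I => t + n * c) (fun t : I => t + n' * c))
        (Sum.elim u fun t => -u t)
      simp only [Fintype.sum_sum_type, Sum.elim_inl, Sum.elim_inr, inner_neg_left, inner_neg_right,
        map_neg, mul_neg, Finset.sum_neg_distrib, Finset.sum_add_distrib] at h1
      have hs0 : ∀ (a : ℝ) (k l : I), incrementCov H a (k + a) a (l + a) =
          incrementCov H 0 k 0 l := fun a k l => by
        simpa using incrementCov_add H 0 k 0 l a
      have hs1 : ∀ (a b : ℝ) (k l : I), incrementCov H a (k + a) b (l + b) =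
          incrementCov H (a - b) (k + (a - b)) 0 l := fun a b k l => by
        have := incrementCov_add H (a - b) (k + (a - b)) 0 l b
        rw [← this]
        congr 1 <;> ring
      simp only [hs0] at h1
      simp only [hs1] at h1
      have h2 : ∀ k l : I, incrementCov H (n * c - n' * c) (k + (n * c - n' * c)) 0 l =
          incrementCov H (((n : ℤ) - n' : ℤ) * c) (k + ((n : ℤ) - n' : ℤ) * c) 0 l := by
        intro k l
        push_cast
        congr 1 <;> ring
      have h3 : ∀ k l : I, incrementCov H (n' * c - n * c) (k + (n' * c - n * c)) 0 l =
          incrementCov H ((-((n : ℤ) - n') : ℤ) * c)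
            (k + (-((n : ℤ) - n') : ℤ) * c) 0 l := by
        intro k l
        push_cast
        congr 1 <;> ring
      simp only [h2, h3] at h1
      have h4 : -σ + (κ ((n : ℤ) - n') + κ (-((n : ℤ) - n'))) / 2 =
          -(σ + -κ (-((n : ℤ) - n')) + -(κ ((n : ℤ) - n') + -σ)) / 2 := by ring
      rw [h4]
      refine Eq.trans ?_ h1
      refine integral_congr_ae (ae_of_all _ fun ω => ?_)
      simp only [hE, he, hS, PathSpace.shift_apply]
      rw [← Complex.exp_conj, ← Complex.exp_add]
      congr 1
      simp only [map_mul, Complex.conj_ofReal, Complex.conj_I]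
      push_cast
      ring
    have hzero := eq_zero_of_setIntegral_eq_const (P := P) (ψ := fun n ω => E n ω - m)
      (M := 1 + |m|) (fun n => (hEm n).sub_const _)
      (fun n ω => (norm_sub_le _ _).trans (by rw [heb, Complex.norm_real, Real.norm_eq_abs]))
      (r := fun d => Real.exp (-σ + (κ d + κ (-d)) / 2) - m ^ 2) (A := A)
      (a := ∫ ω in A, e ω ∂P - P.real A * m) ?_ ?_ ?_
    · rw [integral_smul_measure, hmean, sub_eq_zero.1 hzero]
      simp [Measure.real, Complex.real_smul]
    · intro n n'
      have hEEi : Integrable (fun ω => E n ω * (starRingEnd ℂ) (E n' ω)) P := by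
        refine Integrable.of_bound (C := 1)
          ((hEm n).mul (RCLike.continuous_conj.measurable.comp (hEm n'))).aestronglyMeasurable
          (ae_of_all _ fun ω => ?_)
        rw [norm_mul, RCLike.norm_conj]
        simp [hE, heb]
      have hconji : Integrable (fun ω => (starRingEnd ℂ) (E n' ω)) P :=
        Integrable.of_bound (C := 1)
          (RCLike.continuous_conj.measurable.comp (hEm n')).aestronglyMeasurable
          (ae_of_all _ fun ω => by rw [RCLike.norm_conj]; exact (heb _).le)
      have hconj : ∫ ω, (starRingEnd ℂ) (E n' ω) ∂P = m := by
        rw [integral_conj, hEmean, Complex.conj_ofReal]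
      have hex : ∀ ω, (E n ω - m) * (starRingEnd ℂ) (E n' ω - m) =
          (E n ω * (starRingEnd ℂ) (E n' ω) - m * E n ω) -
            (m * (starRingEnd ℂ) (E n' ω) - (m : ℂ) * m) := by
        intro ω
        rw [map_sub, Complex.conj_ofReal]
        ring
      have hi1 : Integrable (fun ω => E n ω * (starRingEnd ℂ) (E n' ω) - m * E n ω) P :=
        hEEi.sub ((hEi n).const_mul _)
      have hi2 : Integrable (fun ω => m * (starRingEnd ℂ) (E n' ω) - (m : ℂ) * m) P :=
        (hconji.const_mul _).sub (integrable_const _)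
      simp only [hex]
      rw [integral_sub hi1 hi2, integral_sub hEEi ((hEi n).const_mul _),
        integral_sub (hconji.const_mul _) (integrable_const _), integral_const_mul,
        integral_const_mul, hEmean, hconj, hEE]
      simp
      ring
    · have h1 : Tendsto (fun d : ℤ => κ (-d)) cofinite (𝓝 0) :=
        hκ0.comp (neg_injective.tendsto_cofinite)
      have h2 : Tendsto (fun d : ℤ => -σ + (κ d + κ (-d)) / 2) cofinite (𝓝 (-σ)) := by
        simpa using ((hκ0.add h1).div_const 2).const_add (-σ)
      have h3 := ((Real.continuous_exp.tendsto _).comp h2).sub_const (m ^ 2)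
      have h4 : Real.exp (-σ) - m ^ 2 = 0 := by
        rw [hm, ← Real.exp_nat_mul]
        rw [sub_eq_zero]
        congr 1
        push_cast
        ring
      rw [h4] at h3
      exact h3
    · intro n
      rw [integral_sub (hEi n).integrableOn (integrable_const _), hEset]
      simp [Measure.real]
  have h := congrArg (fun μ : Measure (PathSpace V γ) => μ A) key
  simp only [Measure.restrict_apply hA, inter_self, Measure.smul_apply, smul_eq_mul] at h
  rw [eventuallyConst_set']
  by_cases h0 : P A = 0
  · left
    rwa [ae_eq_empty]
  · right
    rw [ae_eq_univ]
    have h1 : P A = 1 := by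
      have := (ENNReal.mul_eq_left h0 (measure_ne_top _ _)).1 h.symm
      exact this
    rw [prob_compl_eq_zero_iff hA, h1]

end IsFBMLaw

/-! ### Tempered Hölder growth of the paths -/

/-- The supremum of a pathwise bounded centred Gaussian sequence is integrable. -/
theorem lintegral_iSup_enorm_lt_top_of_gaussian {Ω : Type*} [MeasurableSpace Ω] {P : Measure Ω}
    [IsProbabilityMeasure P] {V : Type*} [NormedAddCommGroup V] [NormedSpace ℝ V] [CompleteSpace V]
    [SecondCountableTopology V] [MeasurableSpace V] [BorelSpace V] {Y : ℕ → Ω → V}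
    (hYm : ∀ k, Measurable (Y k))
    (hG : ∀ m : ℕ, HasGaussianLaw (fun ω (k : Fin m) => Y k ω) P)
    (hmean : ∀ k, ∫ ω, Y k ω ∂P = 0) (hb : ∀ ω, ∃ C : ℝ, ∀ k, ‖Y k ω‖ ≤ C) :
    ∫⁻ ω, ⨆ k, ‖Y k ω‖ₑ ∂P < ⊤ := by
  -- Any level strictly between `1/2` and `1` would serve Fernique's theorem.
  set c : ENNReal := 3 / 4 with hc
  have hcr : c.toReal = 3 / 4 := by simp [hc]
  have hc1 : c < 1 := by
    rw [hc]
    refine (ENNReal.div_lt_iff (by simp) (by simp)).2 ?_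
    norm_num
  have hc2 : 2⁻¹ < c := by
    rw [← ENNReal.toReal_lt_toReal (by simp) hc1.ne_top, hcr]
    norm_num
  obtain ⟨n, hn0, hn⟩ : ∃ n : ℕ, 0 < n ∧ c ≤ P {ω | ∀ k, ‖Y k ω‖ ≤ n} := by
    have hmono : Monotone fun n : ℕ => {ω | ∀ k, ‖Y k ω‖ ≤ n} := fun a b hab ω hω k =>
      (hω k).trans (by exact_mod_cast hab)
    have hU : ⋃ n : ℕ, {ω | ∀ k, ‖Y k ω‖ ≤ n} = univ := by
      refine eq_univ_of_forall fun ω => mem_iUnion.2 ?_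
      obtain ⟨C, hC⟩ := hb ω
      obtain ⟨n, hn⟩ := exists_nat_ge C
      exact ⟨n, fun k => (hC k).trans hn⟩
    have hlim := tendsto_measure_iUnion_atTop (μ := P) hmono
    rw [hU, measure_univ] at hlim
    obtain ⟨n, hn0, hn⟩ := ((eventually_gt_atTop 0).and (hlim.eventually (lt_mem_nhds hc1))).exists
    exact ⟨n, hn0, hn.le⟩
  -- The exponent depends only on the level `c` and the radius `n`, not on how many variables are
  -- considered. The moment bound is therefore uniform over finite subfamilies and passes to the
  -- supremum by monotone convergence.
  set α : ℝ := Fernique.logRatio c * (n : ℝ)⁻¹ ^ 2 with hα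
  have hα0 : 0 < α := mul_pos (Fernique.logRatio_pos hc2 hc1) (by positivity)
  set B : ENNReal := .ofReal (Real.exp (Fernique.logRatio c))
        + ∑' n, .ofReal (Real.exp (-2⁻¹ * Real.log (c / (1 - c)).toReal * 2 ^ n)) with hB
  have hBfin : B < ⊤ := by
    refine ENNReal.add_lt_top.mpr ⟨ENNReal.ofReal_lt_top, ?_⟩
    refine Summable.tsum_ofReal_lt_top <|
      Real.summable_exp_nat_mul_of_ge ?_ (fun i ↦ mod_cast (Nat.lt_pow_self (by simp)).le)
    refine mul_neg_of_neg_of_pos (by simp) (Real.log_pos ?_)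
    rw [ENNReal.toReal_div, ENNReal.toReal_sub_of_le hc1.le (by simp), hcr]
    norm_num
  set f : ℕ → Ω → ENNReal := fun m ω => ‖(fun k : Fin m => Y k ω)‖ₑ with hf
  have hfm : ∀ m, Measurable fun ω (k : Fin m) => Y k ω := fun m =>
    measurable_pi_lambda _ fun k => hYm k
  have hbound : ∀ m, ∫⁻ ω, f m ω ∂P ≤ ENNReal.ofReal (1 + α⁻¹) * B := by
    intro m
    have hg := (hG m).isGaussian_map
    set μ := P.map fun ω (k : Fin m) => Y k ω with hμ
    have hμ0 : μ[id] = 0 := by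
      rw [hμ, integral_map (hfm m).aemeasurable (by fun_prop)]
      have hint := (hG m).integrable
      ext k
      have := (ContinuousLinearMap.proj (R := ℝ) (φ := fun _ : Fin m => V) k).integral_comp_comm
        hint
      simp only [ContinuousLinearMap.proj_apply] at this
      simp only [id_eq, Pi.zero_apply]
      rw [← this, hmean]
    -- Centring is needed here: Fernique's estimate rests on the rotation invariance of two
    -- independent copies.
    have hrot := IsGaussian.map_rotation_eq_self hμ0 (-(Real.pi / 4))
    have hcm : c ≤ μ {x | ‖x‖ ≤ n} := by
      rw [hμ, Measure.map_apply (hfm m) (measurableSet_le measurable_norm measurable_const)]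
      refine hn.trans (measure_mono fun ω hω => ?_)
      simp only [mem_preimage, mem_ofPred_eq]
      exact (pi_norm_le_iff_of_nonneg (by positivity)).2 fun k => hω k
    have hfern := lintegral_exp_mul_sq_norm_le_of_map_rotation_eq_self hrot hcm hc2
    rw [← hB, ← hα, hμ, lintegral_map (by fun_prop) (hfm m)] at hfern
    calc ∫⁻ ω, f m ω ∂P
        ≤ ∫⁻ ω, ENNReal.ofReal (1 + α⁻¹) *
            ENNReal.ofReal (Real.exp (α * ‖(fun k : Fin m => Y k ω)‖ ^ 2)) ∂P := by
          refine lintegral_mono fun ω => ?_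
          simp only [hf]
          rw [← ofReal_norm, ← ENNReal.ofReal_mul (by positivity)]
          refine ENNReal.ofReal_le_ofReal ?_
          set x := ‖(fun k : Fin m => Y k ω)‖
          have h1 := Real.add_one_le_exp (α * x ^ 2)
          have h2 : x ≤ 1 + x ^ 2 := by nlinarith [sq_nonneg (x - 1)]
          have h3 : α⁻¹ * (α * x ^ 2) = x ^ 2 := by field_simp
          have h4 : 0 ≤ α⁻¹ := by positivity
          have h5 : 0 ≤ α * x ^ 2 := by positivity
          nlinarith [mul_le_mul_of_nonneg_left h1 h4]
      _ ≤ ENNReal.ofReal (1 + α⁻¹) * B := by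
          rw [lintegral_const_mul _ (by fun_prop)]
          gcongr
  have hfmono : Monotone f := by
    intro a b hab ω
    simp only [hf]
    rw [← ofReal_norm, ← ofReal_norm]
    refine ENNReal.ofReal_le_ofReal ?_
    refine (pi_norm_le_iff_of_nonneg (norm_nonneg _)).2 fun k => ?_
    exact norm_le_pi_norm (fun k : Fin b => Y k ω) (Fin.castLE hab k)
  calc ∫⁻ ω, ⨆ k, ‖Y k ω‖ₑ ∂P ≤ ∫⁻ ω, ⨆ m, f m ω ∂P := by
        refine lintegral_mono fun ω => iSup_le fun k => ?_
        refine le_trans ?_ (le_iSup (fun m => f m ω) (k + 1))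
        simp only [hf]
        rw [← ofReal_norm, ← ofReal_norm]
        exact ENNReal.ofReal_le_ofReal
          (norm_le_pi_norm (fun j : Fin (k + 1) => Y j ω) (Fin.last k))
    _ = ⨆ m, ∫⁻ ω, f m ω ∂P := lintegral_iSup (fun m => (hfm m).enorm) hfmono
    _ ≤ ENNReal.ofReal (1 + α⁻¹) * B := iSup_le hbound
    _ < ⊤ := ENNReal.mul_lt_top ENNReal.ofReal_lt_top hBfin

namespace PathSpace

section

variable {V : Type*} [NormedAddCommGroup V] {γ : ℝ≥0}

/-- The increments of the path are Hölder continuous, with a constant growing with rate `δ`. -/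
def HolderGrowth (ω : PathSpace V γ) (C δ : ℝ) : Prop :=
  ∀ a b : ℝ, ‖ω a - ω b‖ ≤ C * Real.exp (δ * (|a| + |b|)) * |a - b| ^ (γ : ℝ)

/-- The paths whose local Hölder constants grow subexponentially. -/
def temperedPaths (V : Type*) [NormedAddCommGroup V] (γ : ℝ≥0) : Set (PathSpace V γ) :=
  {ω | ∀ δ : ℝ, 0 < δ → ∃ C : ℝ, HolderGrowth ω C δ}

theorem HolderGrowth.nonneg {ω : PathSpace V γ} {C δ : ℝ} (h : HolderGrowth ω C δ) : 0 ≤ C := by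
  have h1 := (norm_nonneg _).trans (h 1 0)
  simp only [sub_zero, abs_one, Real.one_rpow, mul_one] at h1
  exact nonneg_of_mul_nonneg_left h1 (Real.exp_pos _)

theorem HolderGrowth.mono {ω : PathSpace V γ} {C C' δ δ' : ℝ} (h : HolderGrowth ω C δ)
    (hC : C ≤ C') (hδ : δ ≤ δ') : HolderGrowth ω C' δ' := by
  intro a b
  have := h.nonneg
  have := this.trans hC
  refine (h a b).trans ?_
  gcongr

/-- The factor `2` in the exponent arises because both endpoints of an increment move by `t`. -/
theorem HolderGrowth.shift {ω : PathSpace V γ} {C δ : ℝ} (h : HolderGrowth ω C δ) (hδ : 0 ≤ δ)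
    (t : ℝ) : HolderGrowth (shift t ω) (C * Real.exp (2 * δ * |t|)) δ := by
  intro a b
  have hC := h.nonneg
  have h1 := h (a + t) (b + t)
  simp only [shift_apply, sub_sub_sub_cancel_right]
  refine h1.trans ?_
  rw [add_sub_add_right_eq_sub, mul_assoc C (Real.exp (2 * δ * |t|)), ← Real.exp_add]
  gcongr
  nlinarith [abs_add_le a t, abs_add_le b t]

theorem preimage_shift_temperedPaths (t : ℝ) :
    shift t ⁻¹' temperedPaths V γ = temperedPaths V γ := by
  have h : ∀ t, ∀ ω ∈ temperedPaths V γ, shift t ω ∈ temperedPaths V γ := by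
    intro t ω hω δ hδ
    obtain ⟨C, hC⟩ := hω δ hδ
    exact ⟨_, hC.shift hδ.le t⟩
  ext ω
  refine ⟨fun hω => ?_, fun hω => h t ω hω⟩
  have := h (-t) _ hω
  rwa [shift_shift, neg_add_cancel, shift_zero] at this

/-- Rates `1 / (k + 1)` and natural constants suffice, and for fixed rate and constant the growth
condition is closed under pointwise convergence, hence in the compact-open topology. -/
theorem measurableSet_temperedPaths [MeasurableSpace V] [BorelSpace V] :
    MeasurableSet (temperedPaths V γ) := by
  have h : temperedPaths V γ =
      ⋂ k : ℕ, ⋃ C : ℕ, {ω : PathSpace V γ | HolderGrowth ω C (1 / ((k : ℝ) + 1))} := by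
    ext ω
    simp only [mem_iInter, mem_iUnion]
    constructor
    · intro hω k
      obtain ⟨C, hC⟩ := hω (1 / ((k : ℝ) + 1)) (by positivity)
      obtain ⟨n, hn⟩ := exists_nat_ge C
      exact ⟨n, hC.mono hn le_rfl⟩
    · intro hω δ hδ
      obtain ⟨k, hk⟩ := exists_nat_one_div_lt hδ
      obtain ⟨C, hC⟩ := hω k
      exact ⟨C, HolderGrowth.mono hC le_rfl hk.le⟩
  rw [h]
  refine MeasurableSet.iInter fun k => MeasurableSet.iUnion fun C => ?_
  have hcl : IsClosed {f : C(ℝ, V) | ∀ a b : ℝ, ‖f a - f b‖ ≤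
      (C : ℝ) * Real.exp (1 / ((k : ℝ) + 1) * (|a| + |b|)) * |a - b| ^ (γ : ℝ)} := by
    simp only [ofPred_forall]
    refine isClosed_iInter fun a => isClosed_iInter fun b => ?_
    exact isClosed_le ((continuous_eval_const a).sub (continuous_eval_const b)).norm
      continuous_const
  exact measurableSet_preimage_of_isClosed hcl

end

section Scale

variable {V : Type*} [NormedAddCommGroup V] [NormedSpace ℝ V] {γ : ℝ≥0}

/-- The path `t ↦ c • ω (a t)`. -/
def scale (a : ℝ) (c : ℝ) (ω : PathSpace V γ) : PathSpace V γ :=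
  ⟨⟨fun s => c • ω (a * s), by have := ω.1.continuous; fun_prop⟩, by
    refine ⟨by simp, fun x y => ?_⟩
    obtain ⟨C, hC⟩ := ω.2.2 (min (a * x) (a * y)) (max (a * x) (a * y))
    have hmem : ∀ z ∈ Icc x y, a * z ∈ Icc (min (a * x) (a * y)) (max (a * x) (a * y)) := by
      intro z hz
      rcases le_total 0 a with ha | ha
      · exact ⟨(min_le_left _ _).trans (mul_le_mul_of_nonneg_left hz.1 ha),
          (mul_le_mul_of_nonneg_left hz.2 ha).trans (le_max_right _ _)⟩
      · exact ⟨(min_le_right _ _).trans (mul_le_mul_of_nonpos_left hz.2 ha),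
          (mul_le_mul_of_nonpos_left hz.1 ha).trans (le_max_left _ _)⟩
    have h2 : LipschitzWith ‖a‖₊ fun s : ℝ => a * s := by
      refine LipschitzWith.of_dist_le_mul fun s t => ?_
      rw [Real.dist_eq, Real.dist_eq, ← mul_sub, abs_mul]
      simp
    have h1 := ((lipschitzWith_smul (β := V) c).holderWith.holderOnWith univ).comp
      (hC.comp (h2.holderWith.holderOnWith (Icc x y)) hmem) (mapsTo_univ _ _)
    simp only [mul_one, NNReal.coe_one, NNReal.rpow_one, one_mul] at h1
    exact ⟨_, h1⟩⟩

theorem scale_apply (a c s : ℝ) (ω : PathSpace V γ) : scale a c ω s = c • ω (a * s) := rfl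

end Scale

end PathSpace

namespace IsFBMLaw

variable {V : Type*} [NormedAddCommGroup V] [InnerProductSpace ℝ V] [CompleteSpace V]
  [MeasurableSpace V] [BorelSpace V] [SecondCountableTopology V] {γ : ℝ≥0}
  {H : ℝ} {Q : V →L[ℝ] V} {P : Measure (PathSpace V γ)}

theorem measurePreserving_scale (hP : IsFBMLaw H Q P) {a : ℝ} (ha : 0 < a) :
    MeasurePreserving (PathSpace.scale a (a ^ (-H))) P P :=
  hP.measurePreserving_of_affine (a := a) (b := 0) (c := a ^ (-H))
    (by
      rw [abs_of_pos ha, ← Real.rpow_natCast, ← Real.rpow_mul ha.le, ← Real.rpow_add ha]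
      have : 2 * H + -H * ((2 : ℕ) : ℝ) = 0 := by push_cast; ring
      rw [this, Real.rpow_zero])
    fun ω s => by simp [PathSpace.scale_apply]

/-- The Hölder seminorm on `[-1, 1]` is the supremum `N` of a countable centred Gaussian family,
finite on every path by the definition of the path space, hence integrable by Fernique. By
self-similarity the seminorms on `[-(n + 1), n + 1]` are, up to powers of `n + 1`, identically
distributed copies of `N`. Thus the series of `exp (-δ n)` times these copies has finite mean and
converges almost surely, which bounds the `n`-th copy by a random constant times `exp (δ n)`. -/
theorem measure_compl_temperedPaths (hP : IsFBMLaw H Q P) (hH : H < 1) :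
    P (PathSpace.temperedPaths V γ)ᶜ = 0 := by
  have hprob := hP.isProbabilityMeasure
  obtain ⟨q, hq⟩ := exists_surjective_nat (ℚ × ℚ)
  -- Clamping to `[-1, 1]` lets all rational pairs index the family, with no subtype of times.
  set κ : ℝ → ℝ := fun x => max (-1) (min 1 x) with hκ
  have hκc : Continuous κ := by fun_prop
  have hκm : ∀ x, κ x ∈ Icc (-1 : ℝ) 1 := fun x =>
    ⟨le_max_left _ _, max_le (by norm_num) (min_le_left _ _)⟩
  have hκe : ∀ x ∈ Icc (-1 : ℝ) 1, κ x = x := fun x hx => by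
    rw [hκ]; simp only; rw [min_eq_right hx.2, max_eq_right hx.1]
  set a : ℕ → ℝ := fun k => κ (q k).1
  set b : ℕ → ℝ := fun k => κ (q k).2
  -- When `a k = b k` the value of the weight is irrelevant, because the increment vanishes.
  set w : ℕ → ℝ := fun k => (|a k - b k| ^ (γ : ℝ))⁻¹ with hw
  set Y : ℕ → PathSpace V γ → V := fun k ω => w k • (ω (a k) - ω (b k)) with hY
  have hYm : ∀ k, Measurable (Y k) := fun k =>
    ((PathSpace.measurable_eval _).sub (PathSpace.measurable_eval _)).const_smul (w k)
  have hpos : ∀ k, a k ≠ b k → 0 < |a k - b k| ^ (γ : ℝ) := fun k hk =>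
    Real.rpow_pos_of_pos (abs_pos.2 (sub_ne_zero.2 hk)) _
  have hYfin : ∫⁻ ω, ⨆ k, ‖Y k ω‖ₑ ∂P < ⊤ := by
    refine lintegral_iSup_enorm_lt_top_of_gaussian hYm (fun m => ?_) (fun k => ?_) fun ω => ?_
    · classical
      let I : Finset ℝ := Finset.univ.image (fun k : Fin m => a k) ∪
        Finset.univ.image (fun k : Fin m => b k)
      have ht : ∀ k : Fin m, a k ∈ I := fun k => by simp [I]
      have hs : ∀ k : Fin m, b k ∈ I := fun k => by simp [I]
      let L : (I → V) →L[ℝ] (Fin m → V) := ContinuousLinearMap.pi fun k => w k •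
        (ContinuousLinearMap.proj (R := ℝ) (φ := fun _ : I => V) ⟨a k, ht k⟩ -
          ContinuousLinearMap.proj (R := ℝ) (φ := fun _ : I => V) ⟨b k, hs k⟩)
      exact ((hP.gaussian.hasGaussianLaw I).map L).congr (ae_of_all _ fun ω => rfl)
    · have hi : ∀ t, Integrable (fun ω : PathSpace V γ => ω t) P := fun t =>
        (hP.memLp_eval t).integrable (by norm_num)
      simp only [hY]
      rw [integral_smul, integral_sub (hi _) (hi _), hP.centred, hP.centred]
      simp
    · obtain ⟨C, hC⟩ := ω.2.2 (-1) 1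
      refine ⟨C, fun k => ?_⟩
      have h1 := hC.dist_le (hκm (q k).1) (hκm (q k).2)
      rw [dist_eq_norm, Real.dist_eq] at h1
      by_cases hk : a k = b k
      · simp [hY, hk]
      · simp only [hY, hw, norm_smul, norm_inv, Real.norm_eq_abs]
        rw [abs_of_pos (hpos k hk), inv_mul_le_iff₀ (hpos k hk), mul_comm]
        exact h1
  set N : PathSpace V γ → ENNReal := fun ω => ⨆ k, ‖Y k ω‖ₑ with hN
  have hNm : Measurable N := Measurable.iSup fun k => (hYm k).enorm
  -- the Hölder constants on `[-n, n]`
  set θ : ℕ → PathSpace V γ → PathSpace V γ := fun n =>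
    PathSpace.scale ((n : ℝ) + 1) (((n : ℝ) + 1) ^ (-H)) with hθ
  have hθP : ∀ n, MeasurePreserving (θ n) P P := fun n =>
    hP.measurePreserving_scale (by positivity)
  have hNθ : ∀ n, Measurable fun ω => N (θ n ω) := fun n => hNm.comp (hθP n).measurable
  have hN_holder : ∀ (ω : PathSpace V γ) (K : ℝ), 0 ≤ K → N ω ≤ ENNReal.ofReal K →
      ∀ x ∈ Icc (-1 : ℝ) 1, ∀ y ∈ Icc (-1 : ℝ) 1, ‖ω x - ω y‖ ≤ K * |x - y| ^ (γ : ℝ) := by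
    intro ω K hK hNK x hx y hy
    have hcl : IsClosed {p : ℝ × ℝ | ‖ω (κ p.1) - ω (κ p.2)‖ ≤
        K * |κ p.1 - κ p.2| ^ (γ : ℝ)} := by
      have hc := ω.continuous_coe
      refine isClosed_le ((hc.comp (hκc.comp continuous_fst)).sub
        (hc.comp (hκc.comp continuous_snd))).norm (continuous_const.mul ?_)
      exact ((hκc.comp continuous_fst).sub (hκc.comp continuous_snd)).abs.rpow_const
        fun _ => Or.inr γ.2
    have hd : DenseRange fun p : ℚ × ℚ => ((p.1 : ℝ), (p.2 : ℝ)) :=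
      Rat.denseRange_cast.prodMap Rat.denseRange_cast
    have := hd.induction_on (p := fun p : ℝ × ℝ => ‖ω (κ p.1) - ω (κ p.2)‖ ≤
        K * |κ p.1 - κ p.2| ^ (γ : ℝ)) (x, y) hcl (fun p => by
      obtain ⟨k, rfl⟩ := hq p
      by_cases hk : a k = b k
      · change ‖ω (a k) - ω (b k)‖ ≤ K * |a k - b k| ^ (γ : ℝ)
        rw [hk, sub_self, norm_zero]
        positivity
      · have h1 : ‖Y k ω‖ₑ ≤ ENNReal.ofReal K := (le_iSup (fun k => ‖Y k ω‖ₑ) k).trans hNK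
        rw [← ofReal_norm, ENNReal.ofReal_le_ofReal_iff hK] at h1
        simp only [hY, hw, norm_smul, norm_inv, Real.norm_eq_abs] at h1
        rwa [abs_of_pos (hpos k hk), inv_mul_le_iff₀ (hpos k hk), mul_comm] at h1)
    simpa only [hκe x hx, hκe y hy] using this
  have hsum : ∀ j : ℕ, ∀ᵐ ω ∂P, ∃ K : ℝ, 0 ≤ K ∧
      ∀ n : ℕ, N (θ n ω) ≤ ENNReal.ofReal (K * Real.exp (1 / ((j : ℝ) + 1) * n)) := by
    intro j
    set δ : ℝ := 1 / ((j : ℝ) + 1)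
    have hδ : 0 < δ := by positivity
    have h1 : ∫⁻ ω, ∑' n : ℕ, ENNReal.ofReal (Real.exp (-δ * n)) * N (θ n ω) ∂P < ⊤ := by
      rw [lintegral_tsum fun n =>
        ((hNθ n).const_mul _).aemeasurable]
      have h2 : ∀ n : ℕ, ∫⁻ ω, ENNReal.ofReal (Real.exp (-δ * n)) * N (θ n ω) ∂P =
          ENNReal.ofReal (Real.exp (-δ * n)) * ∫⁻ ω, N ω ∂P := fun n => by
        rw [lintegral_const_mul _ (hNθ n),
          (hθP n).lintegral_comp hNm]
      simp only [h2]
      rw [ENNReal.tsum_mul_right]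
      refine ENNReal.mul_lt_top ?_ hYfin
      exact Summable.tsum_ofReal_lt_top
        (Real.summable_exp_nat_mul_of_ge (by linarith) fun i => le_rfl)
    have hmeas : Measurable fun ω =>
        ∑' n : ℕ, ENNReal.ofReal (Real.exp (-δ * n)) * N (θ n ω) :=
      Measurable.tsum fun n => (hNθ n).const_mul _
    filter_upwards [ae_lt_top hmeas h1.ne] with ω hω
    refine ⟨(∑' n : ℕ, ENNReal.ofReal (Real.exp (-δ * n)) * N (θ n ω)).toReal,
      ENNReal.toReal_nonneg, fun n => ?_⟩
    rw [ENNReal.ofReal_mul ENNReal.toReal_nonneg, ENNReal.ofReal_toReal hω.ne]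
    have h3 := ENNReal.le_tsum (f := fun n : ℕ =>
      ENNReal.ofReal (Real.exp (-δ * n)) * N (θ n ω)) n
    calc N (θ n ω) = ENNReal.ofReal (Real.exp (-δ * n)) * N (θ n ω) *
          ENNReal.ofReal (Real.exp (δ * n)) := by
          rw [mul_right_comm, ← ENNReal.ofReal_mul (Real.exp_pos _).le, ← Real.exp_add]
          simp
      _ ≤ _ := by gcongr
  have hall := ae_all_iff.2 hsum
  refine measure_mono_null (fun ω hω => ?_) (ae_iff.1 hall)
  intro hgood
  refine hω fun δ hδ => ?_
  -- Half of the rate `δ` absorbs the random Hölder constants, the other half the scaling factor `(n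
  -- + 1) ^ H ≤ n + 1`.
  obtain ⟨j, hj⟩ := exists_nat_one_div_lt (half_pos hδ)
  obtain ⟨K, hK0, hK⟩ := hgood j
  have hpoly : ∃ D : ℝ, 0 ≤ D ∧ ∀ n : ℕ, ((n : ℝ) + 1) ^ H ≤ D * Real.exp (δ / 2 * n) := by
    refine ⟨1 + 2 / δ, by positivity, fun n => ?_⟩
    have h1 : ((n : ℝ) + 1) ^ H ≤ (n : ℝ) + 1 := by
      simpa using Real.rpow_le_rpow_of_exponent_le (x := (n : ℝ) + 1) (by simp) hH.le
    have h2 := Real.add_one_le_exp (δ / 2 * n)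
    have h3 : 2 / δ * (δ / 2 * n) = n := by field_simp
    have h4 : 0 < 2 / δ := by positivity
    have h5 : 0 ≤ δ / 2 * n := by positivity
    nlinarith [mul_le_mul_of_nonneg_left h2 h4.le]
  obtain ⟨D, hD0, hD⟩ := hpoly
  refine ⟨K * D, fun x y => ?_⟩
  -- The floor gives both `x, y ∈ [-(n + 1), n + 1]` and `n ≤ |x| + |y|`, the latter turning `exp (δ
  -- n)` into the required growth.
  set n : ℕ := ⌊|x| + |y|⌋₊ with hn
  have hle : |x| + |y| ≤ (n : ℝ) + 1 := (Nat.lt_floor_add_one _).le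
  have hnle : (n : ℝ) ≤ |x| + |y| := Nat.floor_le (by positivity)
  have hn0 : (0 : ℝ) < n + 1 := by positivity
  have hxm : x / (n + 1) ∈ Icc (-1 : ℝ) 1 := by
    rw [mem_Icc, ← abs_le, abs_div, abs_of_pos hn0, div_le_one hn0]
    linarith [abs_nonneg y]
  have hym : y / (n + 1) ∈ Icc (-1 : ℝ) 1 := by
    rw [mem_Icc, ← abs_le, abs_div, abs_of_pos hn0, div_le_one hn0]
    linarith [abs_nonneg x]
  have h1 := hN_holder (θ n ω) _ (by positivity) (hK n) _ hxm _ hym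
  simp only [hθ, PathSpace.scale_apply] at h1
  rw [mul_div_cancel₀ _ hn0.ne', mul_div_cancel₀ _ hn0.ne', ← smul_sub, norm_smul,
    Real.norm_eq_abs, abs_of_pos (Real.rpow_pos_of_pos hn0 _), ← sub_div, abs_div,
    abs_of_pos hn0, Real.div_rpow (abs_nonneg _) hn0.le, Real.rpow_neg hn0.le,
    inv_mul_le_iff₀ (Real.rpow_pos_of_pos hn0 _)] at h1
  have h2 : |x - y| ^ (γ : ℝ) / ((n : ℝ) + 1) ^ (γ : ℝ) ≤ |x - y| ^ (γ : ℝ) := by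
    refine div_le_self (by positivity) (Real.one_le_rpow (by linarith) γ.2)
  calc ‖ω x - ω y‖ ≤ ((n : ℝ) + 1) ^ H * (K * Real.exp (1 / ((j : ℝ) + 1) * n) *
        (|x - y| ^ (γ : ℝ) / ((n : ℝ) + 1) ^ (γ : ℝ))) := h1
    _ ≤ (D * Real.exp (δ / 2 * n)) * (K * Real.exp (δ / 2 * n) * |x - y| ^ (γ : ℝ)) := by
        gcongr
        exact hD n
    _ = K * D * Real.exp (δ * n) * |x - y| ^ (γ : ℝ) := by
        have : Real.exp (δ * n) = Real.exp (δ / 2 * n) * Real.exp (δ / 2 * n) := by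
          rw [← Real.exp_add]; congr 1; ring
        rw [this]; ring
    _ ≤ _ := by gcongr

theorem isInvariantFull_temperedPaths (hP : IsFBMLaw H Q P) (hH : H < 1) :
    PathSpace.IsInvariantFull P (PathSpace.temperedPaths V γ) :=
  ⟨PathSpace.measurableSet_temperedPaths, PathSpace.preimage_shift_temperedPaths,
    hP.measure_compl_temperedPaths hH⟩

end IsFBMLaw

/-! ### The pointwise ergodic theorem for bounded functions -/

section Birkhoff

variable {Ω : Type*} [MeasurableSpace Ω] {P : Measure Ω} [IsProbabilityMeasure P] {T : Ω → Ω}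

/-- The maximum of the Birkhoff sums `S₀, …, Sₙ` of `G`. -/
noncomputable def birkhoffMax (T : Ω → Ω) (G : Ω → ℝ) : ℕ → Ω → ℝ
  | 0 => fun _ => 0
  | n + 1 => fun ω => max 0 (G ω + birkhoffMax T G n (T ω))

theorem birkhoffMax_nonneg (T : Ω → Ω) (G : Ω → ℝ) (n : ℕ) (ω : Ω) : 0 ≤ birkhoffMax T G n ω := by
  cases n with
  | zero => exact le_rfl
  | succ n => exact le_max_left _ _

theorem birkhoffMax_mono (T : Ω → Ω) (G : Ω → ℝ) (ω : Ω) :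
    Monotone fun n => birkhoffMax T G n ω := by
  refine monotone_nat_of_le_succ fun n => ?_
  induction n generalizing ω with
  | zero => exact birkhoffMax_nonneg T G 1 ω
  | succ n ih => exact max_le_max le_rfl (by have := ih (T ω); linarith)

theorem birkhoffSum_le_birkhoffMax (T : Ω → Ω) (G : Ω → ℝ) (n : ℕ) (ω : Ω) :
    birkhoffSum T G n ω ≤ birkhoffMax T G n ω := by
  induction n generalizing ω with
  | zero => simp [birkhoffSum, birkhoffMax]
  | succ n ih =>
    rw [birkhoffSum_succ']
    exact le_trans (by have := ih (T ω); linarith) (le_max_right _ _)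

theorem birkhoffMax_le {G : Ω → ℝ} {M : ℝ} (hM : 0 ≤ M) (hG : ∀ ω, |G ω| ≤ M) (n : ℕ) (ω : Ω) :
    birkhoffMax T G n ω ≤ n * M := by
  induction n generalizing ω with
  | zero => simp [birkhoffMax]
  | succ n ih =>
    refine max_le (by positivity) ?_
    have h1 := ih (T ω)
    have h2 := (abs_le.1 (hG ω)).2
    push_cast
    linarith

theorem measurable_birkhoffMax (hT : Measurable T) {G : Ω → ℝ} (hG : Measurable G) (n : ℕ) :
    Measurable (birkhoffMax T G n) := by
  induction n with
  | zero => exact measurable_const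
  | succ n ih => exact measurable_const.max (hG.add (ih.comp hT))

/-- Let `M n` be the running maximum. The set where it is unbounded is invariant, since `M (n + 1) =
max 0 (G + M n ∘ T)` and `G` is bounded. If this set had full measure, then `M (n + 1) - M n ∘ T =
max (-M n ∘ T) G` would tend to `G` almost everywhere, boundedly. These functions have nonnegative
integrals, as `T` preserves the measure and `M` increases in `n`; so `∫ G ≥ 0`, a contradiction. -/
theorem ae_bddAbove_birkhoffSum (hT : Ergodic T P) {G : Ω → ℝ} (hG : Measurable G) {M : ℝ}
    (hGM : ∀ ω, |G ω| ≤ M) (hneg : ∫ ω, G ω ∂P < 0) :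
    ∀ᵐ ω ∂P, ∃ C : ℝ, ∀ n, birkhoffSum T G n ω ≤ C := by
  obtain ⟨ω₀⟩ : Nonempty Ω := nonempty_of_isProbabilityMeasure P
  have hM : 0 ≤ M := (abs_nonneg _).trans (hGM ω₀)
  have hmeas := measurable_birkhoffMax hT.measurable hG
  set A : Set Ω := {ω | ∀ C : ℕ, ∃ n, (C : ℝ) < birkhoffMax T G n ω} with hA
  have hAm : MeasurableSet A := by
    simp only [hA, ofPred_forall, ofPred_exists]
    exact MeasurableSet.iInter fun C => MeasurableSet.iUnion fun n =>
      measurableSet_lt measurable_const (hmeas n)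
  have hinv : T ⁻¹' A = A := by
    ext ω
    simp only [hA, mem_preimage, mem_ofPred_eq]
    constructor
    · intro h C
      obtain ⟨K, hK⟩ := exists_nat_ge ((C : ℝ) - G ω)
      obtain ⟨n, hn⟩ := h K
      exact ⟨n + 1, lt_of_lt_of_le (by linarith) (le_max_right _ _)⟩
    · intro h C
      obtain ⟨K, hK⟩ := exists_nat_ge ((C : ℝ) + M)
      obtain ⟨n, hn⟩ := h K
      have hK' : (0 : ℝ) ≤ K := by positivity
      cases n with
      | zero => exact absurd hn (not_lt.2 hK')
      | succ n =>
        refine ⟨n, ?_⟩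
        rcases lt_max_iff.1 hn with h1 | h1
        · exact absurd h1 (not_lt.2 hK')
        · have := (abs_le.1 (hGM ω)).2
          linarith
  have hint : ∀ n, Integrable (birkhoffMax T G n) P := fun n =>
    Integrable.of_bound (C := n * M) (hmeas n).aestronglyMeasurable (ae_of_all _ fun ω => by
      rw [Real.norm_eq_abs, abs_of_nonneg (birkhoffMax_nonneg T G n ω)]
      exact birkhoffMax_le hM hGM n ω)
  have hnull : P A = 0 := by
    rcases hT.toPreErgodic.measure_self_or_compl_eq_zero hAm hinv with h | h
    · exact h
    exfalso
    have hlim : Tendsto (fun n => ∫ ω, max (-birkhoffMax T G n (T ω)) (G ω) ∂P) atTop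
        (𝓝 (∫ ω, G ω ∂P)) := by
      refine tendsto_integral_of_dominated_convergence (fun _ => M) (fun n => ?_)
        (integrable_const M) (fun n => ae_of_all _ fun ω => ?_) ?_
      · exact (((hmeas n).comp hT.measurable).neg.max hG).aestronglyMeasurable
      · have h1 := birkhoffMax_nonneg T G n (T ω)
        have h2 := abs_le.1 (hGM ω)
        rw [Real.norm_eq_abs, abs_le]
        exact ⟨h2.1.trans (le_max_right _ _), max_le (by linarith) h2.2⟩
      · have hmem : ∀ᵐ ω ∂P, ω ∈ A := by rwa [ae_iff]
        filter_upwards [hmem] with ω hω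
        rw [← hinv] at hω
        obtain ⟨K, hK⟩ := exists_nat_ge (-G ω)
        obtain ⟨n, hn⟩ := hω K
        refine tendsto_const_nhds.congr' ?_
        filter_upwards [eventually_ge_atTop n] with k hk
        have := birkhoffMax_mono T G (T ω) hk
        simp only at this
        rw [max_eq_right (by linarith)]
    have hge : ∀ n, 0 ≤ ∫ ω, max (-birkhoffMax T G n (T ω)) (G ω) ∂P := by
      intro n
      have h1 : ∀ ω, max (-birkhoffMax T G n (T ω)) (G ω) =
          birkhoffMax T G (n + 1) ω - birkhoffMax T G n (T ω) := by
        intro ω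
        change _ = max 0 (G ω + birkhoffMax T G n (T ω)) - _
        rw [← max_sub_sub_right]
        simp
      have h2 : ∫ ω, birkhoffMax T G n (T ω) ∂P = ∫ ω, birkhoffMax T G n ω ∂P := by
        conv_rhs => rw [← hT.map_eq, integral_map hT.measurable.aemeasurable
          (hmeas n).aestronglyMeasurable]
      have h3 : Integrable (fun ω => birkhoffMax T G n (T ω)) P :=
        hT.toMeasurePreserving.integrable_comp_of_integrable (hint n)
      simp only [h1]
      rw [integral_sub (hint _) h3, h2, sub_nonneg]
      exact integral_mono (hint _) (hint _) fun ω => birkhoffMax_mono T G ω n.le_succ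
    exact absurd (ge_of_tendsto' hlim hge) (not_le.2 hneg)
  have : ∀ᵐ ω ∂P, ω ∉ A := measure_eq_zero_iff_ae_notMem.1 hnull
  filter_upwards [this] with ω hω
  simp only [hA, mem_ofPred_eq, not_forall, not_exists, not_lt] at hω
  obtain ⟨C, hC⟩ := hω
  exact ⟨C, fun n => (birkhoffSum_le_birkhoffMax T G n ω).trans (hC n)⟩

/-- Subtracting `∫ F + ε / 2` gives a function of negative mean, whose Birkhoff sums are bounded
above; the bound disappears after division by `n`. -/
theorem ae_eventually_birkhoffSum_le (hT : Ergodic T P) {F : Ω → ℝ} (hF : Measurable F) {M : ℝ}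
    (hFM : ∀ ω, |F ω| ≤ M) {ε : ℝ} (hε : 0 < ε) :
    ∀ᵐ ω ∂P, ∀ᶠ n : ℕ in atTop, birkhoffSum T F n ω / n ≤ ∫ ω, F ω ∂P + ε := by
  have hFi : Integrable F P := Integrable.of_bound (C := M) hF.aestronglyMeasurable (ae_of_all _ hFM)
  set m := ∫ ω, F ω ∂P + ε / 2 with hm
  have hG : ∫ ω, (F ω - m) ∂P < 0 := by
    rw [integral_sub hFi (integrable_const _)]
    simp [hm]
    linarith
  filter_upwards [ae_bddAbove_birkhoffSum hT (hF.sub_const m) (M := M + |m|)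
    (fun ω => (abs_sub _ _).trans (by linarith [hFM ω])) hG] with ω hω
  obtain ⟨C, hC⟩ := hω
  have hlim : Tendsto (fun n : ℕ => C / n) atTop (𝓝 0) := tendsto_const_div_atTop_nhds_zero_nat C
  filter_upwards [hlim.eventually (ge_mem_nhds (half_pos hε)), eventually_gt_atTop 0] with n hn hn0
  have h1 := hC n
  have h2 : birkhoffSum T (fun ω => F ω - m) n ω = birkhoffSum T F n ω - n * m := by
    simp [birkhoffSum]
  have hn0' : (0 : ℝ) < n := by exact_mod_cast hn0
  rw [div_le_iff₀ hn0'] at hn ⊢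
  rw [h2] at h1
  simp only [hm] at h1
  nlinarith

/-- The pointwise ergodic theorem for bounded functions. -/
theorem ae_tendsto_birkhoffSum_div (hT : Ergodic T P) {F : Ω → ℝ} (hF : Measurable F) {M : ℝ}
    (hFM : ∀ ω, |F ω| ≤ M) :
    ∀ᵐ ω ∂P, Tendsto (fun n : ℕ => birkhoffSum T F n ω / n) atTop (𝓝 (∫ ω, F ω ∂P)) := by
  have h1 : ∀ k : ℕ, ∀ᵐ ω ∂P, ∀ᶠ n : ℕ in atTop,
      birkhoffSum T F n ω / n ≤ ∫ ω, F ω ∂P + 1 / ((k : ℝ) + 1) := fun k =>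
    ae_eventually_birkhoffSum_le hT hF hFM (by positivity)
  have h2 : ∀ k : ℕ, ∀ᵐ ω ∂P, ∀ᶠ n : ℕ in atTop,
      ∫ ω, F ω ∂P - 1 / ((k : ℝ) + 1) ≤ birkhoffSum T F n ω / n := fun k => by
    have := ae_eventually_birkhoffSum_le (F := fun ω => -F ω) hT hF.neg (M := M)
      (by simpa using hFM) (ε := 1 / ((k : ℝ) + 1)) (by positivity)
    filter_upwards [this] with ω hω
    filter_upwards [hω] with n hn
    have h3 : birkhoffSum T (fun ω => -F ω) n ω = -birkhoffSum T F n ω := by simp [birkhoffSum]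
    rw [h3, integral_neg, neg_div] at hn
    linarith
  filter_upwards [ae_all_iff.2 h1, ae_all_iff.2 h2] with ω hω1 hω2
  rw [Metric.tendsto_atTop']
  intro ε hε
  obtain ⟨k, hk⟩ := exists_nat_one_div_lt hε
  obtain ⟨N, hN⟩ := eventually_atTop.1 ((hω1 k).and (hω2 k))
  refine ⟨N, fun n hn => ?_⟩
  obtain ⟨h3, h4⟩ := hN n hn.le
  rw [Real.dist_eq, abs_lt]
  constructor <;> linarith

end Birkhoff

/-! ### Time averages -/

/-- The time averages over `[0, T]` of `h` converge to `m` as `T → ∞`. -/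
def HasTimeAverage (h : ℝ → ℝ) (m : ℝ) : Prop :=
  Tendsto (fun T : ℝ => (∫ r in (0 : ℝ)..T, h r) / T) atTop (𝓝 m)

section TimeAverage

variable {h : ℝ → ℝ} {m M : ℝ}

theorem intervalIntegrable_of_bounded {E : Type*} [NormedAddCommGroup E] {h : ℝ → E}
    (hm : AEStronglyMeasurable h volume) (hM : ∀ r, ‖h r‖ ≤ M) (a b : ℝ) :
    IntervalIntegrable h volume a b := by
  rw [intervalIntegrable_iff]
  exact Measure.integrableOn_of_bounded (M := M) (by simp) hm (ae_of_all _ hM)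

theorem tendsto_div_of_bounded_sub {f g : ℝ → ℝ} {C : ℝ}
    (hf : Tendsto (fun T : ℝ => f T / T) atTop (𝓝 m)) (hfg : ∀ᶠ T in atTop, |g T - f T| ≤ C) :
    Tendsto (fun T : ℝ => g T / T) atTop (𝓝 m) := by
  have h1 : Tendsto (fun T : ℝ => (g T - f T) / T) atTop (𝓝 0) := by
    refine squeeze_zero_norm' ?_ (tendsto_const_nhds (x := C) |>.div_atTop tendsto_id)
    filter_upwards [hfg, eventually_gt_atTop 0] with T hT hT0
    rw [norm_div, Real.norm_eq_abs, Real.norm_eq_abs, abs_of_pos hT0]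
    exact div_le_div_of_nonneg_right hT hT0.le
  refine (by simpa using hf.add h1 : Tendsto _ _ (𝓝 m)).congr fun T => ?_
  ring

/-- For bounded `h`, rounding the time down to an integer changes the integral by at most `M`. This
reduction supplies both the measurability of the averaging event and the passage from discrete to
continuous time. -/
theorem hasTimeAverage_iff_nat (hh : Measurable h) (hM : ∀ r, |h r| ≤ M) :
    HasTimeAverage h m ↔
      Tendsto (fun n : ℕ => (∫ r in (0 : ℝ)..n, h r) / n) atTop (𝓝 m) := by
  constructor
  · intro H
    exact H.comp tendsto_natCast_atTop_atTop
  · intro H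
    have hi := intervalIntegrable_of_bounded hh.aestronglyMeasurable hM
    have h1 := (H.comp (tendsto_nat_floor_atTop (α := ℝ))).mul (tendsto_nat_floor_div_atTop (R := ℝ))
    rw [mul_one] at h1
    have h2 : Tendsto (fun T : ℝ => (∫ r in (0 : ℝ)..⌊T⌋₊, h r) / T) atTop (𝓝 m) := by
      refine h1.congr' ?_
      filter_upwards [eventually_ge_atTop 1] with T hT
      have : (0 : ℝ) < ⌊T⌋₊ := by exact_mod_cast Nat.floor_pos.2 hT
      simp only [Function.comp_apply]
      field_simp
    refine tendsto_div_of_bounded_sub (C := M) h2 ?_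
    filter_upwards [eventually_ge_atTop 0] with T hT
    rw [intervalIntegral.integral_interval_sub_left (hi _ _) (hi _ _)]
    refine (intervalIntegral.norm_integral_le_of_norm_le_const (f := h) fun r _ => hM r).trans ?_
    have h3 : |T - ⌊T⌋₊| ≤ 1 := by
      rw [abs_le]
      constructor <;> linarith [Nat.floor_le hT, Nat.lt_floor_add_one T]
    have : 0 ≤ M := (abs_nonneg _).trans (hM 0)
    nlinarith

theorem HasTimeAverage.comp_add (hh : Measurable h) (hM : ∀ r, |h r| ≤ M)
    (H : HasTimeAverage h m) (t : ℝ) : HasTimeAverage (fun r => h (r + t)) m := by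
  have hi := intervalIntegrable_of_bounded hh.aestronglyMeasurable hM
  refine tendsto_div_of_bounded_sub (C := M * |t| + M * |t|) H (Eventually.of_forall fun T => ?_)
  rw [intervalIntegral.integral_comp_add_right]
  have h1 : (∫ r in (0 + t)..(T + t), h r) - ∫ r in (0 : ℝ)..T, h r =
      (∫ r in T..(T + t), h r) - ∫ r in (0 : ℝ)..(0 + t), h r := by
    have h2 := intervalIntegral.integral_add_adjacent_intervals (hi 0 T) (hi T (T + t))
    have h3 := intervalIntegral.integral_add_adjacent_intervals (hi 0 (0 + t)) (hi (0 + t) (T + t))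
    linarith
  rw [h1]
  refine (abs_sub _ _).trans (add_le_add ?_ ?_)
  · have := intervalIntegral.norm_integral_le_of_norm_le_const (a := T) (b := T + t)
      (f := h) fun r _ => hM r
    simpa using this
  · have := intervalIntegral.norm_integral_le_of_norm_le_const (a := (0 : ℝ)) (b := 0 + t)
      (f := h) fun r _ => hM r
    simpa using this

end TimeAverage

/-! ### Invariant sets of paths with prescribed time averages -/

namespace PathSpace

variable {V : Type*} [NormedAddCommGroup V] [InnerProductSpace ℝ V] [CompleteSpace V]
  [MeasurableSpace V] [BorelSpace V] [SecondCountableTopology V] {γ : ℝ≥0}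

/-- The paths along which the time averages of `F`, forwards and backwards, converge to `m`. -/
def averagingPaths (F : PathSpace V γ → ℝ) (m : ℝ) : Set (PathSpace V γ) :=
  {ω | HasTimeAverage (fun r => F (shift r ω)) m ∧ HasTimeAverage (fun r => F (shift (-r) ω)) m}

variable {F : PathSpace V γ → ℝ} {m M : ℝ}

theorem measurable_orbit (hF : Measurable F) (c : ℝ) (ω : PathSpace V γ) :
    Measurable fun r => F (shift (c * r) ω) :=
  hF.comp ((measurable_shift_left ω).comp (measurable_const_mul c))

theorem measurable_integral_orbit (hF : Measurable F) (c a b : ℝ) :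
    Measurable fun ω : PathSpace V γ => ∫ r in a..b, F (shift (c * r) ω) := by
  have h : StronglyMeasurable fun p : PathSpace V γ × ℝ => F (shift (c * p.2) p.1) :=
    (hF.comp (measurable_shift_uncurry.comp
      ((measurable_snd.const_mul c).prodMk measurable_fst))).stronglyMeasurable
  simp only [intervalIntegral]
  exact (h.integral_prod_right.sub h.integral_prod_right).measurable

theorem measurableSet_averagingPaths (hF : Measurable F) (hM : ∀ ω, |F ω| ≤ M) :
    MeasurableSet (averagingPaths F m) := by
  have h : ∀ c : ℝ, MeasurableSet {ω : PathSpace V γ |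
      HasTimeAverage (fun r => F (shift (c * r) ω)) m} := by
    intro c
    simp only [hasTimeAverage_iff_nat (measurable_orbit hF c _) fun r => hM _]
    exact measurableSet_tendsto _ fun n =>
      (measurable_integral_orbit hF c 0 n).div_const _
  have := (h 1).inter (h (-1))
  simpa [averagingPaths, ofPred_and] using this

theorem preimage_shift_averagingPaths (hF : Measurable F) (hM : ∀ ω, |F ω| ≤ M) (t : ℝ) :
    shift t ⁻¹' averagingPaths F m = averagingPaths F m := by
  have h : ∀ t, ∀ ω ∈ averagingPaths F m, shift t ω ∈ averagingPaths F m := by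
    rintro t ω ⟨h1, h2⟩
    have hm1 := measurable_orbit hF 1 ω
    have hm2 := measurable_orbit hF (-1) ω
    simp only [one_mul, neg_mul] at hm1 hm2
    refine ⟨?_, ?_⟩
    · simpa only [shift_shift] using h1.comp_add hm1 (fun r => hM _) t
    · have := h2.comp_add hm2 (fun r => hM _) (-t)
      simp only [shift_shift]
      simpa only [neg_add, neg_neg] using this
  ext ω
  refine ⟨fun hω => ?_, fun hω => h t ω hω⟩
  have := h (-t) _ hω
  rwa [shift_shift, neg_add_cancel, shift_zero] at this

end PathSpace

namespace IsFBMLaw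

variable {V : Type*} [NormedAddCommGroup V] [InnerProductSpace ℝ V] [CompleteSpace V]
  [MeasurableSpace V] [BorelSpace V] [SecondCountableTopology V] {γ : ℝ≥0}
  {H : ℝ} {Q : V →L[ℝ] V} {P : Measure (PathSpace V γ)} {F : PathSpace V γ → ℝ} {M : ℝ}

/-- The discrete ergodic theorem for the shift by `c` is applied to `G = ∫₀¹ F ∘ θ_{cr} dr`: its
Birkhoff sums are the integrals over `[0, n]`, and by invariance and Fubini it has the mean of `F`.
The values `c = 1` and `c = -1` give the two time directions. -/
theorem ae_hasTimeAverage (hP : IsFBMLaw H Q P) (hH : H < 1) (hF : Measurable F)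
    (hM : ∀ ω, |F ω| ≤ M) {c : ℝ} (hc : c ≠ 0) :
    ∀ᵐ ω ∂P, HasTimeAverage (fun r => F (PathSpace.shift (c * r) ω)) (∫ ω, F ω ∂P) := by
  have hprob := hP.isProbabilityMeasure
  have hFi : Integrable F P := Integrable.of_bound (C := M) hF.aestronglyMeasurable (ae_of_all _ hM)
  set G : PathSpace V γ → ℝ := fun ω => ∫ r in (0 : ℝ)..1, F (PathSpace.shift (c * r) ω) with hG
  have hGm : Measurable G := PathSpace.measurable_integral_orbit hF c 0 1
  have hGM : ∀ ω, |G ω| ≤ M := fun ω => by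
    have := intervalIntegral.norm_integral_le_of_norm_le_const (a := 0) (b := 1)
      (f := fun r => F (PathSpace.shift (c * r) ω)) (C := M) fun r _ => hM _
    simpa using this
  have hGint : ∫ ω, G ω ∂P = ∫ ω, F ω ∂P := by
    have hjoint : Measurable fun p : ℝ × PathSpace V γ => F (PathSpace.shift (c * p.1) p.2) :=
      hF.comp (PathSpace.measurable_shift_uncurry.comp
        ((measurable_fst.const_mul c).prodMk measurable_snd))
    simp only [hG]
    rw [← intervalIntegral_integral_swap]
    · have h1 : ∀ r : ℝ, ∫ ω, F (PathSpace.shift (c * r) ω) ∂P = ∫ ω, F ω ∂P := fun r => by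
        have hmp := hP.measurePreserving_shift (c * r)
        conv_rhs => rw [← hmp.map_eq, integral_map hmp.measurable.aemeasurable
          hF.aestronglyMeasurable]
      simp [h1]
    · have : IsFiniteMeasure ((volume : Measure ℝ).restrict (uIoc 0 1)) := ⟨by simp⟩
      exact Integrable.of_bound (C := M) hjoint.aestronglyMeasurable (ae_of_all _ fun p => hM _)
  have hiter : ∀ (n : ℕ) (ω : PathSpace V γ),
      (PathSpace.shift c)^[n] ω = PathSpace.shift (n * c) ω := by
    intro n ω
    induction n with
    | zero => simp
    | succ n ih =>
      rw [Function.iterate_succ_apply', ih, PathSpace.shift_shift]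
      congr 1
      push_cast
      ring
  have hsum : ∀ (n : ℕ) (ω : PathSpace V γ), birkhoffSum (PathSpace.shift c) G n ω =
      ∫ r in (0 : ℝ)..n, F (PathSpace.shift (c * r) ω) := by
    intro n ω
    have h1 := intervalIntegral.sum_integral_adjacent_intervals (n := n) (μ := volume)
      (a := fun k : ℕ => (k : ℝ)) (f := fun r => F (PathSpace.shift (c * r) ω))
      (fun k _ => intervalIntegrable_of_bounded
        (PathSpace.measurable_orbit hF c ω).aestronglyMeasurable (fun r => hM _) _ _)
    rw [Nat.cast_zero] at h1
    rw [← h1]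
    refine Finset.sum_congr rfl fun k _ => ?_
    simp only [hG, hiter, PathSpace.shift_shift]
    have h2 := intervalIntegral.integral_comp_add_right (a := 0) (b := 1)
      (fun r => F (PathSpace.shift (c * r) ω)) (k : ℝ)
    rw [zero_add] at h2
    push_cast
    rw [add_comm (k : ℝ) 1, ← h2]
    refine intervalIntegral.integral_congr fun r _ => ?_
    congr 2
    ring
  filter_upwards [ae_tendsto_birkhoffSum_div (hP.ergodic_shift hH hc) hGm hGM] with ω hω
  rw [hasTimeAverage_iff_nat (PathSpace.measurable_orbit hF c ω) fun r => hM _]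
  simpa only [hsum, hGint] using hω

theorem isInvariantFull_averagingPaths (hP : IsFBMLaw H Q P) (hH : H < 1) (hF : Measurable F)
    (hM : ∀ ω, |F ω| ≤ M) :
    PathSpace.IsInvariantFull P (PathSpace.averagingPaths F (∫ ω, F ω ∂P)) := by
  refine ⟨PathSpace.measurableSet_averagingPaths hF hM,
    PathSpace.preimage_shift_averagingPaths hF hM, ?_⟩
  have h1 := hP.ae_hasTimeAverage hH hF hM one_ne_zero
  have h2 := hP.ae_hasTimeAverage hH hF hM (neg_ne_zero.2 one_ne_zero)
  simp only [one_mul, neg_mul] at h1 h2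
  have h3 : ∀ᵐ ω ∂P, ω ∈ PathSpace.averagingPaths F (∫ ω, F ω ∂P) := by
    filter_upwards [h1, h2] with ω hω1 hω2 using ⟨hω1, hω2⟩
  exact ae_iff.1 h3

end IsFBMLaw

/-! ### Operations on invariant sets of full measure -/

namespace PathSpace.IsInvariantFull

variable {V : Type*} [NormedAddCommGroup V] {γ : ℝ≥0} {P : Measure (PathSpace V γ)}

theorem inter {S S' : Set (PathSpace V γ)} (hS : IsInvariantFull P S)
    (hS' : IsInvariantFull P S') : IsInvariantFull P (S ∩ S') :=
  ⟨hS.measurableSet.inter hS'.measurableSet, fun t => by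
    rw [preimage_inter, hS.invariant, hS'.invariant], by
    rw [compl_inter]; exact measure_union_null hS.full hS'.full⟩

theorem iInter {ι : Type*} [Countable ι] {S : ι → Set (PathSpace V γ)}
    (hS : ∀ i, IsInvariantFull P (S i)) : IsInvariantFull P (⋂ i, S i) :=
  ⟨MeasurableSet.iInter fun i => (hS i).measurableSet, fun t => by
    simp only [preimage_iInter, (hS _).invariant], by
    rw [compl_iInter]; exact measure_iUnion_null fun i => (hS i).full⟩

theorem shift_mem {S : Set (PathSpace V γ)} (hS : IsInvariantFull P S) {ω : PathSpace V γ}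
    (hω : ω ∈ S) (t : ℝ) : shift t ω ∈ S := by
  rwa [← hS.invariant t] at hω

end PathSpace.IsInvariantFull

/-! ### Functional calculus in a complete orthonormal system -/

namespace HilbertBasis

variable {V : Type*} [NormedAddCommGroup V] [InnerProductSpace ℝ V] {ι : Type*}

/-- Distinct basis vectors have distance `√2`, so balls of radius `1/2` around them are disjoint. -/
theorem countable_index [TopologicalSpace.SeparableSpace V] (b : HilbertBasis ι ℝ V) :
    Countable ι := by
  refine Pairwise.countable_of_isOpen_disjoint (s := fun i => Metric.ball (b i) (1 / 2))
    (fun i j hij => ?_) (fun i => Metric.isOpen_ball) fun i => ⟨b i, by simp⟩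
  refine Metric.ball_disjoint_ball ?_
  rw [dist_eq_norm]
  have h := norm_sub_sq_real (b i) (b j)
  rw [b.orthonormal.2 hij, b.orthonormal.1 i, b.orthonormal.1 j] at h
  nlinarith [norm_nonneg (b i - b j)]

theorem ext_inner (b : HilbertBasis ι ℝ V) {x y : V} (h : ∀ i, inner ℝ (b i) x = inner ℝ (b i) y) :
    x = y := by
  refine b.repr.injective (lp.ext (funext fun i => ?_))
  rw [b.repr_apply_apply, b.repr_apply_apply, h]

theorem hasSum_inner_sq (b : HilbertBasis ι ℝ V) (x : V) :
    HasSum (fun i => inner ℝ (b i) x ^ 2) (‖x‖ ^ 2) := by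
  have := b.hasSum_inner_mul_inner x x
  rw [real_inner_self_eq_norm_sq] at this
  simpa only [real_inner_comm, sq] using this

theorem norm_le_mul_of_inner_le (b : HilbertBasis ι ℝ V) {x y : V} {K : ℝ} (hK : 0 ≤ K)
    (h : ∀ i, |inner ℝ (b i) x| ≤ K * |inner ℝ (b i) y|) : ‖x‖ ≤ K * ‖y‖ := by
  refine le_of_sq_le_sq ?_ (by positivity)
  rw [mul_pow]
  refine hasSum_le (fun i => ?_) (b.hasSum_inner_sq x) ((b.hasSum_inner_sq y).mul_left (K ^ 2))
  rw [← mul_pow, ← sq_abs]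
  refine (pow_le_pow_left₀ (abs_nonneg _) (h i) 2).trans_eq ?_
  rw [mul_pow, mul_pow, sq_abs]

/-- Vectors with coefficients dominated by those of a given vector exist. -/
theorem exists_hasSum_of_abs_le (b : HilbertBasis ι ℝ V) {c : ι → ℝ} {v : V} {K : ℝ}
    (h : ∀ i, |c i| ≤ K * |inner ℝ (b i) v|) :
    ∃ x : V, HasSum (fun i => c i • b i) x ∧ ∀ i, inner ℝ (b i) x = c i := by
  have hmem : Memℓp c 2 := by
    refine memℓp_gen ?_
    have h1 := (b.hasSum_inner_sq v).summable.mul_left (K ^ 2)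
    refine Summable.of_nonneg_of_le (fun i => by positivity) (fun i => ?_) h1
    have : ‖c i‖ ^ (2 : ENNReal).toReal = c i ^ 2 := by simp
    rw [this, ← sq_abs]
    refine (pow_le_pow_left₀ (abs_nonneg _) (h i) 2).trans_eq ?_
    rw [mul_pow, sq_abs]
  let f : lp (fun _ : ι => ℝ) 2 := ⟨c, hmem⟩
  refine ⟨b.repr.symm f, b.hasSum_repr_symm f, fun i => ?_⟩
  rw [← b.repr_apply_apply, LinearIsometryEquiv.apply_symm_apply]

theorem measurable_of_inner [MeasurableSpace V] [BorelSpace V] [SecondCountableTopology V]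
    (b : HilbertBasis ι ℝ V) {α : Type*} [MeasurableSpace α] {F : α → V}
    (h : ∀ i, Measurable fun a => inner ℝ (b i) (F a)) : Measurable F := by
  have := b.countable_index
  refine measurable_of_tendsto_metrizable' (f := fun (s : Finset ι) (a : α) =>
    ∑ i ∈ s, inner ℝ (b i) (F a) • b i) atTop
    (fun s => Finset.measurable_sum _ fun i _ => (h i).smul_const _) ?_
  rw [tendsto_pi_nhds]
  intro a
  have := b.hasSum_repr (F a)
  simp only [b.repr_apply_apply] at this
  exact this

end HilbertBasis

namespace Eigensystem

variable {V : Type*} [NormedAddCommGroup V] [InnerProductSpace ℝ V] {T : V →ₗ.[ℝ] V} {ι : Type*}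
  (E : Eigensystem T ι) {φ ψ : ℝ → ℝ} {K : ℝ}

/-- Boundedness of `φ` on the spectrum ensures that the series converges; otherwise `tsum` could
take its default value `0`. All operator identities below are checked coordinatewise through this
formula. -/
theorem inner_apply (hφ : ∀ i, |φ (E.eigenvalue i)| ≤ K) (v : V) (i : ι) :
    inner ℝ (E.basis i) (E.apply φ v) = φ (E.eigenvalue i) * inner ℝ (E.basis i) v := by
  obtain ⟨x, hx, hxi⟩ := E.basis.exists_hasSum_of_abs_le
    (c := fun i => φ (E.eigenvalue i) * inner ℝ (E.basis i) v) (v := v) (K := K) fun i => by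
      rw [abs_mul]
      exact mul_le_mul_of_nonneg_right (hφ i) (abs_nonneg _)
  rw [apply, hx.tsum_eq, hxi]

theorem norm_apply_le (hK : 0 ≤ K) (hφ : ∀ i, |φ (E.eigenvalue i)| ≤ K) (v : V) :
    ‖E.apply φ v‖ ≤ K * ‖v‖ := by
  refine E.basis.norm_le_mul_of_inner_le hK fun i => ?_
  rw [E.inner_apply hφ, abs_mul]
  exact mul_le_mul_of_nonneg_right (hφ i) (abs_nonneg _)

/-- The operator `φ(T)` for a function `φ` which is bounded by `K` on the spectrum. -/
noncomputable def applyL (φ : ℝ → ℝ) (K : ℝ) (hK : 0 ≤ K) (hφ : ∀ i, |φ (E.eigenvalue i)| ≤ K) :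
    V →L[ℝ] V :=
  LinearMap.mkContinuous
    { toFun := E.apply φ
      map_add' := fun x y => E.basis.ext_inner fun i => by
        simp only [inner_add_right, E.inner_apply hφ]
        ring
      map_smul' := fun c x => E.basis.ext_inner fun i => by
        simp only [inner_smul_right, E.inner_apply hφ, RingHom.id_apply]
        ring } K (E.norm_apply_le hK hφ)

theorem coe_applyL (hK : 0 ≤ K) (hφ : ∀ i, |φ (E.eigenvalue i)| ≤ K) :
    ⇑(E.applyL φ K hK hφ) = E.apply φ := rfl

theorem measurable_apply [MeasurableSpace V] [BorelSpace V] [SecondCountableTopology V]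
    {α : Type*} [MeasurableSpace α] {φ : α → ℝ → ℝ} {K : α → ℝ}
    (hφ : ∀ a i, |φ a (E.eigenvalue i)| ≤ K a) (hφm : ∀ l, Measurable fun a => φ a l)
    {F : α → V} (hF : Measurable F) : Measurable fun a => E.apply (φ a) (F a) := by
  refine E.basis.measurable_of_inner fun i => ?_
  simp only [E.inner_apply (hφ _)]
  exact (hφm _).mul (measurable_const.inner hF)

theorem eigenvalue_pos (hT : IsPositiveCompactInverse T) (i : ι) : 0 < E.eigenvalue i := by
  obtain ⟨x, hx, hx'⟩ := (LinearPMap.mem_graph_iff _).1 (E.eigen i)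
  simp only [] at hx hx'
  have hne : (x : V) ≠ 0 := by
    rw [hx]; exact E.basis.orthonormal.ne_zero i
  have := hT.positive x hne
  rw [hx', hx, inner_smul_left, real_inner_self_eq_norm_sq, E.basis.orthonormal.1 i] at this
  simpa using this

theorem inner_inverse (hT : IsPositiveCompactInverse T) {K : V →L[ℝ] V}
    (hK : ∀ v : V, (K v, v) ∈ T.graph) (v : V) (i : ι) :
    E.eigenvalue i * inner ℝ (E.basis i) (K v) = inner ℝ (E.basis i) v := by
  obtain ⟨x, hx, hx'⟩ := (LinearPMap.mem_graph_iff _).1 (E.eigen i)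
  obtain ⟨y, hy, hy'⟩ := (LinearPMap.mem_graph_iff _).1 (hK v)
  simp only [] at hx hx' hy hy'
  have := hT.symmetric x y
  rw [hx', hy', hx, hy, inner_smul_left] at this
  simpa using this

/-- Because `T` has an everywhere defined right inverse, a coordinatewise identity already puts `x`
in the domain: `x` must be the image of `y` under that inverse. -/
theorem mem_graph_of_inner (hT : IsPositiveCompactInverse T) {x y : V}
    (h : ∀ i, inner ℝ (E.basis i) y = E.eigenvalue i * inner ℝ (E.basis i) x) :
    (x, y) ∈ T.graph := by
  obtain ⟨K, -, hK, -⟩ := hT.compact_inverse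
  have : K y = x := E.basis.ext_inner fun i => by
    have h1 := E.inner_inverse hT hK y i
    rw [h i] at h1
    exact mul_left_cancel₀ (E.eigenvalue_pos hT i).ne' h1
  rw [← this]
  exact hK y

theorem semigroup_bound (hT : IsPositiveCompactInverse T) {t : ℝ} (ht : 0 ≤ t) (i : ι) :
    |Real.exp (-(t * E.eigenvalue i))| ≤ 1 := by
  rw [abs_of_pos (Real.exp_pos _)]
  exact Real.exp_le_one_iff.2 (neg_nonpos.2 (mul_nonneg ht (E.eigenvalue_pos hT i).le))

theorem inner_semigroup (hT : IsPositiveCompactInverse T) {t : ℝ} (ht : 0 ≤ t) (v : V) (i : ι) :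
    inner ℝ (E.basis i) (E.semigroup t v) =
      Real.exp (-(t * E.eigenvalue i)) * inner ℝ (E.basis i) v :=
  E.inner_apply (φ := fun l => Real.exp (-(t * l))) (E.semigroup_bound hT ht) v i

/-- Test the decay at time `1` on an eigenvector. -/
theorem le_eigenvalue {lam : ℝ} (hT : IsPositiveCompactInverse T)
    (h : ∀ t : ℝ, 0 ≤ t → ∀ v : V, ‖E.semigroup t v‖ ≤ Real.exp (-(lam * t)) * ‖v‖) (i : ι) :
    lam ≤ E.eigenvalue i := by
  have h1 := h 1 zero_le_one (E.basis i)
  have h2 : E.semigroup 1 (E.basis i) = Real.exp (-(1 * E.eigenvalue i)) • E.basis i := by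
    classical
    refine E.basis.ext_inner fun j => ?_
    rw [E.inner_semigroup hT zero_le_one, inner_smul_right]
    by_cases hij : j = i
    · rw [hij]
    · rw [E.basis.orthonormal.2 hij]; simp
  rw [h2, norm_smul, E.basis.orthonormal.1, Real.norm_eq_abs, abs_of_pos (Real.exp_pos _)] at h1
  simp only [one_mul, mul_one, Real.exp_le_exp] at h1
  linarith

theorem semigroup_add (hT : IsPositiveCompactInverse T) {s t : ℝ} (hs : 0 ≤ s) (ht : 0 ≤ t)
    (v : V) : E.semigroup s (E.semigroup t v) = E.semigroup (s + t) v := by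
  refine E.basis.ext_inner fun i => ?_
  rw [E.inner_semigroup hT hs, E.inner_semigroup hT ht, E.inner_semigroup hT (add_nonneg hs ht),
    ← mul_assoc, ← Real.exp_add]
  congr 2
  ring

/-- The operators of the semigroup as bounded operators; for negative times this is the
identity. -/
noncomputable def semigroupL (hT : IsPositiveCompactInverse T) (t : ℝ) : V →L[ℝ] V :=
  E.applyL (fun l => Real.exp (-(max t 0 * l))) 1 zero_le_one
    (E.semigroup_bound hT (le_max_right t 0))

theorem semigroupL_apply (hT : IsPositiveCompactInverse T) {t : ℝ} (ht : 0 ≤ t) (v : V) :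
    E.semigroupL hT t v = E.semigroup t v := by
  rw [semigroupL, coe_applyL, semigroup, max_eq_left ht]

theorem measurable_semigroupL (hT : IsPositiveCompactInverse T)
    [MeasurableSpace V] [BorelSpace V] [SecondCountableTopology V] {α : Type*} [MeasurableSpace α]
    {τ : α → ℝ} (hτ : Measurable τ) {F : α → V} (hF : Measurable F) :
    Measurable fun a => E.semigroupL hT (τ a) (F a) := by
  simp only [semigroupL, coe_applyL]
  exact E.measurable_apply (K := fun _ => 1) (φ := fun a l => Real.exp (-(max (τ a) 0 * l)))
    (fun a i => E.semigroup_bound hT (le_max_right _ _) i) (fun l => by fun_prop) hF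

/-- The derivative `s ↦ -T exp (-s T)` of the semigroup at positive times. -/
noncomputable def semigroupDeriv (E : Eigensystem T ι) (s : ℝ) (v : V) : V :=
  E.apply (fun l => if 0 < s then -(l * Real.exp (-(s * l))) else 0) v

/-- With `x = s l`, the inequality `x ≤ exp (x / 2)` spends half of the exponential on the unbounded
factor `l`, at the price of `s⁻¹`; the other half remains as decay. -/
theorem abs_semigroupDeriv_le {l lam s : ℝ} (hl0 : 0 ≤ lam) (hl : lam ≤ l) :
    |if 0 < s then -(l * Real.exp (-(s * l))) else 0| ≤ |s|⁻¹ * Real.exp (-(lam / 2 * s)) := by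
  split_ifs with hs
  · have hl' : 0 ≤ l := hl0.trans hl
    rw [abs_neg, abs_of_nonneg (mul_nonneg hl' (Real.exp_pos _).le), abs_of_pos hs,
      inv_mul_eq_div, le_div_iff₀ hs]
    have h1 : s * l ≤ Real.exp (s * l / 2) := by
      have h2 := Real.add_one_le_exp (s * l / 2 - 1)
      have h3 : Real.exp (s * l / 2) = Real.exp 1 * Real.exp (s * l / 2 - 1) := by
        rw [← Real.exp_add]; congr 1; ring
      have h4 := Real.add_one_le_exp (1 : ℝ)
      have h5 : 0 ≤ s * l := by positivity
      rw [h3]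
      nlinarith [Real.exp_pos (s * l / 2 - 1)]
    have h6 : Real.exp (-(s * l)) = Real.exp (-(s * l / 2)) * Real.exp (-(s * l / 2)) := by
      rw [← Real.exp_add]; congr 1; ring
    have h7 : Real.exp (s * l / 2) * Real.exp (-(s * l / 2)) = 1 := by
      rw [← Real.exp_add]; simp
    calc l * Real.exp (-(s * l)) * s = (s * l) * Real.exp (-(s * l / 2)) *
          Real.exp (-(s * l / 2)) := by rw [h6]; ring
      _ ≤ Real.exp (s * l / 2) * Real.exp (-(s * l / 2)) * Real.exp (-(s * l / 2)) := by gcongr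
      _ = Real.exp (-(s * l / 2)) := by rw [h7, one_mul]
      _ ≤ Real.exp (-(lam / 2 * s)) := by
          refine Real.exp_le_exp.2 ?_
          nlinarith
  · rw [abs_zero]
    positivity

variable {lam : ℝ}

theorem inner_semigroupDeriv (hlam0 : 0 ≤ lam) (hlam : ∀ i, lam ≤ E.eigenvalue i)
    {s : ℝ} (hs : 0 < s) (v : V) (i : ι) :
    inner ℝ (E.basis i) (E.semigroupDeriv s v) =
      -(E.eigenvalue i * Real.exp (-(s * E.eigenvalue i))) * inner ℝ (E.basis i) v := by
  rw [semigroupDeriv, E.inner_apply fun i => abs_semigroupDeriv_le hlam0 (hlam i), if_pos hs]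

theorem norm_semigroupDeriv_le (hlam0 : 0 ≤ lam) (hlam : ∀ i, lam ≤ E.eigenvalue i)
    (s : ℝ) (v : V) :
    ‖E.semigroupDeriv s v‖ ≤ |s|⁻¹ * Real.exp (-(lam / 2 * s)) * ‖v‖ :=
  E.norm_apply_le (by positivity) (fun i => abs_semigroupDeriv_le hlam0 (hlam i)) v

theorem continuous_semigroupDeriv (hlam0 : 0 ≤ lam) (hlam : ∀ i, lam ≤ E.eigenvalue i)
    (s : ℝ) : Continuous (E.semigroupDeriv s) :=
  (E.applyL (fun l => if 0 < s then -(l * Real.exp (-(s * l))) else 0)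
    (|s|⁻¹ * Real.exp (-(lam / 2 * s))) (by positivity)
    (fun i => abs_semigroupDeriv_le hlam0 (hlam i))).continuous

theorem measurable_semigroupDeriv (hlam0 : 0 ≤ lam) (hlam : ∀ i, lam ≤ E.eigenvalue i)
    [MeasurableSpace V] [BorelSpace V] [SecondCountableTopology V] {α : Type*} [MeasurableSpace α]
    {τ : α → ℝ} (hτ : Measurable τ) {F : α → V} (hF : Measurable F) :
    Measurable fun a => E.semigroupDeriv (τ a) (F a) :=
  E.measurable_apply (φ := fun a l => if 0 < τ a then -(l * Real.exp (-(τ a * l))) else 0)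
    (fun a i => abs_semigroupDeriv_le hlam0 (hlam i))
    (fun l => Measurable.ite (measurableSet_lt measurable_const hτ) (by fun_prop)
      measurable_const) hF

end Eigensystem

/-! ### Convolution of the semigroup with the past of a path -/

theorem integral_exp_neg_mul_Ioi_zero {a : ℝ} (ha : 0 < a) :
    ∫ s in Ioi (0 : ℝ), Real.exp (-a * s) = 1 / a := by
  have := integral_exp_mul_Ioi (neg_neg_of_pos ha) 0
  simpa [neg_div_neg_eq] using this

namespace Eigensystem

variable {V : Type*} [NormedAddCommGroup V] [InnerProductSpace ℝ V]
  {T : V →ₗ.[ℝ] V} {ι : Type*} (E : Eigensystem T ι) (hT : IsPositiveCompactInverse T)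
  {lam : ℝ}

/-- The semigroup decays exponentially with rate `lam`. -/
def HasDecay (E : Eigensystem T ι) (lam : ℝ) : Prop :=
  ∀ t : ℝ, 0 ≤ t → ∀ v : V, ‖E.semigroup t v‖ ≤ Real.exp (-(lam * t)) * ‖v‖

/-- The convolution `∫_{-∞}^0 exp (r T) h(r) dr` of the semigroup with the past of `h`. -/
noncomputable def pastConv (h : ℝ → V) : V := ∫ s in Ioi (0 : ℝ), E.semigroupL hT s (h (-s))

section Bounds

variable {h h₁ h₂ : ℝ → V} {D δ : ℝ}

theorem norm_semigroupL_le_of_le (hdec : E.HasDecay lam)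
    (hD : ∀ s : ℝ, 0 < s → ‖h (-s)‖ ≤ D * Real.exp (δ * s)) :
    ∀ᵐ s ∂(volume.restrict (Ioi (0 : ℝ))),
      ‖E.semigroupL hT s (h (-s))‖ ≤ D * Real.exp (-(lam - δ) * s) := by
  filter_upwards [ae_restrict_mem measurableSet_Ioi] with s hs
  rw [E.semigroupL_apply hT (le_of_lt hs)]
  refine (hdec s (le_of_lt hs) _).trans ?_
  refine (mul_le_mul_of_nonneg_left (hD s hs) (Real.exp_pos _).le).trans_eq ?_
  rw [mul_left_comm, ← Real.exp_add]
  ring_nf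

theorem norm_pastConv_le (hdec : E.HasDecay lam)
    (hδ : δ < lam)
    (hD : ∀ s : ℝ, 0 < s → ‖h (-s)‖ ≤ D * Real.exp (δ * s)) :
    ‖E.pastConv hT h‖ ≤ D / (lam - δ) := by
  refine (norm_integral_le_of_norm_le
    ((exp_neg_integrableOn_Ioi 0 (sub_pos.2 hδ)).const_mul D)
    (E.norm_semigroupL_le_of_le hT hdec hD)).trans_eq ?_
  rw [integral_const_mul, integral_exp_neg_mul_Ioi_zero (sub_pos.2 hδ)]
  ring

variable [MeasurableSpace V] [BorelSpace V] [SecondCountableTopology V]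

theorem integrableOn_pastConv (hdec : E.HasDecay lam)
    (hδ : δ < lam) (hm : Measurable h)
    (hD : ∀ s : ℝ, 0 < s → ‖h (-s)‖ ≤ D * Real.exp (δ * s)) :
    IntegrableOn (fun s => E.semigroupL hT s (h (-s))) (Ioi 0) :=
  Integrable.mono' ((exp_neg_integrableOn_Ioi 0 (sub_pos.2 hδ)).const_mul D)
    (E.measurable_semigroupL hT measurable_id (hm.comp measurable_neg)).aestronglyMeasurable
    (E.norm_semigroupL_le_of_le hT hdec hD)

theorem pastConv_sub (hdec : E.HasDecay lam)
    {D' : ℝ} (hδ : δ < lam) (hm₁ : Measurable h₁) (hm₂ : Measurable h₂)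
    (hD₁ : ∀ s : ℝ, 0 < s → ‖h₁ (-s)‖ ≤ D * Real.exp (δ * s))
    (hD₂ : ∀ s : ℝ, 0 < s → ‖h₂ (-s)‖ ≤ D' * Real.exp (δ * s)) :
    E.pastConv hT h₁ - E.pastConv hT h₂ = E.pastConv hT fun r => h₁ r - h₂ r := by
  rw [pastConv, pastConv, pastConv, ← integral_sub (E.integrableOn_pastConv hT hdec hδ hm₁ hD₁)
    (E.integrableOn_pastConv hT hdec hδ hm₂ hD₂)]
  simp only [map_sub]

/-- Variation of constants: split the integral over the past of `t` at time zero. The part before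
zero is transported by `S(t)` through the semigroup law, and the rest is the finite convolution. -/
theorem pastConv_shift [CompleteSpace V] (hdec : E.HasDecay lam)
    (hδ0 : 0 ≤ δ) (hδ : δ < lam) (hD0 : 0 ≤ D)
    (hm : Measurable h) (hD : ∀ r, ‖h r‖ ≤ D * Real.exp (δ * |r|)) {t : ℝ} (ht : 0 ≤ t) :
    E.pastConv hT (fun r => h (r + t)) =
      E.semigroup t (E.pastConv hT h) + ∫ r in (0 : ℝ)..t, E.semigroup (t - r) (h r) := by
  have hD' : ∀ s : ℝ, 0 < s → ‖h (-s)‖ ≤ D * Real.exp (δ * s) := fun s hs => by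
    simpa [abs_of_pos hs] using hD (-s)
  have hDt : ∀ s : ℝ, 0 < s → ‖h (-s + t)‖ ≤ (D * Real.exp (δ * t)) * Real.exp (δ * s) :=
    fun s hs => by
      refine (hD _).trans ?_
      rw [mul_assoc, ← Real.exp_add, ← mul_add]
      gcongr
      rw [abs_le]
      constructor <;> linarith
  have hint := E.integrableOn_pastConv hT hdec hδ (h := fun r => h (r + t))
    (hm.comp (measurable_add_const t)) hDt
  have h1 := intervalIntegral.integral_interval_add_Ioi hint
    (hint.mono_set (Ioi_subset_Ioi ht))
  rw [pastConv, ← h1, add_comm]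
  congr 1
  · have h2 : ∫ s in Ioi t, E.semigroupL hT s (h (-s + t)) =
        ∫ s in Ioi (0 : ℝ), E.semigroupL hT (s + t) (h (-s)) := by
      have := (measurePreserving_add_right volume t).setIntegral_preimage_emb
        (measurableEmbedding_addRight t) (fun s => E.semigroupL hT s (h (-s + t))) (Ioi t)
      rw [← this]
      simp
    rw [h2, ← E.semigroupL_apply hT ht, pastConv,
      ← ContinuousLinearMap.integral_comp_comm _ (E.integrableOn_pastConv hT hdec hδ hm hD')]
    refine setIntegral_congr_fun measurableSet_Ioi fun s hs => ?_
    have hs' : (0 : ℝ) ≤ s := le_of_lt hs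
    simp only [E.semigroupL_apply hT ht, E.semigroupL_apply hT hs',
      E.semigroupL_apply hT (add_nonneg hs' ht)]
    rw [E.semigroup_add hT ht hs', add_comm]
  · have h3 := intervalIntegral.integral_comp_sub_left (a := 0) (b := t)
      (fun s => E.semigroupL hT s (h (-s + t))) t
    rw [sub_self, sub_zero] at h3
    rw [← h3]
    refine intervalIntegral.integral_congr fun r hr => ?_
    rw [uIcc_of_le ht] at hr
    simp only [E.semigroupL_apply hT (sub_nonneg.2 hr.2)]
    congr 2
    ring

theorem continuous_pastConv_shift (hdec : E.HasDecay lam)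
    (hδ0 : 0 ≤ δ) (hδ : δ < lam) (hD0 : 0 ≤ D)
    (hc : Continuous h) (hD : ∀ r, ‖h r‖ ≤ D * Real.exp (δ * |r|)) :
    Continuous fun t => E.pastConv hT fun r => h (r + t) := by
  refine continuous_iff_continuousAt.2 fun t₀ => ?_
  refine continuousAt_of_dominated
    (bound := fun s => (D * Real.exp (δ * (|t₀| + 1))) * Real.exp (-(lam - δ) * s))
    (Eventually.of_forall fun t => (E.measurable_semigroupL hT measurable_id
      (hc.measurable.comp (measurable_neg.add_const t))).aestronglyMeasurable) ?_
    ((exp_neg_integrableOn_Ioi 0 (sub_pos.2 hδ)).const_mul _) ?_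
  · filter_upwards [Metric.ball_mem_nhds t₀ one_pos] with t ht
    refine E.norm_semigroupL_le_of_le hT hdec (h := fun r => h (r + t)) fun s hs => ?_
    refine (hD _).trans ?_
    rw [mul_assoc, ← Real.exp_add, ← mul_add]
    rw [Metric.mem_ball, Real.dist_eq] at ht
    gcongr
    have h1 := abs_add_le (-s) t
    have h2 := abs_add_le (t - t₀) t₀
    rw [sub_add_cancel] at h2
    rw [abs_neg, abs_of_pos hs] at h1
    linarith
  · refine Eventually.of_forall fun s => ?_
    exact ((E.semigroupL hT s).continuous.comp
      (hc.comp (continuous_const.add continuous_id))).continuousAt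

end Bounds

end Eigensystem

/-! ### The random fixed point by successive approximation -/

namespace PathSpace

variable {V : Type*} [NormedAddCommGroup V] {γ : ℝ≥0}

/-- Along the orbit of `ω`, the norm of `Z` grows at most like `C * exp (δ * |t|)`. -/
def OrbitGrowth (Z : PathSpace V γ → V) (ω : PathSpace V γ) (C δ : ℝ) : Prop :=
  ∀ t : ℝ, ‖Z (shift t ω)‖ ≤ C * Real.exp (δ * |t|)

/-- Along every orbit in `S`, `Z` is continuous and grows subexponentially. -/
structure IsSubexpOn (Z : PathSpace V γ → V) (S : Set (PathSpace V γ)) : Prop where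
  continuous : ∀ ω ∈ S, Continuous fun t => Z (shift t ω)
  growth : ∀ ω ∈ S, ∀ δ : ℝ, 0 < δ → ∃ C : ℝ, OrbitGrowth Z ω C δ

variable {Z : PathSpace V γ → V} {ω : PathSpace V γ} {C δ : ℝ}

theorem OrbitGrowth.norm_le (h : OrbitGrowth Z ω C δ) : ‖Z ω‖ ≤ C := by
  simpa [shift_zero] using h 0

theorem OrbitGrowth.nonneg (h : OrbitGrowth Z ω C δ) : 0 ≤ C := (norm_nonneg _).trans h.norm_le

theorem OrbitGrowth.shift (h : OrbitGrowth Z ω C δ) (hδ : 0 ≤ δ) (u : ℝ) :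
    OrbitGrowth Z (shift u ω) (C * Real.exp (δ * |u|)) δ := fun t => by
  rw [shift_shift]
  refine (h _).trans ?_
  rw [mul_assoc, ← Real.exp_add, ← mul_add]
  have := abs_add_le t u
  have := h.nonneg
  gcongr
  linarith

end PathSpace

namespace Eigensystem

open PathSpace

variable {V : Type*} [NormedAddCommGroup V] [InnerProductSpace ℝ V] {γ : ℝ≥0}
  {T : V →ₗ.[ℝ] V} {ι : Type*} (E : Eigensystem T ι) (hT : IsPositiveCompactInverse T)
  {lam : ℝ} (G : V → V) (Z : PathSpace V γ → V)

/-- The successive approximations of the stationary solution of `dU = -T U dt + G(U + Z) dt`. -/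
noncomputable def picard : ℕ → PathSpace V γ → V
  | 0 => fun _ => 0
  | k + 1 => fun ω => E.pastConv hT fun r => G (picard k (shift r ω) + Z (shift r ω))

theorem picard_succ (k : ℕ) (ω : PathSpace V γ) : E.picard hT G Z (k + 1) ω =
    E.pastConv hT fun r => G (E.picard hT G Z k (shift r ω) + Z (shift r ω)) := rfl

variable {G Z} {C₁ δ C : ℝ} {ω : PathSpace V γ}

/-- The a priori bound for the stationary solution. -/
noncomputable def picardBound (G : V → V) (C₁ d C : ℝ) : ℝ := (‖G 0‖ + C₁ * C) / (d - C₁)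

theorem norm_lipschitz_le (hG : ∀ y₁ y₂, ‖G y₁ - G y₂‖ ≤ C₁ * ‖y₁ - y₂‖) (y : V) :
    ‖G y‖ ≤ ‖G 0‖ + C₁ * ‖y‖ := by
  have h1 := hG y 0
  rw [sub_zero] at h1
  have h2 := norm_le_norm_add_norm_sub' (G y) (G 0)
  linarith

theorem picardBound_mul_exp_le {d s : ℝ} (hd : C₁ < d) (hs : 0 ≤ s) :
    picardBound G C₁ d (C * Real.exp s) ≤ picardBound G C₁ d C * Real.exp s := by
  rw [picardBound, picardBound, div_mul_eq_mul_div]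
  have : 0 < d - C₁ := sub_pos.2 hd
  have h1 : 1 ≤ Real.exp s := Real.one_le_exp hs
  gcongr
  nlinarith [mul_nonneg (norm_nonneg (G 0)) (sub_nonneg.2 h1)]

/-- An a priori bound valid at every path transfers along the orbit, since shifting a path by `r`
multiplies its growth constant by `exp (δ |r|)` only. -/
theorem norm_picard_arg_le (hC₁ : 0 < C₁) (hG : ∀ y₁ y₂, ‖G y₁ - G y₂‖ ≤ C₁ * ‖y₁ - y₂‖)
    {d : ℝ} (hd : C₁ < d) (hδ0 : 0 ≤ δ) {U : PathSpace V γ → V}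
    (hU : ∀ ω C, OrbitGrowth Z ω C δ → ‖U ω‖ ≤ picardBound G C₁ d C)
    (h : OrbitGrowth Z ω C δ) (r : ℝ) :
    ‖G (U (shift r ω) + Z (shift r ω))‖ ≤ (d * picardBound G C₁ d C) * Real.exp (δ * |r|) := by
  have h0 : 0 ≤ δ * |r| := by positivity
  have h1 := (hU _ _ (h.shift hδ0 r)).trans (picardBound_mul_exp_le hd h0)
  have h2 := h r
  have h3 := norm_lipschitz_le hG (U (shift r ω) + Z (shift r ω))
  have h4 := norm_add_le (U (shift r ω)) (Z (shift r ω))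
  have h5 : 1 ≤ Real.exp (δ * |r|) := Real.one_le_exp h0
  -- `picardBound` is the solution `q` of `d q = ‖G 0‖ + C₁ C + C₁ q`. Since the convolution divides
  -- by `d = lam - δ`, the bound reproduces itself in the iteration.
  have h6 : d * picardBound G C₁ d C = ‖G 0‖ + C₁ * C + C₁ * picardBound G C₁ d C := by
    rw [picardBound]
    have : d - C₁ ≠ 0 := (sub_pos.2 hd).ne'
    field_simp
    ring
  rw [h6]
  have h7 : C₁ * ‖U (shift r ω) + Z (shift r ω)‖ ≤
      C₁ * (picardBound G C₁ d C * Real.exp (δ * |r|) + C * Real.exp (δ * |r|)) := by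
    gcongr
    linarith
  nlinarith [mul_nonneg (norm_nonneg (G 0)) (sub_nonneg.2 h5)]

theorem norm_picard_le (hdec : E.HasDecay lam) (hC₁ : 0 < C₁)
    (hG : ∀ y₁ y₂, ‖G y₁ - G y₂‖ ≤ C₁ * ‖y₁ - y₂‖) (hδ0 : 0 ≤ δ) (hδ : C₁ < lam - δ) (k : ℕ) :
    ∀ ω C, OrbitGrowth Z ω C δ → ‖E.picard hT G Z k ω‖ ≤ picardBound G C₁ (lam - δ) C := by
  have hd : 0 < lam - δ := hC₁.trans hδ
  induction k with
  | zero =>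
    intro ω C h
    have := h.nonneg
    have := sub_pos.2 hδ
    simp only [picard, norm_zero, picardBound]
    positivity
  | succ k ih =>
    intro ω C h
    have hδl : δ < lam := sub_pos.1 hd
    rw [picard_succ]
    refine (E.norm_pastConv_le hT hdec hδl (D := (lam - δ) * picardBound G C₁ (lam - δ) C)
      fun s hs => ?_).trans_eq ?_
    · have := norm_picard_arg_le hC₁ hG hδ hδ0 ih h (-s)
      rwa [abs_neg, abs_of_pos hs] at this
    · field_simp

variable [MeasurableSpace V] [BorelSpace V] [SecondCountableTopology V]

theorem measurable_picard (hG : ∀ y₁ y₂, ‖G y₁ - G y₂‖ ≤ C₁ * ‖y₁ - y₂‖) (hZ : Measurable Z)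
    (k : ℕ) : Measurable (E.picard hT G Z k) := by
  have hGm : Measurable G := (LipschitzWith.of_dist_le' (K := C₁) fun x y => by
    simpa [dist_eq_norm] using hG x y).continuous.measurable
  induction k with
  | zero => exact measurable_const
  | succ k ih =>
    have hsh : Measurable fun p : PathSpace V γ × ℝ => shift (-p.2) p.1 :=
      measurable_shift_uncurry.comp (measurable_snd.neg.prodMk measurable_fst)
    have h1 : Measurable fun p : PathSpace V γ × ℝ => E.semigroupL hT p.2
        (G (E.picard hT G Z k (shift (-p.2) p.1) + Z (shift (-p.2) p.1))) :=
      E.measurable_semigroupL hT measurable_snd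
        (hGm.comp ((ih.comp hsh).add (hZ.comp hsh)))
    exact (h1.stronglyMeasurable.integral_prod_right (ν := volume.restrict (Ioi 0))).measurable

/-- Each iteration gains a factor `C₁` from the Lipschitz bound and `1 / (lam - δ)` from the
convolution. The statement ranges over all paths because the induction uses it at shifted ones. -/
theorem norm_picard_succ_sub_le (hdec : E.HasDecay lam) (hC₁ : 0 < C₁)
    (hG : ∀ y₁ y₂, ‖G y₁ - G y₂‖ ≤ C₁ * ‖y₁ - y₂‖) (hZ : Measurable Z)
    (hδ0 : 0 ≤ δ) (hδ : C₁ < lam - δ) (k : ℕ) :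
    ∀ ω C, OrbitGrowth Z ω C δ → ‖E.picard hT G Z (k + 1) ω - E.picard hT G Z k ω‖ ≤
      picardBound G C₁ (lam - δ) C * (C₁ / (lam - δ)) ^ k := by
  have hd : 0 < lam - δ := hC₁.trans hδ
  have hGm : Measurable G := (LipschitzWith.of_dist_le' (K := C₁) fun x y => by
    simpa [dist_eq_norm] using hG x y).continuous.measurable
  have hmeas : ∀ k ω, Measurable fun r => G (E.picard hT G Z k (shift r ω) + Z (shift r ω)) :=
    fun k ω => hGm.comp (((E.measurable_picard hT hG hZ k).comp (measurable_shift_left ω)).add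
      (hZ.comp (measurable_shift_left ω)))
  have hbd : ∀ k ω C, OrbitGrowth Z ω C δ → ∀ s : ℝ, 0 < s →
      ‖G (E.picard hT G Z k (shift (-s) ω) + Z (shift (-s) ω))‖ ≤
        ((lam - δ) * picardBound G C₁ (lam - δ) C) * Real.exp (δ * s) := fun k ω C h s hs => by
    have := norm_picard_arg_le hC₁ hG hδ hδ0
      (E.norm_picard_le hT hdec hC₁ hG hδ0 hδ k) h (-s)
    rwa [abs_neg, abs_of_pos hs] at this
  induction k with
  | zero =>
    intro ω C h
    have := E.norm_picard_le hT hdec hC₁ hG hδ0 hδ 1 ω C h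
    simpa [picard] using this
  | succ k ih =>
    intro ω C h
    rw [E.picard_succ hT G Z (k + 1), E.picard_succ hT G Z k,
      E.pastConv_sub hT hdec (δ := δ) (by linarith) (hmeas (k + 1) ω) (hmeas k ω)
      (hbd (k + 1) ω C h) (hbd k ω C h)]
    refine (E.norm_pastConv_le hT hdec (δ := δ) (by linarith)
      (D := C₁ * (picardBound G C₁ (lam - δ) C * (C₁ / (lam - δ)) ^ k)) fun s hs => ?_).trans_eq ?_
    · refine (hG _ _).trans ?_
      rw [add_sub_add_right_eq_sub, mul_assoc]
      refine mul_le_mul_of_nonneg_left ?_ hC₁.le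
      refine (ih _ _ (h.shift hδ0 (-s))).trans ?_
      rw [abs_neg, abs_of_pos hs, mul_right_comm]
      exact mul_le_mul_of_nonneg_right (picardBound_mul_exp_le hδ (by positivity))
        (by positivity)
    · rw [pow_succ]
      ring

theorem continuous_picard_orbit {S : Set (PathSpace V γ)} (hS : IsSubexpOn Z S)
    (hdec : E.HasDecay lam) (hC₁ : 0 < C₁) (hgap : C₁ < lam)
    (hG : ∀ y₁ y₂, ‖G y₁ - G y₂‖ ≤ C₁ * ‖y₁ - y₂‖)
    (k : ℕ) {ω : PathSpace V γ} (hω : ω ∈ S) :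
    Continuous fun t => E.picard hT G Z k (shift t ω) := by
  obtain ⟨δ, hδ0, hδ⟩ : ∃ δ, 0 < δ ∧ C₁ < lam - δ :=
    ⟨(lam - C₁) / 2, by linarith, by linarith⟩
  have hGc : Continuous G := (LipschitzWith.of_dist_le' (K := C₁) fun x y => by
    simpa [dist_eq_norm] using hG x y).continuous
  obtain ⟨C, hC⟩ := hS.growth ω hω δ hδ0
  induction k with
  | zero => exact continuous_const
  | succ k ih =>
    have h1 := E.continuous_pastConv_shift hT hdec hδ0.le (by linarith)
      (D := (lam - δ) * picardBound G C₁ (lam - δ) C) ?_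
      (hGc.comp (ih.add (hS.continuous ω hω)))
      (norm_picard_arg_le hC₁ hG hδ hδ0.le (E.norm_picard_le hT hdec hC₁ hG hδ0.le hδ k) hC)
    · refine h1.congr fun t => ?_
      simp only [picard_succ, shift_shift, Function.comp_apply, Pi.add_apply]
    · have := hC.nonneg
      have := sub_pos.2 hδ
      have : 0 < lam - δ := by linarith
      rw [picardBound]
      positivity

/-- The iterates converge geometrically on `S`, locally uniformly along orbits, so the limit
inherits continuity along orbits. The equation passes to the limit by dominated convergence. -/
theorem exists_stationary [CompleteSpace V] {S : Set (PathSpace V γ)} (hSm : MeasurableSet S)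
    (hSinv : ∀ ω ∈ S, ∀ t, shift t ω ∈ S) (hS : IsSubexpOn Z S) (hZ : Measurable Z)
    (hdec : E.HasDecay lam) (hC₁ : 0 < C₁) (hgap : C₁ < lam)
    (hG : ∀ y₁ y₂, ‖G y₁ - G y₂‖ ≤ C₁ * ‖y₁ - y₂‖) :
    ∃ U : PathSpace V γ → V, Measurable U ∧ IsSubexpOn U S ∧
      ∀ ω ∈ S, U ω = E.pastConv hT fun r => G (U (shift r ω) + Z (shift r ω)) := by
  classical
  have hGc : Continuous G := (LipschitzWith.of_dist_le' (K := C₁) fun x y => by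
    simpa [dist_eq_norm] using hG x y).continuous
  -- Spending half of the gap on the exponential weight still leaves a ratio `C₁ / (lam - δ₀)` below
  -- one.
  obtain ⟨δ₀, hδ₀0, hδ₀⟩ : ∃ δ, 0 < δ ∧ C₁ < lam - δ :=
    ⟨(lam - C₁) / 2, by linarith, by linarith⟩
  have hstep : ∀ ω C, OrbitGrowth Z ω C δ₀ → ∀ k,
      dist (E.picard hT G Z k ω) (E.picard hT G Z (k + 1) ω) ≤
        picardBound G C₁ (lam - δ₀) C * (C₁ / (lam - δ₀)) ^ k := fun ω C h k => by
    rw [dist_comm, dist_eq_norm]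
    exact E.norm_picard_succ_sub_le hT hdec hC₁ hG hZ hδ₀0.le hδ₀ k ω C h
  have hκ : C₁ / (lam - δ₀) < 1 := by rw [div_lt_one (by linarith)]; exact hδ₀
  have hκ0 : 0 ≤ C₁ / (lam - δ₀) := div_nonneg hC₁.le (by linarith)
  -- The value `0` off `S` makes the limit globally that of the measurable indicator functions of
  -- the iterates.
  have hlim : ∀ ω, ∃ u : V, (ω ∈ S → Tendsto (fun k => E.picard hT G Z k ω) atTop (𝓝 u)) ∧
      (ω ∉ S → u = 0) := fun ω => by
    by_cases hω : ω ∈ S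
    · obtain ⟨C, hC⟩ := hS.growth ω hω δ₀ hδ₀0
      obtain ⟨u, hu⟩ := cauchySeq_tendsto_of_complete
        (cauchySeq_of_le_geometric _ _ hκ (hstep ω C hC))
      exact ⟨u, fun _ => hu, fun h => absurd hω h⟩
    · exact ⟨0, fun h => absurd h hω, fun _ => rfl⟩
  choose U hU hU0 using hlim
  have hUb : ∀ ω ∈ S, ∀ δ, 0 < δ → C₁ < lam - δ → ∀ C, OrbitGrowth Z ω C δ →
      ‖U ω‖ ≤ picardBound G C₁ (lam - δ) C := fun ω hω δ h0 h1 C hC =>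
    le_of_tendsto (hU ω hω).norm (Eventually.of_forall fun k =>
      E.norm_picard_le hT hdec hC₁ hG h0.le h1 k ω C hC)
  refine ⟨U, ?_, ⟨fun ω hω => ?_, fun ω hω δ hδ => ?_⟩, fun ω hω => ?_⟩
  · refine measurable_of_tendsto_metrizable (f := fun k => S.indicator (E.picard hT G Z k))
      (fun k => (E.measurable_picard hT hG hZ k).indicator hSm) ?_
    rw [tendsto_pi_nhds]
    intro ω
    by_cases hω : ω ∈ S
    · simpa [hω] using hU ω hω
    · simp [hω, hU0 ω hω]
  · obtain ⟨C, hC⟩ := hS.growth ω hω δ₀ hδ₀0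
    have hloc : TendstoLocallyUniformly (fun k t => E.picard hT G Z k (shift t ω))
        (fun t => U (shift t ω)) atTop := by
      rw [Metric.tendstoLocallyUniformly_iff]
      intro ε hε t₀
      refine ⟨Metric.ball t₀ 1, Metric.ball_mem_nhds _ one_pos, ?_⟩
      have h1 : Tendsto (fun k : ℕ => picardBound G C₁ (lam - δ₀)
          (C * Real.exp (δ₀ * (|t₀| + 1))) * (C₁ / (lam - δ₀)) ^ k / (1 - C₁ / (lam - δ₀)))
          atTop (𝓝 0) := by
        have := ((tendsto_pow_atTop_nhds_zero_of_lt_one hκ0 hκ).const_mul (picardBound G C₁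
          (lam - δ₀) (C * Real.exp (δ₀ * (|t₀| + 1))))).div_const (1 - C₁ / (lam - δ₀))
        simpa using this
      filter_upwards [h1.eventually (gt_mem_nhds hε)] with k hk t ht
      refine lt_of_le_of_lt ?_ hk
      rw [dist_comm]
      refine dist_le_of_le_geometric_of_tendsto _ _ hκ (hstep _ _ ?_)
        (hU _ (hSinv ω hω t)) k
      intro u
      refine (hC.shift hδ₀0.le t u).trans ?_
      have := hC.nonneg
      rw [Metric.mem_ball, Real.dist_eq] at ht
      have h2 := abs_add_le (t - t₀) t₀
      rw [sub_add_cancel] at h2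
      gcongr
      linarith
    exact hloc.continuous (Frequently.of_forall fun k =>
      E.continuous_picard_orbit hT hS hdec hC₁ hgap hG k hω)
  -- The limit does not depend on the weight, so it can be estimated with an arbitrarily small rate;
  -- `δ₀` is only a cap that preserves the gap.
  · have h0 : 0 < min δ δ₀ := lt_min hδ hδ₀0
    obtain ⟨C, hC⟩ := hS.growth ω hω _ h0
    have h1 : C₁ < lam - min δ δ₀ := by linarith [min_le_right δ δ₀]
    refine ⟨picardBound G C₁ (lam - min δ δ₀) C, fun t => ?_⟩
    refine (hUb _ (hSinv ω hω t) _ h0 h1 _ (hC.shift h0.le t)).trans ?_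
    refine (picardBound_mul_exp_le h1 (by positivity)).trans ?_
    have h2 : 0 ≤ picardBound G C₁ (lam - min δ δ₀) C := (norm_nonneg _).trans
      (hUb ω hω _ h0 h1 _ hC)
    gcongr
    exact min_le_left _ _
  · obtain ⟨C, hC⟩ := hS.growth ω hω δ₀ hδ₀0
    refine tendsto_nhds_unique ((tendsto_add_atTop_iff_nat 1).2 (hU ω hω)) ?_
    simp only [picard_succ]
    refine tendsto_integral_of_dominated_convergence
      (fun s => ((lam - δ₀) * picardBound G C₁ (lam - δ₀) C) * Real.exp (-(lam - δ₀) * s))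
      (fun k => ?_) ((exp_neg_integrableOn_Ioi 0 (by linarith)).const_mul _)
      (fun k => E.norm_semigroupL_le_of_le hT hdec
        (h := fun r => G (E.picard hT G Z k (shift r ω) + Z (shift r ω))) fun s hs => ?_)
      (Eventually.of_forall fun s => ?_)
    · have hsh : Measurable fun s => shift (-s) ω :=
        (measurable_shift_left ω).comp measurable_neg
      exact (E.measurable_semigroupL hT measurable_id (hGc.measurable.comp
        (((E.measurable_picard hT hG hZ k).comp hsh).add (hZ.comp hsh)))).aestronglyMeasurable
    · have := norm_picard_arg_le hC₁ hG hδ₀ hδ₀0.le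
        (E.norm_picard_le hT hdec hC₁ hG hδ₀0.le hδ₀ k) hC (-s)
      rwa [abs_neg, abs_of_pos hs] at this
    · exact ((E.semigroupL hT s).continuous.tendsto _).comp ((hGc.tendsto _).comp
        ((hU _ (hSinv ω hω (-s))).add_const _))

end Eigensystem

/-! ### The stationary Ornstein--Uhlenbeck process -/

namespace PathSpace

variable {V : Type*} [NormedAddCommGroup V] {γ : ℝ≥0} {ω : PathSpace V γ} {C δ : ℝ}

theorem HolderGrowth.norm_le (h : HolderGrowth ω C δ) (r : ℝ) :
    ‖ω r‖ ≤ C * Real.exp (δ * |r|) * |r| ^ (γ : ℝ) := by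
  have := h r 0
  rwa [coe_zero, sub_zero, sub_zero, abs_zero, add_zero] at this

/-- For `γ ≤ 1` the power of `|r|` is at most `1 + |r|`, which a second factor `exp (δ |r|)`
absorbs. -/
theorem HolderGrowth.exists_norm_le_exp (h : HolderGrowth ω C δ) (hγ : γ ≤ 1) (hδ : 0 < δ) :
    ∃ D, 0 ≤ D ∧ ∀ r, ‖ω r‖ ≤ D * Real.exp (2 * δ * |r|) := by
  refine ⟨C * (1 + 1 / δ), mul_nonneg h.nonneg (by positivity), fun r => ?_⟩
  refine (h.norm_le r).trans ?_
  have h1 : |r| ^ (γ : ℝ) ≤ 1 + |r| := by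
    rcases le_total |r| 1 with hr | hr
    · have := Real.rpow_le_one (abs_nonneg r) hr (NNReal.coe_nonneg γ)
      linarith [abs_nonneg r]
    · have := Real.rpow_le_rpow_of_exponent_le hr (NNReal.coe_le_coe.2 hγ)
      rw [NNReal.coe_one, Real.rpow_one] at this
      linarith
  have h2 : 1 + |r| ≤ (1 + 1 / δ) * Real.exp (δ * |r|) := by
    have h3 := Real.add_one_le_exp (δ * |r|)
    have h4 : |r| = 1 / δ * (δ * |r|) := by field_simp
    have h5 : 0 ≤ δ * |r| := by positivity
    have h6 : (1 : ℝ) ≤ Real.exp (δ * |r|) := by linarith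
    have h7 : |r| ≤ 1 / δ * Real.exp (δ * |r|) := by
      rw [h4]
      refine (mul_le_mul_of_nonneg_left (show δ * |r| ≤ Real.exp (δ * |r|) by linarith)
        (by positivity)).trans_eq ?_
      rw [← h4]
    linarith
  have h0 := h.nonneg
  calc C * Real.exp (δ * |r|) * |r| ^ (γ : ℝ)
      ≤ C * Real.exp (δ * |r|) * ((1 + 1 / δ) * Real.exp (δ * |r|)) := by
        gcongr
        exact h1.trans h2
    _ = C * (1 + 1 / δ) * (Real.exp (δ * |r|) * Real.exp (δ * |r|)) := by ring
    _ = _ := by rw [← Real.exp_add]; ring_nf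

end PathSpace

namespace Eigensystem

open PathSpace

variable {V : Type*} [NormedAddCommGroup V] [InnerProductSpace ℝ V] {γ : ℝ≥0}
  {T : V →ₗ.[ℝ] V} {ι : Type*} (E : Eigensystem T ι) (hT : IsPositiveCompactInverse T)
  {lam δ C : ℝ} {ω : PathSpace V γ}

/-- The stationary solution of `dZ = -T Z dt + dω`: integration by parts turns
`∫_{-∞}^0 exp (r T) dω(r)` into this integral. -/
noncomputable def stationaryOU (ω : PathSpace V γ) : V :=
  ∫ s in Ioi (0 : ℝ), E.semigroupDeriv s (ω (-s))

/-- The integrable majorant of the integrand of `stationaryOU`. -/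
noncomputable def ouMajorant (γ : ℝ≥0) (a s : ℝ) : ℝ := s ^ ((γ : ℝ) - 1) * Real.exp (-a * s)

theorem integrableOn_ouMajorant (hγ : 0 < γ) {a : ℝ} (ha : 0 < a) :
    IntegrableOn (ouMajorant γ a) (Ioi 0) := by
  have := integrableOn_rpow_mul_exp_neg_mul_rpow (p := 1) (s := (γ : ℝ) - 1) (b := a)
    (by have : (0 : ℝ) < γ := hγ
        linarith) one_pos ha
  simp only [Real.rpow_one] at this
  exact this

/-- Since the path vanishes at zero, its Hölder bound `s ^ γ` softens the singularity `s⁻¹` of the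
differentiated semigroup to the integrable `s ^ (γ - 1)`. -/
theorem norm_semigroupDeriv_path_le (hlam0 : 0 ≤ lam) (hlam : ∀ i, lam ≤ E.eigenvalue i)
    (h : HolderGrowth ω C δ) :
    ∀ᵐ s ∂(volume.restrict (Ioi (0 : ℝ))),
      ‖E.semigroupDeriv s (ω (-s))‖ ≤ C * ouMajorant γ (lam / 2 - δ) s := by
  filter_upwards [ae_restrict_mem measurableSet_Ioi] with s hs
  have hs' : (0 : ℝ) < s := hs
  refine (E.norm_semigroupDeriv_le hlam0 hlam s _).trans ?_
  refine (mul_le_mul_of_nonneg_left (h.norm_le (-s)) (by positivity)).trans_eq ?_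
  rw [ouMajorant, abs_neg, abs_of_pos hs', Real.rpow_sub hs', Real.rpow_one]
  have : Real.exp (-(lam / 2 - δ) * s) = Real.exp (-(lam / 2 * s)) * Real.exp (δ * s) := by
    rw [← Real.exp_add]; ring_nf
  rw [this]
  field_simp

theorem norm_stationaryOU_le (hγ : 0 < γ) (hlam0 : 0 ≤ lam) (hlam : ∀ i, lam ≤ E.eigenvalue i)
    (hδ : δ < lam / 2) (h : HolderGrowth ω C δ) :
    ‖E.stationaryOU ω‖ ≤ C * ∫ s in Ioi (0 : ℝ), ouMajorant γ (lam / 2 - δ) s := by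
  rw [← integral_const_mul]
  exact norm_integral_le_of_norm_le
    ((integrableOn_ouMajorant hγ (sub_pos.2 hδ)).const_mul C)
    (E.norm_semigroupDeriv_path_le hlam0 hlam h)

variable [MeasurableSpace V] [BorelSpace V] [SecondCountableTopology V]

theorem measurable_stationaryOU (hlam0 : 0 ≤ lam) (hlam : ∀ i, lam ≤ E.eigenvalue i) :
    Measurable (E.stationaryOU : PathSpace V γ → V) := by
  have h1 : Measurable fun p : PathSpace V γ × ℝ => E.semigroupDeriv p.2 (p.1 (-p.2)) :=
    E.measurable_semigroupDeriv hlam0 hlam measurable_snd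
      (measurable_uncurry_eval.comp (measurable_snd.neg.prodMk measurable_fst))
  exact (h1.stronglyMeasurable.integral_prod_right (ν := volume.restrict (Ioi 0))).measurable

theorem isSubexpOn_stationaryOU (hγ : 0 < γ) (hlam0 : 0 < lam) (hlam : ∀ i, lam ≤ E.eigenvalue i) :
    IsSubexpOn E.stationaryOU (temperedPaths V γ) := by
  constructor
  · intro ω hω
    obtain ⟨C, hC⟩ := hω (lam / 4) (by positivity)
    refine continuous_iff_continuousAt.2 fun t₀ => ?_
    refine continuousAt_of_dominated
      (bound := fun s => (C * Real.exp (2 * (lam / 4) * (|t₀| + 1))) *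
        ouMajorant γ (lam / 2 - lam / 4) s)
      (Eventually.of_forall fun t => (E.measurable_semigroupDeriv hlam0.le hlam measurable_id
        ((continuous_coe _).measurable.comp measurable_neg)).aestronglyMeasurable) ?_
      ((integrableOn_ouMajorant hγ (by linarith)).const_mul _) ?_
    · filter_upwards [Metric.ball_mem_nhds t₀ one_pos] with t ht
      refine E.norm_semigroupDeriv_path_le hlam0.le hlam ?_
      refine (hC.shift (by positivity) t).mono ?_ le_rfl
      have := hC.nonneg
      rw [Metric.mem_ball, Real.dist_eq] at ht
      have h2 := abs_add_le (t - t₀) t₀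
      rw [sub_add_cancel] at h2
      gcongr
      linarith
    · refine Eventually.of_forall fun s => ?_
      refine ((E.continuous_semigroupDeriv hlam0.le hlam s).comp ?_).continuousAt
      simp only [shift_apply]
      exact ((continuous_coe ω).comp (continuous_const.add continuous_id)).sub (continuous_coe ω)
  · intro ω hω δ hδ
    -- Half of `δ`, because a shift by `t` costs `exp (2 · rate · |t|)`; the cap `lam / 4` stays
    -- below the remaining decay rate `lam / 2`.
    have h0 : 0 < min (δ / 2) (lam / 4) := lt_min (by positivity) (by positivity)
    have h1 : min (δ / 2) (lam / 4) < lam / 2 := (min_le_right _ _).trans_lt (by linarith)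
    obtain ⟨C, hC⟩ := hω _ h0
    set I := ∫ s in Ioi (0 : ℝ), ouMajorant γ (lam / 2 - min (δ / 2) (lam / 4)) s
    have hI : 0 ≤ I := setIntegral_nonneg measurableSet_Ioi fun s hs =>
      mul_nonneg (Real.rpow_nonneg (le_of_lt hs) _) (Real.exp_pos _).le
    refine ⟨C * I, fun t => ?_⟩
    refine (E.norm_stationaryOU_le hγ hlam0.le hlam h1 (hC.shift h0.le t)).trans ?_
    rw [mul_right_comm]
    have := hC.nonneg
    gcongr
    linarith [min_le_left (δ / 2) (lam / 4)]

theorem inner_pastConv [CompleteSpace V] (hdec : E.HasDecay lam) (hδ : δ < lam) {h : ℝ → V}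
    {D : ℝ} (hm : Measurable h) (hD : ∀ s : ℝ, 0 < s → ‖h (-s)‖ ≤ D * Real.exp (δ * s)) (i : ι) :
    IntegrableOn (fun s => Real.exp (-(s * E.eigenvalue i)) * inner ℝ (E.basis i) (h (-s)))
      (Ioi 0) ∧
    inner ℝ (E.basis i) (E.pastConv hT h) =
      ∫ s in Ioi (0 : ℝ), Real.exp (-(s * E.eigenvalue i)) * inner ℝ (E.basis i) (h (-s)) := by
  have hint := E.integrableOn_pastConv hT hdec hδ hm hD
  have hcongr : ∀ s ∈ Ioi (0 : ℝ), inner ℝ (E.basis i) (E.semigroupL hT s (h (-s))) =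
      Real.exp (-(s * E.eigenvalue i)) * inner ℝ (E.basis i) (h (-s)) := fun s hs => by
    have hs' : (0 : ℝ) ≤ s := le_of_lt hs
    rw [E.semigroupL_apply hT hs', E.inner_semigroup hT hs']
  refine ⟨IntegrableOn.congr_fun (hint.const_inner (E.basis i)) hcongr measurableSet_Ioi, ?_⟩
  rw [pastConv, ← integral_inner hint (E.basis i)]
  exact setIntegral_congr_fun measurableSet_Ioi hcongr

/-- In one coordinate with eigenvalue `l`, the integrand is `l exp (-l s)` times the coefficient of
`ω t - ω (t - s)`. The constant part integrates to the coefficient of `ω t`, the other to `-l` times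
that of the convolution with the path. This undoes the integration by parts. -/
theorem inner_stationaryOU_shift [CompleteSpace V] (hγ : 0 < γ) (hdec : E.HasDecay lam)
    (hlam0 : 0 < lam) {D : ℝ} (hδ0 : 0 ≤ δ) (hδ : δ < lam)
    (hD0 : 0 ≤ D) (hD : ∀ r, ‖ω r‖ ≤ D * Real.exp (δ * |r|)) (hω : ω ∈ temperedPaths V γ)
    (t : ℝ) (i : ι) :
    inner ℝ (E.basis i) (ω t - E.stationaryOU (shift t ω)) =
      E.eigenvalue i * inner ℝ (E.basis i) (E.pastConv hT fun r => ω (r + t)) := by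
  have hlam := E.le_eigenvalue hT hdec
  have hl := E.eigenvalue_pos hT i
  obtain ⟨C, hC⟩ := hω (lam / 4) (by positivity)
  have hDt : ∀ s : ℝ, 0 < s → ‖ω (-s + t)‖ ≤ (D * Real.exp (δ * |t|)) * Real.exp (δ * s) :=
    fun s hs => by
      refine (hD _).trans ?_
      rw [mul_assoc, ← Real.exp_add, ← mul_add]
      gcongr
      have := abs_add_le (-s) t
      rw [abs_neg, abs_of_pos hs] at this
      linarith
  obtain ⟨h1, h2⟩ := E.inner_pastConv hT hdec hδ (h := fun r => ω (r + t))
    ((continuous_coe ω).measurable.comp (measurable_add_const t)) hDt i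
  have hint : IntegrableOn (fun s => E.semigroupDeriv s (shift t ω (-s))) (Ioi 0) :=
    Integrable.mono' ((integrableOn_ouMajorant hγ (show 0 < lam / 2 - lam / 4 by linarith)).const_mul _)
      (E.measurable_semigroupDeriv hlam0.le hlam measurable_id
        ((continuous_coe _).measurable.comp measurable_neg)).aestronglyMeasurable
      (E.norm_semigroupDeriv_path_le hlam0.le hlam (hC.shift (by positivity) t))
  have hexp : IntegrableOn (fun s => Real.exp (-E.eigenvalue i * s)) (Ioi 0) :=
    exp_neg_integrableOn_Ioi 0 hl
  have h3 : inner ℝ (E.basis i) (E.stationaryOU (shift t ω)) =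
      ∫ s in Ioi (0 : ℝ), ((E.eigenvalue i * inner ℝ (E.basis i) (ω t)) *
        Real.exp (-E.eigenvalue i * s) - E.eigenvalue i *
        (Real.exp (-(s * E.eigenvalue i)) * inner ℝ (E.basis i) (ω (-s + t)))) := by
    rw [stationaryOU, ← integral_inner hint (E.basis i)]
    refine setIntegral_congr_fun measurableSet_Ioi fun s hs => ?_
    simp only [E.inner_semigroupDeriv hlam0.le hlam hs, shift_apply, inner_sub_right]
    rw [show -E.eigenvalue i * s = -(s * E.eigenvalue i) by ring]
    ring
  rw [inner_sub_right, h3, integral_sub (hexp.const_mul _) (h1.const_mul _), integral_const_mul,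
    integral_const_mul, integral_exp_neg_mul_Ioi_zero hl, h2]
  field_simp
  ring

/-- By `pastConv_shift`, the finite convolution is the past convolution at time `t` minus `S(t)`
applied to the one at time `0`. Coordinatewise, `T` turns these into `ω t - Z(θ_t ω)` and `-Z(ω)`,
where `Z` is `stationaryOU`. -/
theorem mem_graph_stationaryOU [CompleteSpace V] (hT : IsPositiveCompactInverse T)
    (hγ : 0 < γ) (hγ1 : γ ≤ 1)
    (hdec : E.HasDecay lam) (hlam0 : 0 < lam) (hω : ω ∈ temperedPaths V γ) {t : ℝ} (ht : 0 ≤ t) :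
    (∫ r in (0 : ℝ)..t, E.semigroup (t - r) (ω r),
      ω t - E.stationaryOU (shift t ω) + E.semigroup t (E.stationaryOU ω)) ∈ T.graph := by
  obtain ⟨C, hC⟩ := hω (lam / 4) (by positivity)
  obtain ⟨D, hD0, hD⟩ := hC.exists_norm_le_exp hγ1 (by positivity)
  have hδ0 : 0 ≤ 2 * (lam / 4) := by positivity
  have hδ : 2 * (lam / 4) < lam := by linarith
  have h1 := E.pastConv_shift hT hdec hδ0 hδ hD0 (continuous_coe ω).measurable hD ht
  refine E.mem_graph_of_inner hT fun i => ?_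
  have h2 := E.inner_stationaryOU_shift hT hγ hdec hlam0 hδ0 hδ hD0 hD hω t i
  have h3 := E.inner_stationaryOU_shift hT hγ hdec hlam0 hδ0 hδ hD0 hD hω 0 i
  simp only [coe_zero, zero_sub, shift_zero, add_zero, inner_neg_right] at h3
  rw [inner_add_right, h2, h1, inner_add_right, E.inner_semigroup hT ht, E.inner_semigroup hT ht]
  linear_combination (-Real.exp (-(t * E.eigenvalue i))) * h3

end Eigensystem

/-! ### Existence of the tempered random fixed point -/

theorem LinearPMap.mem_graph_of_neg {V : Type*} [AddCommGroup V] [Module ℝ V] {B : V →ₗ.[ℝ] V}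
    {x y : V} (h : (x, y) ∈ (-B).graph) : (x, -y) ∈ B.graph := by
  obtain ⟨z, hz, hz'⟩ := (LinearPMap.mem_graph_iff _).1 h
  simp only [LinearPMap.neg_apply] at hz hz'
  rw [LinearPMap.mem_graph_iff]
  exact ⟨z, hz, by rw [← hz', neg_neg]⟩

section

variable {V : Type*} [NormedAddCommGroup V] {γ : ℝ≥0}

theorem isTemperedAt_of_growth {Y : PathSpace V γ → V} {ω : PathSpace V γ}
    (h : ∀ δ : ℝ, 0 < δ → ∃ C : ℝ, PathSpace.OrbitGrowth Y ω C δ) :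
    Tendsto (fun t : ℝ => Real.posLog ‖Y (PathSpace.shift t ω)‖ / |t|) (cocompact ℝ) (𝓝 0) := by
  have habs : Tendsto (fun t : ℝ => |t|) (cocompact ℝ) atTop := tendsto_norm_cocompact_atTop
  rw [Metric.tendsto_nhds]
  intro ε hε
  obtain ⟨C, hC⟩ := h (ε / 2) (by positivity)
  have h0 := hC.nonneg
  have hlog : 0 ≤ Real.log (1 + C) := Real.log_nonneg (by linarith)
  filter_upwards [habs.eventually (eventually_gt_atTop (2 / ε * Real.log (1 + C))),
    habs.eventually (eventually_gt_atTop 0)] with t ht ht0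
  have h1 : Real.posLog ‖Y (PathSpace.shift t ω)‖ ≤ Real.log (1 + C) + ε / 2 * |t| := by
    have h2 : 1 ≤ Real.exp (ε / 2 * |t|) := Real.one_le_exp (by positivity)
    rw [Real.posLog_eq_log_max_one (norm_nonneg _)]
    calc Real.log (max 1 ‖Y (PathSpace.shift t ω)‖)
        ≤ Real.log ((1 + C) * Real.exp (ε / 2 * |t|)) := by
          refine Real.log_le_log (by positivity) (max_le ?_ ((hC t).trans ?_))
          · nlinarith
          · gcongr
            linarith
      _ = _ := by rw [Real.log_mul (by positivity) (Real.exp_pos _).ne', Real.log_exp]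
  rw [Real.dist_eq, sub_zero, abs_of_nonneg (div_nonneg Real.posLog_nonneg (abs_nonneg t)),
    div_lt_iff₀ ht0]
  have h3 : Real.log (1 + C) < ε / 2 * |t| := by
    have := mul_lt_mul_of_pos_left ht (show 0 < ε / 2 by positivity)
    have h4 : ε / 2 * (2 / ε * Real.log (1 + C)) = Real.log (1 + C) := by field_simp
    linarith
  linarith

end

namespace IsFBMLaw

open PathSpace

variable {V : Type*} [NormedAddCommGroup V] [InnerProductSpace ℝ V] [CompleteSpace V]
  [SecondCountableTopology V] [MeasurableSpace V] [BorelSpace V] {γ : ℝ≥0} {H : ℝ}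
  {Q : V →L[ℝ] V} {P : Measure (PathSpace V γ)} {B : V →ₗ.[ℝ] V} {ι : Type*}

/-- The fixed point is `U x + Z`, with `Z` the stationary Ornstein–Uhlenbeck process and `U x` the
stationary solution of the equation driven by `Z`. All estimates hold on the tempered paths,
whatever `x` is. -/
theorem exists_isRandomFixedPoint (hP : IsFBMLaw H Q P) (hH : H < 1) (hγ : 0 < γ) (hγ1 : γ ≤ 1)
    (hB : IsPositiveCompactInverse (-B)) (E : Eigensystem (-B) ι) {lam C₁ : ℝ}
    (hdec : E.HasDecay lam) (hC₁ : 0 < C₁) (hgap : C₁ < lam) {g : V → V → V}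
    (hg : ∀ x y₁ y₂, ‖g x y₁ - g x y₂‖ ≤ C₁ * ‖y₁ - y₂‖) :
    ∃ Y : PathSpace V γ → V → V, IsRandomFixedPoint E g P Y := by
  have hlam0 : 0 < lam := hC₁.trans hgap
  have hlam := E.le_eigenvalue hB hdec
  have hS := hP.isInvariantFull_temperedPaths hH
  have hZ := E.isSubexpOn_stationaryOU (γ := γ) hγ hlam0 hlam
  have hZm := E.measurable_stationaryOU (γ := γ) hlam0.le hlam
  have hsh : ∀ ω ∈ temperedPaths V γ, ∀ t, shift t ω ∈ temperedPaths V γ :=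
    fun ω hω t => hS.shift_mem hω t
  choose U hUm hU hUeq using fun x => E.exists_stationary hB hS.measurableSet hsh hZ hZm hdec hC₁
    hgap (hg x)
  refine ⟨fun ω x => U x ω + E.stationaryOU ω, fun x => (hUm x).add hZm,
    temperedPaths V γ, hS, fun ω hω x => ⟨⟨?_, fun t ht => ?_⟩, ?_⟩⟩
  · exact (((hU x).continuous ω hω).add (hZ.continuous ω hω)).continuousOn
  -- With this value of `B`, the noise term `ω t + w` becomes `Z(θ_t ω) - S(t) Z(ω)`.
  · refine ⟨E.stationaryOU (shift t ω) - ω t - E.semigroup t (E.stationaryOU ω), ?_, ?_⟩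
    · have := LinearPMap.mem_graph_of_neg
        (E.mem_graph_stationaryOU hB hγ hγ1 hdec hlam0 hω ht)
      convert this using 2
      abel
    · obtain ⟨δ, hδ0, hδ⟩ : ∃ δ, 0 < δ ∧ δ < lam := ⟨lam / 2, by linarith, by linarith⟩
      obtain ⟨CU, hCU⟩ := (hU x).growth ω hω δ hδ0
      obtain ⟨CZ, hCZ⟩ := hZ.growth ω hω δ hδ0
      have hCU0 := hCU.nonneg
      have hCZ0 := hCZ.nonneg
      have hgc : Continuous (g x) := (LipschitzWith.of_dist_le' (K := C₁) fun y z => by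
        simpa [dist_eq_norm] using hg x y z).continuous
      have h1 := E.pastConv_shift hB hdec hδ0.le hδ (D := ‖g x 0‖ + C₁ * (CU + CZ))
        (h := fun r => g x (U x (shift r ω) + E.stationaryOU (shift r ω))) (by positivity)
        (hgc.comp (((hU x).continuous ω hω).add (hZ.continuous ω hω))).measurable
        (fun r => ?_) ht
      · have h2 := hUeq x _ (hsh ω hω t)
        simp only [shift_shift] at h2
        rw [h1, ← hUeq x ω hω] at h2
        beta_reduce
        rw [h2, ← E.semigroupL_apply hB ht, ← E.semigroupL_apply hB ht,
          ← E.semigroupL_apply hB ht, map_add]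
        abel
      · refine (Eigensystem.norm_lipschitz_le (hg x) _).trans ?_
        have h3 := norm_add_le (U x (shift r ω)) (E.stationaryOU (shift r ω))
        have h4 := hCU r
        have h5 := hCZ r
        have h6 : 1 ≤ Real.exp (δ * |r|) := Real.one_le_exp (by positivity)
        have h7 : C₁ * ‖U x (shift r ω) + E.stationaryOU (shift r ω)‖ ≤
            C₁ * (CU * Real.exp (δ * |r|) + CZ * Real.exp (δ * |r|)) := by
          gcongr
          linarith
        nlinarith [mul_nonneg (norm_nonneg (g x 0)) (sub_nonneg.2 h6)]
  · have h1 : ∀ δ : ℝ, 0 < δ → ∃ C : ℝ,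
        OrbitGrowth (fun ω => U x ω + E.stationaryOU ω) ω C δ := fun δ hδ => by
      obtain ⟨CU, hCU⟩ := (hU x).growth ω hω δ hδ
      obtain ⟨CZ, hCZ⟩ := hZ.growth ω hω δ hδ
      refine ⟨CU + CZ, fun t => ?_⟩
      rw [add_mul]
      exact norm_add_le_of_le (hCU t) (hCZ t)
    have h2 := isTemperedAt_of_growth h1
    exact ⟨h2.mono_left atTop_le_cocompact, h2.mono_left atBot_le_cocompact⟩

end IsFBMLaw

/-! ### Comparison of the fixed points for different parameters -/

/-- Gronwall: with `ψ t = p 0 + ∫₀ᵗ exp (lam r) (ρ + c p r) dr`, the hypothesis reads `p ≤ exp (-lam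
t) ψ`, whence `ψ' ≤ ρ exp (lam t) + c ψ`. Multiplication by the integrating factor `exp (-c t)` and
subtraction of a primitive of the inhomogeneity give the nonincreasing function `χ`. -/
theorem le_of_le_exp_convolution {p : ℝ → ℝ} (hp : Continuous p) {lam c ρ : ℝ} (hc : 0 < c)
    (hgap : c < lam) (hρ : 0 ≤ ρ)
    (h : ∀ t, 0 ≤ t → p t ≤ Real.exp (-(lam * t)) * p 0 +
      ∫ r in (0 : ℝ)..t, Real.exp (-(lam * (t - r))) * (ρ + c * p r)) {t : ℝ} (ht : 0 ≤ t) :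
    p t ≤ Real.exp (-((lam - c) * t)) * p 0 + ρ / (lam - c) := by
  have hd : 0 < lam - c := sub_pos.2 hgap
  set F : ℝ → ℝ := fun r => Real.exp (lam * r) * (ρ + c * p r) with hF
  have hFc : Continuous F := by fun_prop
  set ψ : ℝ → ℝ := fun t => p 0 + ∫ r in (0 : ℝ)..t, F r with hψ
  have hψd : ∀ t, HasDerivAt ψ (F t) t := fun t =>
    (hFc.integral_hasStrictDerivAt 0 t).hasDerivAt.const_add _
  have hpψ : ∀ t, 0 ≤ t → p t ≤ Real.exp (-(lam * t)) * ψ t := fun t ht => by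
    refine (h t ht).trans_eq ?_
    rw [hψ]
    simp only []
    rw [mul_add, ← intervalIntegral.integral_const_mul]
    congr 1
    refine intervalIntegral.integral_congr fun r _ => ?_
    simp only [hF]
    rw [← mul_assoc, ← Real.exp_add]
    ring_nf
  set χ : ℝ → ℝ := fun t => Real.exp (-(c * t)) * ψ t - ρ / (lam - c) * Real.exp ((lam - c) * t)
    with hχ
  have hχd : ∀ t, HasDerivAt χ (Real.exp (-(c * t)) * (F t - c * ψ t) -
      ρ * Real.exp ((lam - c) * t)) t := fun t => by
    have h1 : HasDerivAt (fun t => Real.exp (-(c * t))) (Real.exp (-(c * t)) * -(c * 1)) t :=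
      ((hasDerivAt_id t).const_mul c).neg.exp
    have h2 : HasDerivAt (fun t => Real.exp ((lam - c) * t))
        (Real.exp ((lam - c) * t) * ((lam - c) * 1)) t :=
      ((hasDerivAt_id t).const_mul (lam - c)).exp
    refine ((h1.mul (hψd t)).sub (h2.const_mul (ρ / (lam - c)))).congr_deriv ?_
    have h3 : ρ / (lam - c) * (Real.exp ((lam - c) * t) * ((lam - c) * 1)) =
        ρ * Real.exp ((lam - c) * t) := by
      field_simp
    rw [h3]
    ring
  have hanti : AntitoneOn χ (Ici 0) := by
    refine antitoneOn_of_deriv_nonpos (convex_Ici 0)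
      (fun t _ => (hχd t).continuousAt.continuousWithinAt)
      (fun t _ => (hχd t).differentiableAt.differentiableWithinAt) fun t ht => ?_
    rw [interior_Ici] at ht
    rw [(hχd t).deriv]
    have h1 := hpψ t (le_of_lt ht)
    have h2 : F t ≤ Real.exp (lam * t) * ρ + c * ψ t := by
      have h3 : Real.exp (lam * t) * Real.exp (-(lam * t)) = 1 := by
        rw [← Real.exp_add, add_neg_cancel, Real.exp_zero]
      have h4 : Real.exp (lam * t) * p t ≤ ψ t := by
        refine (mul_le_mul_of_nonneg_left h1 (Real.exp_pos _).le).trans_eq ?_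
        rw [← mul_assoc, h3, one_mul]
      simp only [hF]
      nlinarith
    have h5 : Real.exp ((lam - c) * t) = Real.exp (-(c * t)) * Real.exp (lam * t) := by
      rw [← Real.exp_add]; ring_nf
    rw [h5]
    have := mul_le_mul_of_nonneg_left (sub_le_iff_le_add.2 h2) (Real.exp_pos (-(c * t))).le
    linarith
  have h0 : χ t ≤ p 0 := by
    refine (hanti (mem_Ici.2 le_rfl) (mem_Ici.2 ht) ht).trans ?_
    simp only [hχ, hψ, intervalIntegral.integral_same, mul_zero, neg_zero, Real.exp_zero, add_zero,
      one_mul, mul_one]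
    have : 0 ≤ ρ / (lam - c) := by positivity
    linarith
  refine (hpψ t ht).trans ?_
  have h1 : Real.exp (-(lam * t)) = Real.exp (-((lam - c) * t)) * Real.exp (-(c * t)) := by
    rw [← Real.exp_add]; ring_nf
  have h2 : Real.exp (-((lam - c) * t)) * Real.exp ((lam - c) * t) = 1 := by
    rw [← Real.exp_add, neg_add_cancel, Real.exp_zero]
  have h3 := mul_le_mul_of_nonneg_left h0 (Real.exp_pos (-((lam - c) * t))).le
  simp only [hχ] at h3
  rw [h1]
  have h4 : Real.exp (-((lam - c) * t)) * (ρ / (lam - c) * Real.exp ((lam - c) * t)) =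
      ρ / (lam - c) := by
    rw [mul_left_comm, h2, mul_one]
  rw [mul_sub, h4] at h3
  linarith

namespace Eigensystem

variable {V : Type*} [NormedAddCommGroup V] [InnerProductSpace ℝ V] {T : V →ₗ.[ℝ] V} {ι : Type*}
  (E : Eigensystem T ι)

theorem norm_semigroupL_le (hT : IsPositiveCompactInverse T) (t : ℝ) (v : V) :
    ‖E.semigroupL hT t v‖ ≤ ‖v‖ :=
  (E.norm_apply_le (φ := fun l => Real.exp (-(max t 0 * l))) zero_le_one
    (E.semigroup_bound hT (le_max_right t 0)) v).trans_eq (one_mul _)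

theorem intervalIntegrable_semigroup_conv (hT : IsPositiveCompactInverse T) [MeasurableSpace V]
    [BorelSpace V] [SecondCountableTopology V] {h : ℝ → V} {t : ℝ} (ht : 0 ≤ t)
    (hc : ContinuousOn h (Ici 0)) :
    IntervalIntegrable (fun r => E.semigroup (t - r) (h r)) volume 0 t := by
  have hc' : Continuous fun r => h (max r 0) :=
    hc.comp_continuous (continuous_id.max continuous_const) fun r => mem_Ici.2 (le_max_right _ _)
  have h1 : IntervalIntegrable (fun r => E.semigroupL hT (t - r) (h (max r 0))) volume 0 t := by
    refine (hc'.intervalIntegrable 0 t).mono_fun ?_ (Eventually.of_forall fun r =>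
      E.norm_semigroupL_le hT _ _)
    exact (E.measurable_semigroupL hT (measurable_const.sub measurable_id)
      hc'.measurable).aestronglyMeasurable
  refine h1.congr fun r hr => ?_
  rw [uIoc_of_le ht] at hr
  simp only [E.semigroupL_apply hT (sub_nonneg.2 hr.2), max_eq_left hr.1.le]

end Eigensystem

section Comparison

open PathSpace

variable {V : Type*} [NormedAddCommGroup V] [InnerProductSpace ℝ V]
  [SecondCountableTopology V] [MeasurableSpace V] [BorelSpace V] {γ : ℝ≥0}
  {B : V →ₗ.[ℝ] V} {ι : Type*} {E : Eigensystem (-B) ι} {lam C₁ : ℝ}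

/-- The noise cancels: both solutions use a value of `B` at the same vector, and a graph is single
valued. -/
theorem IsMildSolution.sub_eq (hB : IsPositiveCompactInverse (-B)) {G₁ G₂ : V → V}
    (hG₁ : Continuous G₁) (hG₂ : Continuous G₂) {ω : PathSpace V γ} {a₁ a₂ : V} {y₁ y₂ : ℝ → V}
    (h₁ : IsMildSolution E G₁ ω a₁ y₁) (h₂ : IsMildSolution E G₂ ω a₂ y₂) {t : ℝ} (ht : 0 ≤ t) :
    y₁ t - y₂ t = E.semigroup t (a₁ - a₂) +
      ∫ r in (0 : ℝ)..t, E.semigroup (t - r) (G₁ (y₁ r) - G₂ (y₂ r)) := by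
  obtain ⟨w₁, hw₁, e₁⟩ := h₁.2 t ht
  obtain ⟨w₂, hw₂, e₂⟩ := h₂.2 t ht
  have hw : w₁ = w₂ := LinearPMap.mem_graph_snd_inj B hw₁ hw₂ rfl
  have h3 : ∫ r in (0 : ℝ)..t, E.semigroup (t - r) (G₁ (y₁ r) - G₂ (y₂ r)) =
      (∫ r in (0 : ℝ)..t, E.semigroup (t - r) (G₁ (y₁ r))) -
        ∫ r in (0 : ℝ)..t, E.semigroup (t - r) (G₂ (y₂ r)) := by
    rw [← intervalIntegral.integral_sub
      (E.intervalIntegrable_semigroup_conv hB ht (h := fun r => G₁ (y₁ r))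
        (hG₁.comp_continuousOn h₁.1))
      (E.intervalIntegrable_semigroup_conv hB ht (h := fun r => G₂ (y₂ r))
        (hG₂.comp_continuousOn h₂.1))]
    refine intervalIntegral.integral_congr fun r hr => ?_
    rw [uIcc_of_le ht] at hr
    simp only [← E.semigroupL_apply hB (sub_nonneg.2 hr.2), map_sub]
  rw [h3, e₁, e₂, hw, ← E.semigroupL_apply hB ht, ← E.semigroupL_apply hB ht,
    ← E.semigroupL_apply hB ht, map_sub]
  abel

theorem IsMildSolution.norm_sub_le (hB : IsPositiveCompactInverse (-B)) (hdec : E.HasDecay lam)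
    (hC₁ : 0 < C₁) (hgap : C₁ < lam) {G₁ G₂ : V → V} (hG₁ : Continuous G₁) (hG₂ : Continuous G₂)
    {ρ : ℝ} (hρ : 0 ≤ ρ) (hG : ∀ y₁ y₂, ‖G₁ y₁ - G₂ y₂‖ ≤ ρ + C₁ * ‖y₁ - y₂‖)
    {ω : PathSpace V γ} {y₁ y₂ : ℝ → V}
    (h₁ : IsMildSolution E G₁ ω (y₁ 0) y₁) (h₂ : IsMildSolution E G₂ ω (y₂ 0) y₂) {t : ℝ}
    (ht : 0 ≤ t) :
    ‖y₁ t - y₂ t‖ ≤ Real.exp (-((lam - C₁) * t)) * ‖y₁ 0 - y₂ 0‖ + ρ / (lam - C₁) := by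
  -- Mild solutions are continuous only on `[0, ∞)`; freezing them at time zero gives the globally
  -- continuous function that Gronwall's estimate expects.
  have hp : Continuous fun r => ‖y₁ (max r 0) - y₂ (max r 0)‖ :=
    ((h₁.1.sub h₂.1).comp_continuous (continuous_id.max continuous_const)
      fun r => mem_Ici.2 (le_max_right _ _)).norm
  have := le_of_le_exp_convolution hp hC₁ hgap hρ (fun s hs => ?_) ht
  · simpa only [max_eq_left ht, max_self] using this
  · simp only [max_eq_left hs, max_self]
    rw [h₁.sub_eq hB hG₁ hG₂ h₂ hs]
    refine norm_add_le_of_le (hdec s hs _) ?_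
    refine intervalIntegral.norm_integral_le_of_norm_le hs ?_
      (Continuous.intervalIntegrable (by fun_prop) _ _)
    refine Eventually.of_forall fun r hr => ?_
    refine (hdec _ (sub_nonneg.2 hr.2) _).trans ?_
    rw [max_eq_left hr.1.le]
    exact mul_le_mul_of_nonneg_left (hG _ _) (Real.exp_pos _).le

theorem IsTemperedAt.eventually_norm_le {Y : PathSpace V γ → V} {ω : PathSpace V γ}
    (h : IsTemperedAt (fun ω => ‖Y ω‖) ω) {ε : ℝ} (hε : 0 < ε) :
    ∀ᶠ t : ℝ in atTop, ‖Y (shift (-t) ω)‖ ≤ Real.exp (ε * t) := by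
  have h1 := h.2.comp tendsto_neg_atTop_atBot
  filter_upwards [h1.eventually (gt_mem_nhds hε), eventually_gt_atTop 0] with t ht ht0
  simp only [Function.comp_apply, abs_neg, abs_of_pos ht0, div_lt_iff₀ ht0] at ht
  have h2 : Real.log ‖Y (shift (-t) ω)‖ ≤ ε * t := by
    refine (le_max_right 0 _).trans ?_
    rw [← Real.posLog_apply]
    exact ht.le
  rcases (norm_nonneg (Y (shift (-t) ω))).eq_or_lt with h0 | h0
  · rw [← h0]
    exact (Real.exp_pos _).le
  · exact (Real.log_le_iff_le_exp h0).1 h2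

/-- Pullback argument: start both solutions at time `-t`. The contraction `exp (-(lam - C₁) t)`
beats the initial distance, which by temperedness grows at most at half that rate, and only the
forcing term survives as `t → ∞`. The case `ρ = 0` is uniqueness. -/
theorem norm_sub_le_of_tempered (hB : IsPositiveCompactInverse (-B)) (hdec : E.HasDecay lam)
    (hC₁ : 0 < C₁) (hgap : C₁ < lam) {G₁ G₂ : V → V} (hG₁ : Continuous G₁) (hG₂ : Continuous G₂)
    {ρ : ℝ} (hρ : 0 ≤ ρ) (hG : ∀ y₁ y₂, ‖G₁ y₁ - G₂ y₂‖ ≤ ρ + C₁ * ‖y₁ - y₂‖)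
    {Y₁ Y₂ : PathSpace V γ → V} {ω : PathSpace V γ}
    (h₁ : ∀ s, IsMildSolution E G₁ (shift s ω) (Y₁ (shift s ω))
      fun t => Y₁ (shift t (shift s ω)))
    (h₂ : ∀ s, IsMildSolution E G₂ (shift s ω) (Y₂ (shift s ω))
      fun t => Y₂ (shift t (shift s ω)))
    (ht₁ : IsTemperedAt (fun ω => ‖Y₁ ω‖) ω) (ht₂ : IsTemperedAt (fun ω => ‖Y₂ ω‖) ω) :
    ‖Y₁ ω - Y₂ ω‖ ≤ ρ / (lam - C₁) := by
  have hd : 0 < lam - C₁ := sub_pos.2 hgap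
  have hlim : Tendsto (fun t : ℝ => 2 * Real.exp (-((lam - C₁) / 2 * t)) + ρ / (lam - C₁)) atTop
      (𝓝 (2 * 0 + ρ / (lam - C₁))) := by
    refine ((Real.tendsto_exp_neg_atTop_nhds_zero.comp
      (tendsto_id.const_mul_atTop (half_pos hd))).const_mul 2).add_const _
  rw [mul_zero, zero_add] at hlim
  refine ge_of_tendsto hlim ?_
  filter_upwards [ht₁.eventually_norm_le (half_pos hd), ht₂.eventually_norm_le (half_pos hd),
    eventually_ge_atTop 0] with t e₁ e₂ ht
  have h3 := IsMildSolution.norm_sub_le hB hdec hC₁ hgap hG₁ hG₂ hρ hG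
    (y₁ := fun r => Y₁ (shift r (shift (-t) ω))) (y₂ := fun r => Y₂ (shift r (shift (-t) ω)))
    (by simpa only [shift_zero] using h₁ (-t)) (by simpa only [shift_zero] using h₂ (-t)) ht
  simp only [shift_shift, add_neg_cancel, zero_add, shift_zero] at h3
  refine h3.trans (add_le_add_left ?_ _)
  have h4 : ‖Y₁ (shift (-t) ω) - Y₂ (shift (-t) ω)‖ ≤ 2 * Real.exp ((lam - C₁) / 2 * t) := by
    linarith [norm_sub_le (Y₁ (shift (-t) ω)) (Y₂ (shift (-t) ω))]
  refine (mul_le_mul_of_nonneg_left h4 (Real.exp_pos _).le).trans_eq ?_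
  rw [mul_left_comm, ← Real.exp_add]
  ring_nf

/-- The fixed point depends Lipschitz continuously on the parameter. -/
theorem IsRandomFixedPoint.exists_lipschitz {P : Measure (PathSpace V γ)} {g : V → V → V}
    {Y : PathSpace V γ → V → V} (hY : IsRandomFixedPoint E g P Y)
    (hB : IsPositiveCompactInverse (-B)) (hdec : E.HasDecay lam)
    (hC₁ : 0 < C₁) (hgap : C₁ < lam)
    (hg : ∀ x₁ y₁ x₂ y₂, ‖g x₁ y₁ - g x₂ y₂‖ ≤ C₁ * (‖x₁ - x₂‖ + ‖y₁ - y₂‖)) :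
    ∃ S : Set (PathSpace V γ), IsInvariantFull P S ∧ ∀ ω ∈ S, ∀ x₁ x₂,
      ‖Y ω x₁ - Y ω x₂‖ ≤ C₁ / (lam - C₁) * ‖x₁ - x₂‖ := by
  obtain ⟨S, hS, h⟩ := hY.fixedPoint
  refine ⟨S, hS, fun ω hω x₁ x₂ => ?_⟩
  have hc : ∀ x, Continuous (g x) := fun x =>
    (LipschitzWith.of_dist_le' (K := C₁) fun y z => by
      simpa [dist_eq_norm] using hg x y x z).continuous
  refine (norm_sub_le_of_tempered (Y₁ := fun ω => Y ω x₁) (Y₂ := fun ω => Y ω x₂) hB hdec hC₁ hgap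
    (hc x₁) (hc x₂) (ρ := C₁ * ‖x₁ - x₂‖) (by positivity)
    (fun y₁ y₂ => (hg _ _ _ _).trans_eq (mul_add _ _ _))
    (fun s => (h _ (hS.shift_mem hω s) x₁).1) (fun s => (h _ (hS.shift_mem hω s) x₂).1)
    (h ω hω x₁).2 (h ω hω x₂).2).trans_eq ?_
  ring

end Comparison

/-! ### Averages under compact functions of an operator -/

namespace Eigensystem

variable {V : Type*} [NormedAddCommGroup V] [InnerProductSpace ℝ V] {T : V →ₗ.[ℝ] V} {ι : Type*}
  (E : Eigensystem T ι)

/-- The reciprocal eigenvalue is the diagonal coefficient of the bounded inverse at the eigenvector.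
-/
theorem exists_inv_eigenvalue_le (hT : IsPositiveCompactInverse T) :
    ∃ C : ℝ, 0 ≤ C ∧ ∀ i, (E.eigenvalue i)⁻¹ ≤ C := by
  obtain ⟨K, -, hK, -⟩ := hT.compact_inverse
  refine ⟨‖K‖, norm_nonneg K, fun i => ?_⟩
  have h1 := E.inner_inverse hT hK (E.basis i) i
  rw [real_inner_self_eq_norm_sq, E.basis.orthonormal.1, one_pow] at h1
  rw [inv_eq_of_mul_eq_one_right h1]
  refine (real_inner_le_norm _ _).trans ?_
  refine (mul_le_mul_of_nonneg_left (K.le_opNorm _) (norm_nonneg _)).trans_eq ?_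
  rw [E.basis.orthonormal.1, one_mul, mul_one]

/-- If `λ i⁻¹ ≥ ε`, the image of the `i`-th eigenvector under the inverse has distance at least `ε`
from the image of any other one. Compactness provides a finite `ε / 2`-net of the images, on which
the choice of a nearby point is then injective. -/
theorem tendsto_inv_eigenvalue (hT : IsPositiveCompactInverse T) :
    Tendsto (fun i => (E.eigenvalue i)⁻¹) cofinite (𝓝 0) := by
  classical
  obtain ⟨K, hKc, hK, -⟩ := hT.compact_inverse
  have hKe : ∀ i, K (E.basis i) = (E.eigenvalue i)⁻¹ • E.basis i := fun i =>
    E.basis.ext_inner fun j => by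
      have h1 := E.inner_inverse hT hK (E.basis i) j
      rw [inner_smul_right]
      by_cases hij : j = i
      · subst hij
        field_simp [(E.eigenvalue_pos hT j).ne']
        linarith
      · rw [E.basis.orthonormal.2 hij] at h1 ⊢
        rw [mul_zero]
        exact (mul_eq_zero.1 h1).resolve_left (E.eigenvalue_pos hT j).ne'
  rw [Metric.tendsto_nhds]
  intro ε hε
  rw [eventually_cofinite]
  set F : Set ι := {i | ¬ dist (E.eigenvalue i)⁻¹ 0 < ε}
  have hF : ∀ i ∈ F, ε ≤ (E.eigenvalue i)⁻¹ := fun i hi => by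
    have : ¬ dist (E.eigenvalue i)⁻¹ 0 < ε := hi
    rwa [Real.dist_eq, sub_zero, abs_of_pos (inv_pos.2 (E.eigenvalue_pos hT i)), not_lt] at this
  have htb := ((hKc.isCompact_closure_image_closedBall 1).totallyBounded).subset subset_closure
  obtain ⟨t, ht, hcov⟩ := Metric.totallyBounded_iff.1 htb (ε / 2) (by positivity)
  have hc : ∀ i, ∃ y ∈ t, dist (K (E.basis i)) y < ε / 2 := fun i => by
    have h1 := hcov ⟨E.basis i, by simp [E.basis.orthonormal.1 i], rfl⟩
    simpa using h1
  choose c hct hcd using hc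
  refine Set.Finite.of_injOn (f := c) (t := t) (fun i _ => hct i) (fun i hi j hj hij => ?_) ht
  by_contra hne
  have h1 : ‖K (E.basis i) - K (E.basis j)‖ < ε := by
    rw [← dist_eq_norm]
    have := dist_triangle_right (K (E.basis i)) (K (E.basis j)) (c i)
    have h2 := hcd i
    have h3 := hcd j
    rw [← hij] at h3
    linarith
  have h2 := abs_real_inner_le_norm (E.basis i) (K (E.basis i) - K (E.basis j))
  rw [E.basis.orthonormal.1, one_mul, hKe, hKe, inner_sub_right, inner_smul_right,
    inner_smul_right, E.basis.orthonormal.2 hne, real_inner_self_eq_norm_sq,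
    E.basis.orthonormal.1] at h2
  rw [hKe, hKe] at h1
  have h3 := hF i hi
  have h4 := le_abs_self ((E.eigenvalue i)⁻¹ * 1 ^ 2 - (E.eigenvalue j)⁻¹ * 0)
  linarith

theorem exists_abs_rpow_neg_le (hT : IsPositiveCompactInverse T) {ν : ℝ} (hν : 0 < ν) :
    ∃ C : ℝ, 0 ≤ C ∧ ∀ i, |E.eigenvalue i ^ (-ν)| ≤ C := by
  obtain ⟨C, hC0, hC⟩ := E.exists_inv_eigenvalue_le hT
  refine ⟨C ^ ν, by positivity, fun i => ?_⟩
  have h0 := E.eigenvalue_pos hT i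
  rw [Real.rpow_neg h0.le, ← Real.inv_rpow h0.le, abs_of_nonneg (by positivity)]
  exact Real.rpow_le_rpow (by positivity) (hC i) hν.le

theorem tendsto_rpow_neg (hT : IsPositiveCompactInverse T) {ν : ℝ} (hν : 0 < ν) :
    Tendsto (fun i => E.eigenvalue i ^ (-ν)) cofinite (𝓝 0) := by
  have h1 := (E.tendsto_inv_eigenvalue hT).rpow_const (p := ν) (Or.inr hν.le)
  rw [Real.zero_rpow hν.ne'] at h1
  refine h1.congr fun i => ?_
  have h0 := E.eigenvalue_pos hT i
  rw [Real.rpow_neg h0.le, ← Real.inv_rpow h0.le]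

/-- A compact function of the operator turns bounded weakly null families into null families. -/
theorem tendsto_apply_zero {φ : ℝ → ℝ} {K : ℝ} (hφ : ∀ i, |φ (E.eigenvalue i)| ≤ K)
    (hφ0 : Tendsto (fun i => φ (E.eigenvalue i)) cofinite (𝓝 0)) {α : Type*} {l : Filter α}
    {v : α → V} {M : ℝ} (hM : ∀ᶠ a in l, ‖v a‖ ≤ M)
    (hv : ∀ i, Tendsto (fun a => inner ℝ (E.basis i) (v a)) l (𝓝 0)) :
    Tendsto (fun a => E.apply φ (v a)) l (𝓝 0) := by
  classical
  rw [Metric.tendsto_nhds]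
  intro ε hε
  -- Coefficients below `δ` contribute at most `ε / 2` on vectors of norm at most `M`; only finitely
  -- many coordinates remain. The `+ 1` avoids division by zero.
  set δ := ε / (2 * (|M| + 1))
  have hδ : 0 < δ := by positivity
  have hfin : {i | ¬ dist (φ (E.eigenvalue i)) 0 < δ}.Finite :=
    eventually_cofinite.1 (hφ0.eventually (Metric.ball_mem_nhds 0 hδ))
  set s := hfin.toFinset
  have hs : ∀ i ∉ s, |φ (E.eigenvalue i)| ≤ δ := fun i hi => by
    simp only [s, Set.Finite.mem_toFinset, mem_ofPred_eq, not_not, Real.dist_eq, sub_zero] at hi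
    exact hi.le
  set p : α → V := fun a => ∑ i ∈ s, (φ (E.eigenvalue i) * inner ℝ (E.basis i) (v a)) • E.basis i
  have hp : Tendsto p l (𝓝 0) := by
    have : Tendsto p l (𝓝 (∑ i ∈ s, (φ (E.eigenvalue i) * 0) • E.basis i)) :=
      tendsto_finsetSum _ fun i _ => ((hv i).const_mul _).smul_const _
    simpa using this
  have hrest : ∀ a, ‖E.apply φ (v a) - p a‖ ≤ δ * ‖v a‖ := fun a => by
    refine E.basis.norm_le_mul_of_inner_le hδ.le fun j => ?_
    have h1 : inner ℝ (E.basis j) (p a) =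
        if j ∈ s then φ (E.eigenvalue j) * inner ℝ (E.basis j) (v a) else 0 := by
      simp only [p, inner_sum, inner_smul_right, orthonormal_iff_ite.1 E.basis.orthonormal]
      simp
    rw [inner_sub_right, E.inner_apply hφ, h1]
    split_ifs with hj
    · rw [sub_self, abs_zero]
      positivity
    · rw [sub_zero, abs_mul]
      exact mul_le_mul_of_nonneg_right (hs j hj) (abs_nonneg _)
  filter_upwards [hM, hp.eventually (Metric.ball_mem_nhds 0 (half_pos hε))] with a ha hpa
  rw [dist_zero_right]
  have hpa' : ‖p a‖ < ε / 2 := by simpa using hpa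
  have h2 := norm_add_le (E.apply φ (v a) - p a) (p a)
  rw [sub_add_cancel] at h2
  have h3 : δ * ‖v a‖ ≤ ε / 2 := by
    have h4 : ‖v a‖ ≤ |M| + 1 := by linarith [le_abs_self M]
    refine (mul_le_mul_of_nonneg_left h4 hδ.le).trans_eq ?_
    simp only [δ]
    field_simp
  linarith [hrest a]

/-- The averages of `h` are bounded and converge weakly to zero; the bounded operator commutes with
the integral and, being compact, makes the convergence strong. -/
theorem tendsto_norm_average_apply [CompleteSpace V] [MeasurableSpace V] [BorelSpace V]
    [SecondCountableTopology V] {φ : ℝ → ℝ} {K : ℝ} (hK : 0 ≤ K)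
    (hφ : ∀ i, |φ (E.eigenvalue i)| ≤ K)
    (hφ0 : Tendsto (fun i => φ (E.eigenvalue i)) cofinite (𝓝 0)) {h : ℝ → V} (hm : Measurable h)
    {M : ℝ} (hM : ∀ r, ‖h r‖ ≤ M)
    (hh : ∀ i, HasTimeAverage (fun r => inner ℝ (E.basis i) (h r)) 0) :
    Tendsto (fun t : ℝ => 1 / |t| * ‖∫ r in (0 : ℝ)..t, E.apply φ (h r)‖) atTop (𝓝 0) := by
  have hint : ∀ t, IntervalIntegrable h volume 0 t := fun t =>
    intervalIntegrable_of_bounded hm.aestronglyMeasurable hM 0 t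
  have h1 := E.tendsto_apply_zero hφ hφ0 (l := atTop) (v := fun t : ℝ => t⁻¹ • ∫ r in (0 : ℝ)..t, h r)
    (M := M) ?_ fun i => ?_
  · have h2 := h1.norm
    rw [norm_zero] at h2
    refine h2.congr' ?_
    filter_upwards [eventually_gt_atTop 0] with t ht
    rw [← E.coe_applyL hK hφ, map_smul, ← ContinuousLinearMap.intervalIntegral_comp_comm _ (hint t),
      norm_smul, norm_inv, Real.norm_eq_abs, one_div]
  · filter_upwards [eventually_gt_atTop 0] with t ht
    have h2 := intervalIntegral.norm_integral_le_of_norm_le_const (a := 0) (b := t)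
      (fun r _ => hM r)
    rw [sub_zero, abs_of_pos ht] at h2
    rw [norm_smul, norm_inv, Real.norm_eq_abs, abs_of_pos ht, inv_mul_le_iff₀ ht, mul_comm]
    exact h2
  · refine (hh i).congr fun t => ?_
    have h3 := (innerSL ℝ (E.basis i)).intervalIntegral_comp_comm (hint t)
    simp only [innerSL_apply_apply] at h3
    rw [inner_smul_right, h3, div_eq_inv_mul]

end Eigensystem

/-! ### Time averages of the coefficient along the fixed point -/

theorem HasTimeAverage.of_approx {h : ℝ → ℝ} {m : ℝ}
    (hint : ∀ a b, IntervalIntegrable h volume a b)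
    (H : ∀ ε : ℝ, 0 < ε → ∃ (k : ℝ → ℝ) (n : ℝ), HasTimeAverage k n ∧
      (∀ a b, IntervalIntegrable k volume a b) ∧ (∀ r, |h r - k r| ≤ ε) ∧ |m - n| ≤ ε) :
    HasTimeAverage h m := by
  rw [HasTimeAverage, Metric.tendsto_nhds]
  intro ε hε
  obtain ⟨k, n, hk, hki, h1, h2⟩ := H (ε / 4) (by positivity)
  filter_upwards [hk.eventually (Metric.ball_mem_nhds n (show 0 < ε / 4 by positivity)),
    eventually_gt_atTop 0] with t ht ht0
  have h3 := intervalIntegral.norm_integral_le_of_norm_le_const (a := 0) (b := t)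
    (f := fun r => h r - k r) (fun r _ => h1 r)
  rw [intervalIntegral.integral_sub (hint 0 t) (hki 0 t), sub_zero, abs_of_pos ht0,
    Real.norm_eq_abs] at h3
  have h4 : |(∫ r in (0 : ℝ)..t, h r) / t - (∫ r in (0 : ℝ)..t, k r) / t| ≤ ε / 4 := by
    rw [← sub_div, abs_div, abs_of_pos ht0, div_le_iff₀ ht0]
    exact h3
  rw [Real.dist_eq] at ht ⊢
  rw [abs_lt] at ht ⊢
  rw [abs_le] at h4 h2
  constructor <;> linarith

section

open PathSpace

variable {V : Type*} [NormedAddCommGroup V] [InnerProductSpace ℝ V] [CompleteSpace V]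
  [SecondCountableTopology V] [MeasurableSpace V] [BorelSpace V] {γ : ℝ≥0}
  {P : Measure (PathSpace V γ)} {f : V → V → V} {Y : PathSpace V γ → V → V} {L M : ℝ}

theorem integrable_drift [IsProbabilityMeasure P] (hY : ∀ x, Measurable fun ω => Y ω x)
    (hf : ∀ x, Continuous (f x)) (hM : ∀ x y, ‖f x y‖ ≤ M) (x : V) :
    Integrable (fun ω => f x (Y ω x)) P :=
  Integrable.of_bound (C := M) ((hf x).measurable.comp (hY x)).aestronglyMeasurable
    (Eventually.of_forall fun _ => hM _ _)

theorem norm_averagedDrift_sub_le [IsProbabilityMeasure P] (hY : ∀ x, Measurable fun ω => Y ω x)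
    (hf : ∀ x, Continuous (f x)) (hM : ∀ x y, ‖f x y‖ ≤ M) {S : Set (PathSpace V γ)}
    (hS : IsInvariantFull P S)
    (hL : ∀ ω ∈ S, ∀ x₁ x₂, ‖f x₁ (Y ω x₁) - f x₂ (Y ω x₂)‖ ≤ L * ‖x₁ - x₂‖) (x₁ x₂ : V) :
    ‖averagedDrift f P Y x₁ - averagedDrift f P Y x₂‖ ≤ L * ‖x₁ - x₂‖ := by
  rw [averagedDrift, averagedDrift, ← integral_sub (integrable_drift hY hf hM x₁)
    (integrable_drift hY hf hM x₂)]
  have := norm_integral_le_of_norm_le_const (μ := P) (C := L * ‖x₁ - x₂‖)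
    (f := fun ω => f x₁ (Y ω x₁) - f x₂ (Y ω x₂)) ?_
  · simpa using this
  · have h1 : ∀ᵐ ω ∂P, ω ∈ S := hS.full
    filter_upwards [h1] with ω hω using hL ω hω x₁ x₂

/-- On an invariant set of full measure that does not depend on `x`, all coordinates of the drift
have the right time averages in both directions. -/
theorem IsFBMLaw.exists_hasTimeAverage_inner {H : ℝ} {Q : V →L[ℝ] V} (hP : IsFBMLaw H Q P)
    (hH₁ : H < 1) {κ : Type*} (b : HilbertBasis κ ℝ V)
    (hY : ∀ x, Measurable fun ω => Y ω x)
    (hf : ∀ x, Continuous (f x)) (hM : ∀ x y, ‖f x y‖ ≤ M) {S : Set (PathSpace V γ)}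
    (hS : IsInvariantFull P S) (hL0 : 0 ≤ L)
    (hL : ∀ ω ∈ S, ∀ x₁ x₂, ‖f x₁ (Y ω x₁) - f x₂ (Y ω x₂)‖ ≤ L * ‖x₁ - x₂‖) :
    ∃ S' : Set (PathSpace V γ), IsInvariantFull P S' ∧ ∀ ω ∈ S', ∀ x i,
      HasTimeAverage (fun r => inner ℝ (b i) (f x (Y (shift r ω) x)))
        (inner ℝ (b i) (averagedDrift f P Y x)) ∧
      HasTimeAverage (fun r => inner ℝ (b i) (f x (Y (shift (-r) ω) x)))
        (inner ℝ (b i) (averagedDrift f P Y x)) := by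
  have := hP.isProbabilityMeasure
  have := b.countable_index
  have hFm : ∀ x i, Measurable fun ω => inner ℝ (b i) (f x (Y ω x)) := fun x i =>
    measurable_const.inner ((hf x).measurable.comp (hY x))
  have hFb : ∀ x i ω, |inner ℝ (b i) (f x (Y ω x))| ≤ M := fun x i ω => by
    refine (abs_real_inner_le_norm _ _).trans ?_
    rw [b.orthonormal.1, one_mul]
    exact hM _ _
  -- Countably many parameters and coordinates keep the intersection of the averaging sets of full
  -- measure.
  let d := TopologicalSpace.denseSeq V
  have hA := fun p : ℕ × κ => hP.isInvariantFull_averagingPaths hH₁ (hFm (d p.1) p.2)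
    (hFb (d p.1) p.2)
  refine ⟨_, hS.inter (IsInvariantFull.iInter hA), fun ω hω x i => ?_⟩
  have hmean : ∀ x, ∫ ω, inner ℝ (b i) (f x (Y ω x)) ∂P = inner ℝ (b i) (averagedDrift f P Y x) :=
    fun x => integral_inner (integrable_drift hY hf hM x) (b i)
  have hii : ∀ {σ : ℝ → ℝ}, Measurable σ → ∀ x a c, IntervalIntegrable
      (fun r => inner ℝ (b i) (f x (Y (shift (σ r) ω) x))) volume a c := fun hσ x a c =>
    intervalIntegrable_of_bounded ((hFm x i).comp
      ((measurable_shift_left ω).comp hσ)).aestronglyMeasurable (fun r => hFb _ _ _) a c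
  -- The Lipschitz bound holds along the whole orbit because `S` is invariant, so replacing `x` by a
  -- nearby `d n` changes the integrand uniformly little. Here `σ` is the identity or the reflection
  -- of time.
  have key : ∀ {σ : ℝ → ℝ}, Measurable σ →
      (∀ n, HasTimeAverage (fun r => inner ℝ (b i) (f (d n) (Y (shift (σ r) ω) (d n))))
        (inner ℝ (b i) (averagedDrift f P Y (d n)))) →
      HasTimeAverage (fun r => inner ℝ (b i) (f x (Y (shift (σ r) ω) x)))
        (inner ℝ (b i) (averagedDrift f P Y x)) := fun {σ} hσ h => by
    refine HasTimeAverage.of_approx (hii hσ x) fun ε hε => ?_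
    obtain ⟨n, hn⟩ : ∃ n, L * ‖x - d n‖ ≤ ε := by
      obtain ⟨_, hy, n, rfl⟩ := Metric.dense_iff.1 (TopologicalSpace.denseRange_denseSeq V) x
        (ε / (L + 1)) (by positivity)
      rw [Metric.mem_ball, dist_comm, dist_eq_norm] at hy
      refine ⟨n, ?_⟩
      have h1 : (L + 1) * ‖x - d n‖ ≤ ε := by
        rw [← le_div_iff₀' (by positivity)]
        exact hy.le
      nlinarith [norm_nonneg (x - d n)]
    refine ⟨_, _, h n, hii hσ (d n), fun r => ?_, ?_⟩
    · rw [← inner_sub_right]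
      refine (abs_real_inner_le_norm _ _).trans ?_
      rw [b.orthonormal.1, one_mul]
      exact (hL _ (hS.shift_mem hω.1 _) _ _).trans hn
    · rw [← inner_sub_right]
      refine (abs_real_inner_le_norm _ _).trans ?_
      rw [b.orthonormal.1, one_mul]
      exact (norm_averagedDrift_sub_le hY hf hM hS hL _ _).trans hn
  constructor
  · refine key measurable_id fun n => ?_
    have := (mem_iInter.1 hω.2 (n, i)).1
    rwa [hmean] at this
  · refine key measurable_neg fun n => ?_
    have := (mem_iInter.1 hω.2 (n, i)).2
    rwa [hmean] at this

end

theorem HasTimeAverage.sub_mean {h : ℝ → ℝ} {m : ℝ} (H : HasTimeAverage h m)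
    (hint : ∀ a b, IntervalIntegrable h volume a b) :
    HasTimeAverage (fun r => h r - m) 0 := by
  have h1 := Tendsto.sub_const H m
  rw [sub_self] at h1
  refine h1.congr' ?_
  filter_upwards [eventually_gt_atTop 0] with t ht
  rw [intervalIntegral.integral_sub (hint 0 t) intervalIntegrable_const,
    intervalIntegral.integral_const, sub_zero, sub_div, smul_eq_mul, mul_div_cancel_left₀ _ ht.ne']

/-! ### Proof of the theorem -/

theorem lemma4p8 {V : Type*} [NormedAddCommGroup V] [InnerProductSpace ℝ V] [CompleteSpace V]
    [TopologicalSpace.SeparableSpace V] [MeasurableSpace V] [BorelSpace V]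
    -- the operators `A`, `B`, with eigensystems of `-A`, `-B`
    (A B : V →ₗ.[ℝ] V) (hA : IsPositiveCompactInverse (-A)) (hB : IsPositiveCompactInverse (-B))
    {ιA ιB : Type*} (eA : Eigensystem (-A) ιA) (eB : Eigensystem (-B) ιB)
    -- the decay rate of the semigroup of `B`
    (lamB : ℝ) (hlamB : ∀ t : ℝ, 0 ≤ t → ∀ v : V,
      ‖eB.semigroup t v‖ ≤ Real.exp (-(lamB * t)) * ‖v‖)
    -- the coefficients
    (f g : V → V → V) (C₁ : ℝ) (hC₁ : 0 < C₁)
    (hLip : ∀ x₁ y₁ x₂ y₂ : V, ‖f x₁ y₁ - f x₂ y₂‖ + ‖g x₁ y₁ - g x₂ y₂‖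
      ≤ C₁ * (‖x₁ - x₂‖ + ‖y₁ - y₂‖))
    (hbdd : ∃ M : ℝ, ∀ x y : V, ‖f x y‖ ≤ M)
    (hgap : C₁ < lamB)
    -- the noise
    (H : ℝ) (hH₀ : 0 < H) (hH₁ : H < 1) (γ : ℝ≥0) (hγ₀ : 0 < γ) (hγH : (γ : ℝ) < H)
    (Q : V →L[ℝ] V) (hQ : IsTraceClassCovariance Q)
    (P : Measure (PathSpace V γ)) (hP : IsFBMLaw H Q P) :
    -- the fast equation has a tempered random fixed point
    (∃ Y : PathSpace V γ → V → V, IsRandomFixedPoint eB g P Y) ∧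
    -- and every such fixed point has the ergodic property
    ∀ Y : PathSpace V γ → V → V, IsRandomFixedPoint eB g P Y →
      (∃ K : ℝ≥0, LipschitzWith K (averagedDrift f P Y)) ∧
      ∀ ν : ℝ, 0 < ν → ∃ S : Set (PathSpace V γ), PathSpace.IsInvariantFull P S ∧
        ∀ ω ∈ S, ∀ x : V,
          Tendsto (fun T : ℝ => 1 / |T| * ‖∫ r in (0 : ℝ)..T,
            eA.negPow ν (f x (Y (PathSpace.shift r ω) x) - averagedDrift f P Y x)‖)
            atTop (𝓝 0) ∧
          Tendsto (fun T : ℝ => 1 / |T| * ‖∫ r in (0 : ℝ)..T,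
            eA.negPow ν (f x (Y (PathSpace.shift r ω) x) - averagedDrift f P Y x)‖)
            atBot (𝓝 0) := by
  have : SecondCountableTopology V := UniformSpace.secondCountable_of_separable V
  have hγ1 : γ ≤ 1 := by
    rw [← NNReal.coe_le_coe, NNReal.coe_one]
    linarith
  have hdec : eB.HasDecay lamB := hlamB
  have hf : ∀ x₁ y₁ x₂ y₂, ‖f x₁ y₁ - f x₂ y₂‖ ≤ C₁ * (‖x₁ - x₂‖ + ‖y₁ - y₂‖) :=
    fun x₁ y₁ x₂ y₂ => (le_add_of_nonneg_right (norm_nonneg _)).trans (hLip x₁ y₁ x₂ y₂)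
  have hg : ∀ x₁ y₁ x₂ y₂, ‖g x₁ y₁ - g x₂ y₂‖ ≤ C₁ * (‖x₁ - x₂‖ + ‖y₁ - y₂‖) :=
    fun x₁ y₁ x₂ y₂ => (le_add_of_nonneg_left (norm_nonneg _)).trans (hLip x₁ y₁ x₂ y₂)
  refine ⟨hP.exists_isRandomFixedPoint hH₁ hγ₀ hγ1 hB eB hdec hC₁ hgap
    fun x y₁ y₂ => by simpa using hg x y₁ x y₂, fun Y hY => ?_⟩
  have := hP.isProbabilityMeasure
  obtain ⟨M, hM⟩ := hbdd
  obtain ⟨S, hS, hYL⟩ := hY.exists_lipschitz hB hdec hC₁ hgap hg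
  have hfc : ∀ x, Continuous (f x) := fun x => (LipschitzWith.of_dist_le' (K := C₁) fun y z => by
    simpa [dist_eq_norm] using hf x y x z).continuous
  have hd : 0 < lamB - C₁ := sub_pos.2 hgap
  -- This is the Lipschitz constant of `x ↦ f(x, Y(ω, x))`: `C₁` from `f`, and `C₁ / (lamB - C₁)`
  -- from the fixed point.
  have hL0 : 0 ≤ C₁ * (1 + C₁ / (lamB - C₁)) := by positivity
  have hL : ∀ ω ∈ S, ∀ x₁ x₂, ‖f x₁ (Y ω x₁) - f x₂ (Y ω x₂)‖ ≤
      C₁ * (1 + C₁ / (lamB - C₁)) * ‖x₁ - x₂‖ := fun ω hω x₁ x₂ => by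
    refine (hf _ _ _ _).trans ?_
    rw [mul_assoc, add_mul, one_mul]
    exact mul_le_mul_of_nonneg_left (add_le_add_right (hYL ω hω x₁ x₂) _) hC₁.le
  have hLip' := norm_averagedDrift_sub_le hY.measurable hfc hM hS hL
  refine ⟨⟨_, LipschitzWith.of_dist_le' fun x₁ x₂ => by
    simpa only [dist_eq_norm] using hLip' x₁ x₂⟩, fun ν hν => ?_⟩
  -- The coordinates are taken in the eigenbasis of `-A`, where negative powers act diagonally.
  obtain ⟨S', hS', hav⟩ := hP.exists_hasTimeAverage_inner hH₁ eA.basis hY.measurable hfc hM hS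
    hL0 hL
  obtain ⟨K, hK, hKν⟩ := eA.exists_abs_rpow_neg_le hA hν
  have key : ∀ {σ : ℝ → ℝ}, Measurable σ → ∀ (ω : PathSpace V γ) (x : V),
      (∀ i, HasTimeAverage (fun r => inner ℝ (eA.basis i) (f x (Y (PathSpace.shift (σ r) ω) x)))
        (inner ℝ (eA.basis i) (averagedDrift f P Y x))) →
      Tendsto (fun T : ℝ => 1 / |T| * ‖∫ r in (0 : ℝ)..T,
        eA.negPow ν (f x (Y (PathSpace.shift (σ r) ω) x) - averagedDrift f P Y x)‖)
        atTop (𝓝 0) := fun {σ} hσ ω x h => by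
    have hm : Measurable fun r => f x (Y (PathSpace.shift (σ r) ω) x) :=
      (hfc x).measurable.comp ((hY.measurable x).comp
        ((PathSpace.measurable_shift_left ω).comp hσ))
    refine eA.tendsto_norm_average_apply hK hKν (eA.tendsto_rpow_neg hA hν)
      (hm.sub_const (averagedDrift f P Y x)) (M := M + ‖averagedDrift f P Y x‖)
      (fun r => (norm_sub_le _ _).trans (add_le_add_left (hM _ _) _)) fun i => ?_
    simp only [inner_sub_right]
    refine (h i).sub_mean ?_
    exact intervalIntegrable_of_bounded (measurable_const.inner hm).aestronglyMeasurable
      (M := M) (fun r => (norm_inner_le_norm _ _).trans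
        (by rw [eA.basis.orthonormal.1, one_mul]; exact hM _ _))
  refine ⟨S', hS', fun ω hω x => ⟨key measurable_id ω x fun i => (hav ω hω x i).1, ?_⟩⟩
  -- The limit at `-∞` is the forward limit along the reversed orbit, by the substitution `r ↦ -r`.
  refine ((key measurable_neg ω x fun i => (hav ω hω x i).2).comp tendsto_neg_atBot_atTop).congr
    fun T => ?_
  simp only [Function.comp_apply, abs_neg]
  rw [intervalIntegral.integral_comp_neg fun r =>
    eA.negPow ν (f x (Y (PathSpace.shift r ω) x) - averagedDrift f P Y x), neg_neg, neg_zero,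
    intervalIntegral.integral_symm, norm_neg]
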